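/- A $3$-graph $G=([n],E(G))$ consists of the vertex set $[n]=\{1,\dots,n\}$ and a set $E(G)$ of $3$-element subsets of $[n]$, called edges. Its Lagrangian is $$\lambda(G)=\max\Big\{\sum_{\{i,j,k\}\in E(G)}x_ix_jx_k \;:\; x_1,\dots,x_n\ge 0,\ \sum_{i=1}^n x_i=1\Big\}.$$ $G$ is left-compressed if, whenever $\{j_1,j_2,j_3\}\in E(G)$ and $i_1,i_2,i_3\in[n]$ are distinct with $i_p\le j_p$ for $p=1,2,3$, also $\{i_1,i_2,i_3\}\in E(G)$. A $3$-graph $G$ with $m$ edges is extremal if $\lambda(G)$ is the maximum of $\lambda(H)$ over all $3$-graphs $H$ with $m$ edges (on any number of vertices). For distinct $3$-element sets $A,B$ of positive integers, $A$ precedes $B$ in colex order if $\max(A\triangle B)\in B$, and $C_{3,m}$ is the $3$-graph whose edges are the first $m$ three-element sets of positive integers in colex order, its vertex set being $[n]$ for the largest integer $n$ contained in an edge. **Theorem 1.12.** Let $m$ be a positive integer, and let $G$ be a left-compressed extremal $3$-graph with $m$ edges such that $|E(G)\,\triangle\,E(C_{3,m})|\le 6$. Then $\lambda(G)\le\lambda(C_{3,m})$.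 -/

import Mathlib

open Finset

/-- An `r`-uniform hypergraph with vertex set `[n] = {1, …, n}`. -/
structure RGraph (r : ℕ) where
  /-- The number of vertices; the vertex set is `Finset.Icc 1 n`. -/
  n : ℕ
  /-- The edge set. -/
  edges : Finset (Finset ℕ)
  subset_vertices : ∀ e ∈ edges, e ⊆ Finset.Icc 1 n
  card_eq : ∀ e ∈ edges, e.card = r

namespace RGraph

variable {r : ℕ}

/-- The polynomial `λ(G, x) = ∑_{i₁ ⋯ iᵣ ∈ E(G)} x_{i₁} ⋯ x_{iᵣ}`. A vector of `ℝⁿ` is given as a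
function on `ℕ`, of which only the values at `1, …, n` matter. -/
noncomputable def weightPoly (G : RGraph r) (x : ℕ → ℝ) : ℝ :=
  ∑ e ∈ G.edges, ∏ i ∈ e, x i

/-- `x` is a legal weighting: `x₁, …, xₙ ≥ 0` and `x₁ + ⋯ + xₙ = 1`. -/
def IsLegalWeighting (G : RGraph r) (x : ℕ → ℝ) : Prop :=
  (∀ i ∈ Finset.Icc 1 G.n, 0 ≤ x i) ∧ ∑ i ∈ Finset.Icc 1 G.n, x i = 1

/-- The Lagrangian `λ(G)`, the maximum of `λ(G, x)` over all legal weightings `x`. (The maximum of a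
continuous function on a simplex, which is non-empty as soon as `n ≥ 1`; in particular as soon as
`G` has an edge and `r ≥ 1`.) -/
noncomputable def lagrangian (G : RGraph r) : ℝ :=
  sSup {l : ℝ | ∃ x : ℕ → ℝ, G.IsLegalWeighting x ∧ G.weightPoly x = l}

/-- `G` is extremal: `λ(G)` is the maximum of the Lagrangians of all `r`-graphs that have as many
edges as `G` (and any number of vertices). -/
def IsExtremal (G : RGraph r) : Prop :=
  IsGreatest {l : ℝ | ∃ H : RGraph r, H.edges.card = G.edges.card ∧ H.lagrangian = l} G.lagrangian

/-- `G` is left-compressed: if `j₁ ⋯ jᵣ` is an edge and `i₁, …, iᵣ` are distinct vertices with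
`i_p ≤ j_p` for every `p`, then `i₁ ⋯ iᵣ` is an edge. -/
def IsLeftCompressed (G : RGraph r) : Prop :=
  ∀ i j : Fin r → ℕ, Function.Injective i → (∀ p, 1 ≤ i p) → (∀ p, i p ≤ j p) →
    Finset.univ.image j ∈ G.edges → Finset.univ.image i ∈ G.edges

end RGraph

/-- The first `m` sets, in colex order, among the `r`-element sets of positive integers (`r ≥ 1`):
those with fewer than `m` predecessors. Sets preceding a subset of `[m + r]` are themselves
subsets of `[m + r]`, and `[m + r]` has at least `m` subsets of size `r`, so that it is enough
to look at these. -/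
def colexFirst (r m : ℕ) : Finset (Finset ℕ) :=
  {A ∈ Finset.powersetCard r (Finset.Icc 1 (m + r)) |
    #{B ∈ Finset.powersetCard r (Finset.Icc 1 (m + r)) | toColex B < toColex A} < m}

/-- The `r`-graph `C_{r,m}`, whose edges are the first `m` sets of size `r` in colex order; its
vertex set is `[n]` for the largest integer `n` in an edge. -/
def colexGraph (r m : ℕ) : RGraph r where
  n := (colexFirst r m).sup fun e => e.sup id
  edges := colexFirst r m
  subset_vertices := by
    intro e he i hi
    have h := (Finset.mem_powersetCard.1 (Finset.mem_filter.1 he).1).1 hi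
    rw [Finset.mem_Icc] at h ⊢
    exact ⟨h.1, (Finset.le_sup (f := id) hi).trans
      (Finset.le_sup (f := fun e : Finset ℕ => e.sup id) he)⟩
  card_eq := by
    intro e he
    exact (Finset.mem_powersetCard.1 (Finset.mem_filter.1 he).1).2

/-! Choose `t` with `(t - 1).choose 3 < m ≤ t.choose 3`, so that the colex graph `C` lies between
the complete graphs on `[t - 1]` and on `[t]`. By `RGraph.IsLeftCompressed.exists_isOptimal`, `G`
has an optimal weighting `x` that is positive and non-increasing on an initial segment `[k]`, any
two vertices of which lie in an edge inside `[k]`. If `k < t`, every triple of positive weight is an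
edge of `C`. If `k > t`, compression of the edge `{1, k - 1, k}` puts so many triples through `t +
1` into `G \ C` that only `t = 3, 4` survive, and there `G` has too many edges.

The substance is `k = t`. Extremality forces all edges into `[t]`, and one passes to the complements
in `[t]` with the vertices reversed: `M` for `G` and `L` for `C`, of equal size, each with at most
three triples outside the other. Now `M` is closed downwards, the weights `z` increase, and `z`
together with `M` maximises `e₃(z) - M(z)` over all families of that size and all weightings
(`ExtremalComplement`). On the simplex `e₃` is a function of power sums, so the Lagrange conditions
say that `z i - z i ^ 2` plus the derivative of `M` at `i` is constant.

The triples `{1, 2, j}` in `M` are those with `j < p`; let `D` be the rest of `M`. If `L` consists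
of triples through `{1, 2}`, then `#D ≤ 3`, and for each non-empty down-closed `D` the star with `p
+ #D` in place of `p`, with suitably shifted weights, would do better
(`sdiff_starTriples_eq_empty`); so `D` is empty and `M = L`. Otherwise `L` contains the full star,
`M` misses `d ≤ 3` triples of it, and `#D > d`. Then `mul_le_edgeSum` shows that moving the weight
of vertex `1` to vertex `2` loses no more in `e₃` than `M(z)`. The new weighting vanishes on
reversed vertex `1`, which every non-edge of `C` in `[t]` contains, so `C` attains at least the
Lagrangian of `G`. `ExtremalComplement.eq_or_mul_le_edgeSum` combines the two cases. -/

/-! ### Initial segments of the colex order -/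

theorem card_filter_rank_lt {ι α : Type*} [LinearOrder α] (g : ι → α)
    (hg : Function.Injective g) (S : Finset ι) {m : ℕ} (hm : m ≤ #S) :
    #{a ∈ S | #{b ∈ S | g b < g a} < m} = m := by
  classical
  set f : ι → ℕ := fun a => #{b ∈ S | g b < g a} with hf
  have hlt : ∀ a ∈ S, ∀ b ∈ S, g a < g b → f a < f b := by
    intro a ha b hb hab
    apply Finset.card_lt_card
    refine ⟨fun c hc => ?_, fun h => ?_⟩
    · simp only [mem_filter] at hc ⊢
      exact ⟨hc.1, hc.2.trans hab⟩
    · have := h (mem_filter.2 ⟨ha, hab⟩)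
      simp at this
  have hinj : Set.InjOn f S := by
    intro a ha b hb hab
    rcases lt_trichotomy (g a) (g b) with h | h | h
    · exact absurd hab (hlt a ha b hb h).ne
    · exact hg h
    · exact absurd hab (hlt b hb a ha h).ne'
  -- The rank is injective with values below `#S`, hence a bijection onto `range #S`; so exactly `m`
  -- ranks are below `m`.
  have himg : S.image f = range #S := by
    apply Finset.eq_of_subset_of_card_le
    · intro k hk
      obtain ⟨a, ha, rfl⟩ := mem_image.1 hk
      rw [mem_range]
      apply Finset.card_lt_card
      refine ⟨filter_subset _ _, fun h => ?_⟩
      have := h ha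
      simp at this
    · rw [card_range, card_image_of_injOn hinj]
  have h1 : #{a ∈ S | f a < m} = #(({a ∈ S | f a < m}).image f) :=
    (card_image_of_injOn (hinj.mono (by intro a ha; exact (mem_filter.1 ha).1))).symm
  have h2 : ({a ∈ S | f a < m}).image f = range m := by
    ext k
    simp only [mem_image, mem_filter, mem_range]
    constructor
    · rintro ⟨a, ⟨_, h⟩, rfl⟩; exact h
    · intro hk
      have : k ∈ S.image f := by rw [himg, mem_range]; omega
      obtain ⟨a, ha, rfl⟩ := mem_image.1 this
      exact ⟨a, ⟨ha, hk⟩, rfl⟩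
  rw [h1, h2, card_range]

theorem le_choose_add_self {r m : ℕ} (hr : 0 < r) : m ≤ (m + r).choose r := by
  -- Binomial coefficients do not decrease when both arguments grow by one, so the bound comes from
  -- the case `r = 1`.
  have h1 : (m + 1).choose 1 ≤ (m + 1 + (r - 1)).choose (1 + (r - 1)) := by
    induction r - 1 with
    | zero => simp
    | succ k ih =>
      refine ih.trans ?_
      rw [← add_assoc, ← add_assoc, Nat.choose_succ_succ]
      exact Nat.le_add_right _ _
  rw [Nat.choose_one_right] at h1
  have e1 : m + 1 + (r - 1) = m + r := by omega
  have e2 : 1 + (r - 1) = r := by omega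
  rw [e1, e2] at h1
  omega

theorem card_colexFirst {r m : ℕ} (hr : 0 < r) : #(colexFirst r m) = m := by
  apply card_filter_rank_lt (fun A : Finset ℕ => toColex A) toColex.injective
  rw [card_powersetCard, Nat.card_Icc, Nat.add_sub_cancel]
  exact le_choose_add_self hr

theorem mem_colexFirst_of_lt {r m : ℕ} {A B : Finset ℕ} (hA : A ∈ colexFirst r m)
    (hB : #B = r) (hpos : ∀ i ∈ B, 1 ≤ i) (hlt : toColex B < toColex A) :
    B ∈ colexFirst r m := by
  rw [colexFirst, mem_filter, mem_powersetCard] at hA ⊢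
  have hBs : B ⊆ Icc 1 (m + r) := by
    intro i hi
    rw [mem_Icc]
    refine ⟨hpos i hi, ?_⟩
    exact Finset.Colex.forall_le_mono hlt.le (fun b hb => (mem_Icc.1 (hA.1.1 hb)).2) i hi
  refine ⟨⟨hBs, hB⟩, lt_of_le_of_lt (card_le_card ?_) hA.2⟩
  intro D hD
  rw [mem_filter] at hD ⊢
  exact ⟨hD.1, hD.2.trans hlt⟩

/-- If some `A` were missing, all members of the initial segment would precede `A` and hence lie in
`[n]`; with `A` these are `m + 1` sets, too many. The next lemma is the dual count. -/
theorem powersetCard_subset_colexFirst {r m n : ℕ} (hr : 0 < r) (h : n.choose r ≤ m) :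
    powersetCard r (Icc 1 n) ⊆ colexFirst r m := by
  intro A hA
  by_contra hAC
  rw [mem_powersetCard] at hA
  have hsub : insert A (colexFirst r m) ⊆ powersetCard r (Icc 1 n) := by
    intro B hB
    rw [mem_insert] at hB
    rcases hB with rfl | hB
    · exact mem_powersetCard.2 hA
    · have hB' := mem_powersetCard.1 (mem_filter.1 hB).1
      have hlt : toColex B ≤ toColex A := by
        by_contra hc
        exact hAC (mem_colexFirst_of_lt hB hA.2 (fun i hi => (mem_Icc.1 (hA.1 hi)).1)
          (not_le.1 hc))
      refine mem_powersetCard.2 ⟨fun i hi => ?_, hB'.2⟩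
      exact mem_Icc.2 ⟨(mem_Icc.1 (hB'.1 hi)).1,
        Finset.Colex.forall_le_mono hlt (fun b hb => (mem_Icc.1 (hA.1 hb)).2) i hi⟩
  have := card_le_card hsub
  rw [card_insert_of_notMem hAC, card_colexFirst hr, card_powersetCard, Nat.card_Icc,
    Nat.add_sub_cancel] at this
  omega

theorem colexFirst_subset_powersetCard {r m n : ℕ} (hr : 0 < r) (h : m ≤ n.choose r) :
    colexFirst r m ⊆ powersetCard r (Icc 1 n) := by
  intro A hA
  by_contra hAn
  have hA' := mem_powersetCard.1 (mem_filter.1 hA).1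
  have hsub : insert A (powersetCard r (Icc 1 n)) ⊆ colexFirst r m := by
    intro B hB
    rw [mem_insert] at hB
    rcases hB with rfl | hB
    · exact hA
    · rw [mem_powersetCard] at hB
      refine mem_colexFirst_of_lt hA hB.2 (fun i hi => (mem_Icc.1 (hB.1 hi)).1) ?_
      by_contra hc
      refine hAn (mem_powersetCard.2 ⟨fun i hi => ?_, hA'.2⟩)
      exact mem_Icc.2 ⟨(mem_Icc.1 (hA'.1 hi)).1,
        Finset.Colex.forall_le_mono (not_lt.1 hc) (fun b hb => (mem_Icc.1 (hB.1 hb)).2) i hi⟩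
  have := card_le_card hsub
  rw [card_insert_of_notMem hAn, card_colexFirst hr, card_powersetCard, Nat.card_Icc,
    Nat.add_sub_cancel] at this
  omega

/-! ### Edge polynomials, their derivatives, and shifts of weight -/

/-- The sum over a family of finite sets of the products of the weights. -/
noncomputable def edgeSum (F : Finset (Finset ℕ)) (x : ℕ → ℝ) : ℝ :=
  ∑ e ∈ F, ∏ i ∈ e, x i

/-- The partial derivative of `edgeSum F` in the variable `i`. -/
noncomputable def edgeDeriv (F : Finset (Finset ℕ)) (i : ℕ) (x : ℕ → ℝ) : ℝ :=
  ∑ e ∈ F with i ∈ e, ∏ k ∈ e.erase i, x k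

/-- The mixed second partial derivative of `edgeSum F` in the variables `i` and `j`. -/
noncomputable def edgeDeriv₂ (F : Finset (Finset ℕ)) (i j : ℕ) (x : ℕ → ℝ) : ℝ :=
  ∑ e ∈ F with i ∈ e ∧ j ∈ e, ∏ k ∈ (e.erase i).erase j, x k

/-- The part of `edgeDeriv F i` that comes from the sets avoiding `j`. -/
noncomputable def edgeDerivAvoid (F : Finset (Finset ℕ)) (i j : ℕ) (x : ℕ → ℝ) : ℝ :=
  ∑ e ∈ F with i ∈ e ∧ j ∉ e, ∏ k ∈ e.erase i, x k

/-- Move the weight `s` from the vertex `j` to the vertex `i`. -/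
noncomputable def shift (x : ℕ → ℝ) (i j : ℕ) (s : ℝ) : ℕ → ℝ := fun k =>
  if k = i then x k + s else if k = j then x k - s else x k

theorem shift_left (x : ℕ → ℝ) (i j : ℕ) (s : ℝ) : shift x i j s i = x i + s := by
  simp [shift]

theorem shift_right (x : ℕ → ℝ) {i j : ℕ} (hij : i ≠ j) (s : ℝ) :
    shift x i j s j = x j - s := by
  simp [shift, hij.symm]

theorem shift_of_ne (x : ℕ → ℝ) {i j k : ℕ} (hi : k ≠ i) (hj : k ≠ j) (s : ℝ) :
    shift x i j s k = x k := by
  simp [shift, hi, hj]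

theorem prod_shift (x : ℕ → ℝ) {i j : ℕ} (hij : i ≠ j) (s : ℝ) (e : Finset ℕ) :
    ∏ k ∈ e, shift x i j s k = ∏ k ∈ e, x k
      + s * ((if i ∈ e then ∏ k ∈ e.erase i, x k else 0)
        - (if j ∈ e then ∏ k ∈ e.erase j, x k else 0))
      - s ^ 2 * (if i ∈ e ∧ j ∈ e then ∏ k ∈ (e.erase i).erase j, x k else 0) := by
  have hrest : ∀ f : Finset ℕ, i ∉ f → j ∉ f → ∏ k ∈ f, shift x i j s k = ∏ k ∈ f, x k := by
    intro f hi hj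
    refine prod_congr rfl fun k hk => shift_of_ne x ?_ ?_ s
    · rintro rfl; exact hi hk
    · rintro rfl; exact hj hk
  by_cases hi : i ∈ e <;> by_cases hj : j ∈ e
  · have hj' : j ∈ e.erase i := mem_erase.2 ⟨hij.symm, hj⟩
    have hi' : i ∈ e.erase j := mem_erase.2 ⟨hij, hi⟩
    have h3 : (e.erase j).erase i = (e.erase i).erase j := erase_right_comm
    rw [← mul_prod_erase e _ hi, ← mul_prod_erase e x hi, ← mul_prod_erase _ _ hj',
      ← mul_prod_erase _ x hj', hrest _ (by simp) (by simp), shift_left, shift_right x hij,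
      if_pos hi, if_pos hj, if_pos ⟨hi, hj⟩, ← mul_prod_erase _ x hi', h3]
    ring
  · rw [← mul_prod_erase e _ hi, ← mul_prod_erase e x hi, hrest _ (by simp) (by simp [hj]),
      shift_left, if_pos hi, if_neg hj, if_neg (by tauto)]
    ring
  · rw [← mul_prod_erase e _ hj, ← mul_prod_erase e x hj, hrest _ (by simp [hi]) (by simp),
      shift_right x hij, if_pos hj, if_neg hi, if_neg (by tauto)]
    ring
  · rw [hrest _ hi hj, if_neg hi, if_neg hj, if_neg (by tauto)]
    ring

/-- The polynomial has degree at most one in each variable, so its Taylor expansion along a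
two-vertex exchange is exact and stops at order two. -/
theorem edgeSum_shift (F : Finset (Finset ℕ)) (x : ℕ → ℝ) {i j : ℕ} (hij : i ≠ j) (s : ℝ) :
    edgeSum F (shift x i j s) = edgeSum F x + s * (edgeDeriv F i x - edgeDeriv F j x)
      - s ^ 2 * edgeDeriv₂ F i j x := by
  simp only [edgeSum, edgeDeriv, edgeDeriv₂, prod_shift x hij, sum_add_distrib,
    sum_sub_distrib, ← mul_sum, sum_filter]

theorem edgeDeriv_eq (F : Finset (Finset ℕ)) (x : ℕ → ℝ) {i j : ℕ} (hij : i ≠ j) :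
    edgeDeriv F i x = edgeDerivAvoid F i j x + x j * edgeDeriv₂ F i j x := by
  simp only [edgeDeriv, edgeDerivAvoid, edgeDeriv₂, sum_filter, mul_sum, ← sum_add_distrib]
  refine sum_congr rfl fun e _ => ?_
  by_cases hi : i ∈ e <;> by_cases hj : j ∈ e
  · simp only [hi, hj, if_true, not_true, and_false, if_false, and_true, zero_add]
    rw [mul_prod_erase _ x (mem_erase.2 ⟨hij.symm, hj⟩)]
  all_goals simp [hi, hj]

theorem edgeDeriv₂_comm (F : Finset (Finset ℕ)) (x : ℕ → ℝ) (i j : ℕ) :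
    edgeDeriv₂ F i j x = edgeDeriv₂ F j i x := by
  simp only [edgeDeriv₂, and_comm (a := i ∈ _)]
  exact sum_congr rfl fun e _ => by rw [erase_right_comm]

theorem edgeDeriv_eq_update (F : Finset (Finset ℕ)) (i : ℕ) (x : ℕ → ℝ) :
    edgeDeriv F i x = edgeSum F (Function.update x i 1) - edgeSum F (Function.update x i 0) := by
  simp only [edgeDeriv, edgeSum, sum_filter, ← sum_sub_distrib]
  refine sum_congr rfl fun e _ => ?_
  by_cases hi : i ∈ e
  · have h : ∀ v : ℝ, ∏ k ∈ e, Function.update x i v k = v * ∏ k ∈ e.erase i, x k := by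
      intro v
      rw [← mul_prod_erase e _ hi, Function.update_self]
      congr 1
      exact prod_congr rfl fun k hk => Function.update_of_ne (ne_of_mem_erase hk) _ _
    simp [hi, h]
  · have h : ∀ v : ℝ, ∏ k ∈ e, Function.update x i v k = ∏ k ∈ e, x k := by
      intro v
      refine prod_congr rfl fun k hk => Function.update_of_ne ?_ _ _
      rintro rfl; exact hi hk
    simp [hi, h]

theorem eq_zero_of_quadratic_nonpos {r A B : ℝ} (hr : 0 < r)
    (h : ∀ s, |s| ≤ r → s * A - s ^ 2 * B ≤ 0) : A = 0 := by
  by_contra hA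
  have hA' : 0 < |A| := abs_pos.2 hA
  -- For this step length the quadratic term is at most half the linear one.
  set u := min r (|A| / (2 * (|B| + 1))) with hu
  have hB : 0 < |B| + 1 := by positivity
  have hu0 : 0 < u := lt_min hr (by positivity)
  have hur : u ≤ r := min_le_left _ _
  have huB : u * (2 * (|B| + 1)) ≤ |A| := by
    rw [← le_div_iff₀ (by positivity)]; exact min_le_right _ _
  have hB' := le_abs_self B
  have key : u * |A| - u ^ 2 * B ≤ 0 := by
    rcases le_total 0 A with h0 | h0
    · rw [abs_of_nonneg h0]; exact h u (by rw [abs_of_pos hu0]; exact hur)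
    · have := h (-u) (by rw [abs_neg, abs_of_pos hu0]; exact hur)
      rw [abs_of_nonpos h0]; nlinarith
  nlinarith [mul_pos hu0 hu0, mul_pos hu0 hA', mul_le_mul_of_nonneg_left huB hu0.le,
    mul_le_mul_of_nonneg_left hB' (mul_pos hu0 hu0).le]

theorem sum_shift {s : Finset ℕ} {i j : ℕ} (hi : i ∈ s) (hj : j ∈ s) (hij : i ≠ j)
    (x : ℕ → ℝ) (u : ℝ) : ∑ k ∈ s, shift x i j u k = ∑ k ∈ s, x k := by
  have : ∀ k, shift x i j u k = x k + ((if k = i then u else 0) - if k = j then u else 0) := by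
    intro k
    unfold shift
    by_cases h1 : k = i
    · have : k ≠ j := h1 ▸ hij
      simp [h1, hij]
    · by_cases h2 : k = j <;> simp [h1, h2, hij.symm]
      ring
  simp only [this, sum_add_distrib, sum_sub_distrib, sum_ite_eq', hi, hj, if_true]
  ring

theorem shift_nonneg {n : ℕ} {x : ℕ → ℝ} (hx : ∀ i ∈ Icc 1 n, 0 ≤ x i) {i j : ℕ} {s : ℝ}
    (h1 : 0 ≤ x i + s) (h2 : 0 ≤ x j - s) : ∀ k ∈ Icc 1 n, 0 ≤ shift x i j s k := by
  intro k hk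
  unfold shift
  split_ifs with h h'
  · subst h; exact h1
  · subst h'; exact h2
  · exact hx k hk

/-! ### Optimal weightings of left-compressed graphs -/

namespace RGraph

variable {r : ℕ}

theorem weightPoly_eq_edgeSum (G : RGraph r) (x : ℕ → ℝ) : G.weightPoly x = edgeSum G.edges x :=
  rfl

theorem weightPoly_congr (G : RGraph r) {x y : ℕ → ℝ} (h : ∀ i ∈ Icc 1 G.n, x i = y i) :
    G.weightPoly x = G.weightPoly y :=
  sum_congr rfl fun e he => prod_congr rfl fun i hi => h i (G.subset_vertices e he hi)

/-- An optimal legal weighting that vanishes outside the vertex set. -/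
structure IsOptimal (G : RGraph r) (x : ℕ → ℝ) : Prop where
  legal : G.IsLegalWeighting x
  eq_zero : ∀ i, i ∉ Icc 1 G.n → x i = 0
  le : ∀ y, G.IsLegalWeighting y → G.weightPoly y ≤ G.weightPoly x

/-- Weights outside the vertex set are pinned to zero, which makes the simplex a closed subset of a
product of copies of `[0, 1]`, hence compact. -/
theorem exists_isOptimal (G : RGraph r) (hn : 1 ≤ G.n) : ∃ x, G.IsOptimal x := by
  set K : Set (ℕ → ℝ) := {x | (∀ i ∈ Icc 1 G.n, 0 ≤ x i) ∧ (∀ i, i ∉ Icc 1 G.n → x i = 0) ∧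
    ∑ i ∈ Icc 1 G.n, x i = 1} with hK
  have hcl : IsClosed K := by
    refine IsClosed.inter ?_ (IsClosed.inter ?_ ?_)
    · have : {x : ℕ → ℝ | ∀ i ∈ Icc 1 G.n, 0 ≤ x i} = ⋂ i ∈ Icc 1 G.n, {x | 0 ≤ x i} := by
        ext; simp
      change IsClosed {x : ℕ → ℝ | ∀ i ∈ Icc 1 G.n, 0 ≤ x i}
      rw [this]
      exact isClosed_biInter fun i _ => isClosed_le continuous_const (continuous_apply i)
    · have : {x : ℕ → ℝ | ∀ i, i ∉ Icc 1 G.n → x i = 0}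
          = ⋂ i, ⋂ _ : i ∉ Icc 1 G.n, {x | x i = 0} := by
        ext; simp
      change IsClosed {x : ℕ → ℝ | ∀ i, i ∉ Icc 1 G.n → x i = 0}
      rw [this]
      exact isClosed_iInter fun i => isClosed_iInter fun _ =>
        isClosed_eq (continuous_apply i) continuous_const
    · exact isClosed_eq (by fun_prop) continuous_const
  have hcomp : IsCompact K := by
    refine IsCompact.of_isClosed_subset
      (isCompact_univ_pi fun _ : ℕ => isCompact_Icc (a := (0 : ℝ)) (b := 1)) hcl ?_
    intro x hx i _
    by_cases hi : i ∈ Icc 1 G.n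
    · refine ⟨hx.1 i hi, ?_⟩
      rw [← hx.2.2]
      exact single_le_sum (f := x) hx.1 hi
    · rw [hx.2.1 i hi]; simp
  have hne : K.Nonempty := by
    refine ⟨fun i => if i = 1 then 1 else 0, ?_, ?_, ?_⟩
    · intro i _; positivity
    · intro i hi
      have : i ≠ 1 := by rintro rfl; exact hi (mem_Icc.2 ⟨le_rfl, hn⟩)
      simp [this]
    · simp [hn]
  have hcont : ContinuousOn (fun x => G.weightPoly x) K := by
    refine Continuous.continuousOn ?_
    unfold weightPoly
    exact continuous_finsetSum _ fun e _ => continuous_finsetProd _ fun i _ => continuous_apply i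
  obtain ⟨x, hx, hmax⟩ := hcomp.exists_isMaxOn hne hcont
  refine ⟨x, ⟨hx.1, hx.2.2⟩, hx.2.1, fun y hy => ?_⟩
  have hy' : (fun i => if i ∈ Icc 1 G.n then y i else 0) ∈ K := by
    refine ⟨fun i hi => ?_, fun i hi => ?_, ?_⟩
    · simp only [hi, if_true]; exact hy.1 i hi
    · simp only [hi, if_false]
    · rw [← hy.2]; exact sum_congr rfl fun i hi => by simp only [hi, if_true]
  have := hmax hy'
  refine le_trans (le_of_eq (G.weightPoly_congr fun i hi => ?_)) this
  simp only [hi, if_true]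

theorem IsOptimal.lagrangian_eq {G : RGraph r} {x : ℕ → ℝ} (hx : G.IsOptimal x) :
    G.lagrangian = G.weightPoly x := by
  refine IsGreatest.csSup_eq ⟨⟨x, hx.legal, rfl⟩, ?_⟩
  rintro l ⟨y, hy, rfl⟩
  exact hx.le y hy

theorem IsLegalWeighting.one_le {G : RGraph r} {x : ℕ → ℝ} (hx : G.IsLegalWeighting x) :
    1 ≤ G.n := by
  by_contra h
  have : G.n = 0 := by omega
  have h2 := hx.2
  rw [this] at h2
  simp at h2

theorem weightPoly_le_lagrangian (G : RGraph r) {x : ℕ → ℝ} (hx : G.IsLegalWeighting x) :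
    G.weightPoly x ≤ G.lagrangian := by
  obtain ⟨y, hy⟩ := G.exists_isOptimal hx.one_le
  rw [hy.lagrangian_eq]
  exact hy.le x hx

theorem IsLeftCompressed.insert_erase_mem {G : RGraph r} (hG : G.IsLeftCompressed) {e : Finset ℕ}
    (he : e ∈ G.edges) {i j : ℕ} (hi : 1 ≤ i) (hij : i < j) (hje : j ∈ e) (hie : i ∉ e) :
    insert i (e.erase j) ∈ G.edges := by
  have hc := G.card_eq e he
  set f := e.orderEmbOfFin hc with hf
  have himg : Finset.univ.image f = e := image_orderEmbOfFin_univ e hc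
  have hg : Finset.univ.image (fun p => if f p = j then i else f p) = insert i (e.erase j) := by
    ext k
    simp only [mem_image, mem_univ, true_and, mem_insert, mem_erase]
    constructor
    · rintro ⟨p, rfl⟩
      split_ifs with h
      · exact Or.inl rfl
      · exact Or.inr ⟨h, orderEmbOfFin_mem e hc p⟩
    · rintro (rfl | ⟨hk, hke⟩)
      · rw [← himg] at hje
        obtain ⟨p, _, hp⟩ := mem_image.1 hje
        exact ⟨p, by simp [hp]⟩
      · rw [← himg] at hke
        obtain ⟨p, _, hp⟩ := mem_image.1 hke
        exact ⟨p, by simp [hp, hk]⟩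
  have hmem : ∀ p, f p ∈ e := fun p => orderEmbOfFin_mem e hc p
  rw [← hg]
  refine hG _ f ?_ ?_ ?_ (by rw [himg]; exact he)
  · intro p q hpq
    simp only at hpq
    split_ifs at hpq with h1 h2 h2
    · exact f.injective (h1.trans h2.symm)
    · exact absurd (hpq ▸ hmem q) hie
    · exact absurd (hpq ▸ hmem p) hie
    · exact f.injective hpq
  · intro p
    split_ifs
    · exact hi
    · exact (mem_Icc.1 (G.subset_vertices e he (hmem p))).1
  · intro p
    split_ifs with h
    · rw [h]; exact hij.le
    · exact le_rfl

/-- Replacing `j` by `i` injects the edges with `j` but not `i` into those with `i` but not `j`, and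
keeps the remaining monomial. -/
theorem IsLeftCompressed.edgeDerivAvoid_le {G : RGraph r} (hG : G.IsLeftCompressed) {x : ℕ → ℝ}
    (hx : ∀ i, 0 ≤ x i) {i j : ℕ} (hi : 1 ≤ i) (hij : i < j) :
    edgeDerivAvoid G.edges j i x ≤ edgeDerivAvoid G.edges i j x := by
  have hinj : Set.InjOn (fun e : Finset ℕ => insert i (e.erase j))
      ({e ∈ G.edges | j ∈ e ∧ i ∉ e} : Finset (Finset ℕ)) := by
    intro e he f hf hef
    simp only [coe_filter, Set.mem_ofPred_eq] at he hf
    have h1 : e.erase j = f.erase j := by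
      have := congrArg (fun s => Finset.erase s i) hef
      simpa [erase_insert, he.2.2, hf.2.2] using this
    rw [← insert_erase he.2.1, h1, insert_erase hf.2.1]
  have hsum : edgeDerivAvoid G.edges j i x
      = ∑ e ∈ ({e ∈ G.edges | j ∈ e ∧ i ∉ e}).image (fun e => insert i (e.erase j)),
        ∏ k ∈ e.erase i, x k := by
    rw [sum_image hinj]
    refine sum_congr rfl fun e he => ?_
    rw [mem_filter] at he
    rw [erase_insert (by simp [he.2.2])]
  rw [hsum]
  refine sum_le_sum_of_subset_of_nonneg ?_ fun e _ _ => prod_nonneg fun k _ => hx k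
  intro e he
  obtain ⟨f, hf, rfl⟩ := mem_image.1 he
  rw [mem_filter] at hf ⊢
  refine ⟨hG.insert_erase_mem hf.1 hi hij hf.2.1 hf.2.2, mem_insert_self _ _, ?_⟩
  simp [hij.ne']

theorem IsOptimal.nonneg {G : RGraph r} {x : ℕ → ℝ} (hx : G.IsOptimal x) (i : ℕ) : 0 ≤ x i := by
  by_cases hi : i ∈ Icc 1 G.n
  · exact hx.legal.1 i hi
  · exact (hx.eq_zero i hi).ge

/-- The Lagrange condition: small exchanges between two vertices of positive weight are legal in
both directions, so the linear term vanishes. -/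
theorem IsOptimal.edgeDeriv_eq_edgeDeriv {G : RGraph r} {x : ℕ → ℝ} (hx : G.IsOptimal x)
    {i j : ℕ} (hi : 0 < x i) (hj : 0 < x j) :
    edgeDeriv G.edges i x = edgeDeriv G.edges j x := by
  have hmem : ∀ k, 0 < x k → k ∈ Icc 1 G.n := by
    intro k hk
    by_contra h
    exact hk.ne' (hx.eq_zero k h)
  rcases eq_or_ne i j with rfl | hij
  · rfl
  rw [← sub_eq_zero]
  apply eq_zero_of_quadratic_nonpos (r := min (x i) (x j)) (B := edgeDeriv₂ G.edges i j x)
    (lt_min hi hj)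
  intro s hs
  have hs' := abs_le.1 hs
  have h1 : min (x i) (x j) ≤ x i := min_le_left _ _
  have h2 : min (x i) (x j) ≤ x j := min_le_right _ _
  have := hx.le (shift x i j s) ⟨shift_nonneg hx.legal.1 (by linarith) (by linarith),
    by rw [sum_shift (hmem i hi) (hmem j hj) hij]; exact hx.legal.2⟩
  rw [weightPoly_eq_edgeSum, weightPoly_eq_edgeSum, edgeSum_shift _ _ hij] at this
  linarith

/-- A left-compressed graph has an optimal weighting that is positive on an initial segment of the
vertex set, non-increasing there, and zero elsewhere, such that any two vertices of the segment lie
in an edge contained in the segment. -/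
theorem IsLeftCompressed.exists_isOptimal {G : RGraph r} (hG : G.IsLeftCompressed)
    (hn : 1 ≤ G.n) : ∃ (x : ℕ → ℝ) (k : ℕ), G.IsOptimal x ∧ (∀ i ∈ Icc 1 k, 0 < x i) ∧
      (∀ i, i ∉ Icc 1 k → x i = 0) ∧ (∀ i j, 1 ≤ i → i ≤ j → j ≤ k → x j ≤ x i) ∧
      ∀ i ∈ Icc 1 k, ∀ j ∈ Icc 1 k, i ≠ j → ∃ e ∈ G.edges, i ∈ e ∧ j ∈ e ∧ e ⊆ Icc 1 k := by
  classical
  -- Minimising the sum of the labels in the support, among optimal weightings, excludes both gaps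
  -- and superfluous vertices.
  set μ : (ℕ → ℝ) → ℕ := fun x => ∑ i ∈ Icc 1 G.n with 0 < x i, i with hμ
  obtain ⟨x₀, hx₀⟩ := G.exists_isOptimal hn
  have hex : ∃ k, ∃ x, G.IsOptimal x ∧ μ x = k := ⟨_, x₀, hx₀, rfl⟩
  obtain ⟨x, hx, hxk⟩ := Nat.find_spec hex
  have hmin : ∀ y, G.IsOptimal y → μ x ≤ μ y := by
    intro y hy
    rw [hxk]
    exact Nat.find_min' hex ⟨y, hy, rfl⟩
  have hmem : ∀ k, 0 < x k → k ∈ Icc 1 G.n := by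
    intro k hk
    by_contra h
    exact hk.ne' (hx.eq_zero k h)
  -- Emptying `j` into such an `i` lowers `μ`, so it cannot preserve optimality.
  have hno : ∀ i j, i ∈ Icc 1 G.n → 0 < x j → i ≠ j → (0 < x i ∨ i < j) →
      G.weightPoly x ≤ G.weightPoly (shift x i j (x j)) → False := by
    intro i j hi hj hij hor hle
    have hj' := hmem j hj
    have hopt : G.IsOptimal (shift x i j (x j)) := by
      refine ⟨⟨shift_nonneg hx.legal.1 (add_nonneg (hx.nonneg i) hj.le) (by simp),
        by rw [sum_shift hi hj' hij]; exact hx.legal.2⟩, fun k hk => ?_,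
        fun y hy => (hx.le y hy).trans hle⟩
      rw [shift_of_ne]
      · exact hx.eq_zero k hk
      · rintro rfl; exact hk hi
      · rintro rfl; exact hk hj'
    have h1 := hmin _ hopt
    have h2 : ({k ∈ Icc 1 G.n | 0 < shift x i j (x j) k} : Finset ℕ)
        = insert i (({k ∈ Icc 1 G.n | 0 < x k} : Finset ℕ).erase j) := by
      ext k
      simp only [mem_filter, mem_insert, mem_erase]
      by_cases hki : k = i
      · subst hki
        simp only [shift_left, true_or, iff_true]
        exact ⟨hi, add_pos_of_nonneg_of_pos (hx.nonneg k) hj⟩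
      · by_cases hkj : k = j
        · subst hkj
          simp [shift_right x hij, hki]
        · simp [shift_of_ne x hki hkj, hki, hkj]
    have hjs : j ∈ ({k ∈ Icc 1 G.n | 0 < x k} : Finset ℕ) := mem_filter.2 ⟨hj', hj⟩
    have h3 : μ x = j + ∑ k ∈ ({k ∈ Icc 1 G.n | 0 < x k} : Finset ℕ).erase j, k :=
      (add_sum_erase _ (fun k => k) hjs).symm
    have h4 : μ (shift x i j (x j))
        = ∑ k ∈ insert i (({k ∈ Icc 1 G.n | 0 < x k} : Finset ℕ).erase j), k := by
      rw [hμ]; simp only [h2]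
    by_cases hxi : 0 < x i
    · rw [insert_eq_of_mem (mem_erase.2 ⟨hij, mem_filter.2 ⟨hi, hxi⟩⟩)] at h4
      have := (mem_Icc.1 hj').1
      omega
    · rw [sum_insert (by simp [hxi])] at h4
      have := hor.resolve_left hxi
      omega
  have hdown : ∀ i j, 1 ≤ i → i < j → 0 < x j → 0 < x i := by
    intro i j hi hij hj
    by_contra hxi
    have hxi0 : x i = 0 := le_antisymm (not_lt.1 hxi) (hx.nonneg i)
    have hjn := (mem_Icc.1 (hmem j hj)).2
    refine hno i j (mem_Icc.2 ⟨hi, by omega⟩) hj hij.ne (Or.inr hij) ?_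
    -- As `x i = 0`, the second-order terms cancel and the change is `x j` times the difference of
    -- the two avoiding derivatives.
    rw [weightPoly_eq_edgeSum, weightPoly_eq_edgeSum, edgeSum_shift _ _ hij.ne,
      edgeDeriv_eq _ _ hij.ne, edgeDeriv_eq _ _ hij.ne', hxi0, edgeDeriv₂_comm _ _ j i]
    have := mul_nonneg hj.le (sub_nonneg.2 (hG.edgeDerivAvoid_le hx.nonneg hi hij))
    linarith
  have hpair : ∀ i j, 0 < x i → 0 < x j → i ≠ j → 0 < edgeDeriv₂ G.edges i j x := by
    intro i j hi hj hij
    have h0 : 0 ≤ edgeDeriv₂ G.edges i j x :=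
      sum_nonneg fun e _ => prod_nonneg fun k _ => hx.nonneg k
    refine lt_of_le_of_ne h0 fun h => ?_
    refine hno i j (hmem i hi) hj hij (Or.inl hi) ?_
    -- The first-order term vanishes by the Lagrange condition and the second-order term by
    -- assumption, so the shift costs nothing.
    rw [weightPoly_eq_edgeSum, weightPoly_eq_edgeSum, edgeSum_shift _ _ hij, ← h,
      hx.edgeDeriv_eq_edgeDeriv hi hj]
    simp
  set S : Finset ℕ := {k ∈ Icc 1 G.n | 0 < x k} with hS
  have hSmem : ∀ i, i ∈ S ↔ 0 < x i := fun i => by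
    rw [hS, mem_filter]; exact ⟨fun h => h.2, fun h => ⟨hmem i h, h⟩⟩
  have hSeq : ∃ k, ∀ i, i ∈ Icc 1 k ↔ 0 < x i := by
    refine ⟨S.sup id, fun i => ?_⟩
    rw [mem_Icc]
    constructor
    · rintro ⟨h1, h2⟩
      have hne : S.Nonempty := by
        by_contra h
        rw [not_nonempty_iff_eq_empty] at h
        rw [h] at h2
        simp at h2
        omega
      obtain ⟨j, hj, hjs⟩ := exists_mem_eq_sup S hne id
      rw [hjs] at h2
      rcases (show i ≤ j from h2).lt_or_eq with h | h
      · exact hdown i j h1 h ((hSmem j).1 hj)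
      · rw [h]; exact (hSmem j).1 hj
    · intro h
      exact ⟨(mem_Icc.1 (hmem i h)).1, le_sup (f := id) ((hSmem i).2 h)⟩
  obtain ⟨k, hk⟩ := hSeq
  refine ⟨x, k, hx, fun i hi => (hk i).1 hi, fun i hi => ?_, fun i j h1 h2 h3 => ?_,
    fun i hi j hj hij => ?_⟩
  · exact le_antisymm (not_lt.1 fun h => hi ((hk i).2 h)) (hx.nonneg i)
  · rcases h2.eq_or_lt with rfl | h2
    · exact le_rfl
    have hi := (hk i).1 (mem_Icc.2 ⟨h1, by omega⟩)
    have hj := (hk j).1 (mem_Icc.2 ⟨by omega, h3⟩)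
    have e1 := hx.edgeDeriv_eq_edgeDeriv hi hj
    -- Equal derivatives make `x i - x j` times the positive mixed derivative equal to a difference
    -- that is non-negative by compression.
    rw [edgeDeriv_eq _ _ h2.ne, edgeDeriv_eq _ _ h2.ne', edgeDeriv₂_comm _ _ j i] at e1
    have e2 := hpair i j hi hj h2.ne
    have e3 := hG.edgeDerivAvoid_le hx.nonneg h1 h2
    nlinarith
  · have h := hpair i j ((hk i).1 hi) ((hk j).1 hj) hij
    obtain ⟨e, he, hpos⟩ := exists_lt_of_sum_lt (s := {e ∈ G.edges | i ∈ e ∧ j ∈ e})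
      (f := fun _ => (0 : ℝ)) (g := fun e => ∏ k ∈ (e.erase i).erase j, x k) (by rw [sum_const_zero]; exact h)
    rw [mem_filter] at he
    refine ⟨e, he.1, he.2.1, he.2.2, fun l hl => ?_⟩
    by_cases hli : l = i
    · rw [hli]; exact hi
    by_cases hlj : l = j
    · rw [hlj]; exact hj
    rw [hk]
    have : x l ≠ 0 := fun h0 => by
      have h1 : ∏ k ∈ (e.erase i).erase j, x k = 0 :=
        prod_eq_zero (mem_erase.2 ⟨hlj, mem_erase.2 ⟨hli, hl⟩⟩) h0
      simp only [h1] at hpos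
      exact lt_irrefl _ hpos
    exact lt_of_le_of_ne (hx.nonneg l) this.symm

end RGraph

/-! ### The complete family through power sums -/

theorem edgeSum_powersetCard_one (s : Finset ℕ) (x : ℕ → ℝ) :
    edgeSum (powersetCard 1 s) x = ∑ i ∈ s, x i := by
  rw [edgeSum, powersetCard_one, sum_map]
  simp

theorem edgeSum_powersetCard_insert {s : Finset ℕ} {a : ℕ} (ha : a ∉ s) (k : ℕ) (x : ℕ → ℝ) :
    edgeSum (powersetCard (k + 1) (insert a s)) x
      = edgeSum (powersetCard (k + 1) s) x + x a * edgeSum (powersetCard k s) x := by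
  have hnot : ∀ e ∈ powersetCard k s, a ∉ e := fun e he h => ha ((mem_powersetCard.1 he).1 h)
  rw [powersetCard_succ_insert ha, edgeSum, sum_union, sum_image, edgeSum, edgeSum, mul_sum]
  · congr 1
    exact sum_congr rfl fun e he => by rw [prod_insert (hnot e he)]
  · intro e he f hf hef
    have := congrArg (fun u => Finset.erase u a) hef
    simpa [erase_insert, hnot e he, hnot f hf] using this
  · rw [disjoint_left]
    intro e he he'
    obtain ⟨f, _, rfl⟩ := mem_image.1 he'
    exact ha ((mem_powersetCard.1 he).1 (mem_insert_self _ _))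

theorem edgeSum_powersetCard_two (s : Finset ℕ) (x : ℕ → ℝ) :
    2 * edgeSum (powersetCard 2 s) x = (∑ i ∈ s, x i) ^ 2 - ∑ i ∈ s, x i ^ 2 := by
  induction s using Finset.induction_on with
  | empty =>
    rw [edgeSum, powersetCard_eq_empty.2 (by simp)]
    simp
  | insert a s ha ih =>
    rw [edgeSum_powersetCard_insert ha, edgeSum_powersetCard_one, sum_insert ha, sum_insert ha]
    linear_combination ih

theorem edgeSum_powersetCard_three (s : Finset ℕ) (x : ℕ → ℝ) :
    6 * edgeSum (powersetCard 3 s) x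
      = (∑ i ∈ s, x i) ^ 3 - 3 * (∑ i ∈ s, x i) * ∑ i ∈ s, x i ^ 2 + 2 * ∑ i ∈ s, x i ^ 3 := by
  induction s using Finset.induction_on with
  | empty =>
    rw [edgeSum, powersetCard_eq_empty.2 (by simp)]
    simp
  | insert a s ha ih =>
    rw [edgeSum_powersetCard_insert ha, sum_insert ha, sum_insert ha, sum_insert ha]
    linear_combination ih + 3 * x a * edgeSum_powersetCard_two s x

/-- The triples in `[t]`. -/
def triples (t : ℕ) : Finset (Finset ℕ) := powersetCard 3 (Icc 1 t)

theorem sum_update {s : Finset ℕ} {i : ℕ} (hi : i ∈ s) (x : ℕ → ℝ) (v : ℝ) (f : ℝ → ℝ) :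
    ∑ k ∈ s, f (Function.update x i v k) = f v + (∑ k ∈ s, f (x k) - f (x i)) := by
  rw [← add_sum_erase s _ hi, ← add_sum_erase s (fun k => f (x k)) hi, Function.update_self]
  rw [sum_congr rfl fun k hk => by rw [Function.update_of_ne (ne_of_mem_erase hk)]]
  ring

/-- Newton's identity shows that on the simplex this depends on `i` only through `x i`, which makes
the Lagrange conditions of the complement explicit. -/
theorem edgeDeriv_triples {t i : ℕ} {x : ℕ → ℝ} (hi : i ∈ Icc 1 t)
    (hx : ∑ k ∈ Icc 1 t, x k = 1) :
    edgeDeriv (triples t) i x = (1 - ∑ k ∈ Icc 1 t, x k ^ 2) / 2 - x i + x i ^ 2 := by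
  have h : ∀ v, 6 * edgeSum (triples t) (Function.update x i v) = (v + (1 - x i)) ^ 3
      - 3 * (v + (1 - x i)) * (v ^ 2 + (∑ k ∈ Icc 1 t, x k ^ 2 - x i ^ 2))
      + 2 * (v ^ 3 + (∑ k ∈ Icc 1 t, x k ^ 3 - x i ^ 3)) := by
    intro v
    rw [triples, edgeSum_powersetCard_three, sum_update hi x v (fun u => u), hx,
      sum_update hi x v (fun u => u ^ 2), sum_update hi x v (fun u => u ^ 3)]
  rw [edgeDeriv_eq_update]
  linear_combination (h 1 - h 0) / 6

/-! ### Reversed complements of extremal graphs and their Lagrange conditions -/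

/-- The complement `M` of an extremal left-compressed family of triples in `[t]`, with the order of
the vertices reversed, together with an optimal weighting `z`. -/
structure ExtremalComplement (t : ℕ) (M : Finset (Finset ℕ)) (z : ℕ → ℝ) : Prop where
  subset : M ⊆ triples t
  down : ∀ a b c a' b' c', 1 ≤ a' → a' < b' → b' < c' → a' ≤ a → b' ≤ b → c' ≤ c → a < b → b < c →
    ({a, b, c} : Finset ℕ) ∈ M → ({a', b', c'} : Finset ℕ) ∈ M
  pos : ∀ i ∈ Icc 1 t, 0 < z i
  mono : ∀ i j, 1 ≤ i → i ≤ j → j ≤ t → z i ≤ z j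
  sum_eq : ∑ i ∈ Icc 1 t, z i = 1
  max : ∀ N ⊆ triples t, #N = #M → ∀ y : ℕ → ℝ, (∀ i ∈ Icc 1 t, 0 ≤ y i) →
    ∑ i ∈ Icc 1 t, y i = 1 →
    edgeSum (triples t) y - edgeSum N y ≤ edgeSum (triples t) z - edgeSum M z
  three_le : 3 ≤ t
  notMem : ({1, 2, t} : Finset ℕ) ∉ M

namespace ExtremalComplement

variable {t : ℕ} {M : Finset (Finset ℕ)} {z : ℕ → ℝ}

theorem lagrange (h : ExtremalComplement t M z) {i j : ℕ} (hi : i ∈ Icc 1 t) (hj : j ∈ Icc 1 t) :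
    z i - z i ^ 2 + edgeDeriv M i z = z j - z j ^ 2 + edgeDeriv M j z := by
  rcases eq_or_ne i j with rfl | hij
  · rfl
  have hzi := h.pos i hi
  have hzj := h.pos j hj
  have key : (edgeDeriv (triples t) i z - edgeDeriv (triples t) j z)
      - (edgeDeriv M i z - edgeDeriv M j z) = 0 := by
    apply eq_zero_of_quadratic_nonpos (r := min (z i) (z j))
      (B := edgeDeriv₂ (triples t) i j z - edgeDeriv₂ M i j z) (lt_min hzi hzj)
    intro s hs
    have hs' := abs_le.1 hs
    have h1 : min (z i) (z j) ≤ z i := min_le_left _ _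
    have h2 : min (z i) (z j) ≤ z j := min_le_right _ _
    have := h.max M h.subset rfl (shift z i j s)
      (shift_nonneg (fun k hk => (h.pos k hk).le) (by linarith) (by linarith))
      (by rw [sum_shift hi hj hij, h.sum_eq])
    rw [edgeSum_shift _ _ hij, edgeSum_shift _ _ hij] at this
    linarith
  rw [edgeDeriv_triples hi h.sum_eq, edgeDeriv_triples hj h.sum_eq] at key
  linear_combination -key

/-- With total weight `1`, `6 e₃ = 1 - 3 p₂ + 2 p₃` in power sums, so the change of `e₃` is a sum
over the perturbed vertices alone. Every competitor that moves weight is tested in this form. -/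
theorem max_newton (h : ExtremalComplement t M z) {N : Finset (Finset ℕ)} (hN : N ⊆ triples t)
    (hcard : #N = #M) {δ : ℕ → ℝ} {U : Finset ℕ} (hU : U ⊆ Icc 1 t) (hδ : ∀ i, i ∉ U → δ i = 0)
    (hsum : ∑ i ∈ U, δ i = 0) (hnonneg : ∀ i ∈ U, 0 ≤ z i + δ i) :
    ∑ i ∈ U, (-(1 / 2) * (2 * z i * δ i + δ i ^ 2)
      + 1 / 3 * (3 * z i ^ 2 * δ i + 3 * z i * δ i ^ 2 + δ i ^ 3))
      - edgeSum N (fun i => z i + δ i) + edgeSum M z ≤ 0 := by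
  have hsub : ∀ f : ℝ → ℝ, ∑ i ∈ Icc 1 t, f (z i + δ i)
      = ∑ i ∈ Icc 1 t, f (z i) + ∑ i ∈ U, (f (z i + δ i) - f (z i)) := by
    intro f
    have : ∑ i ∈ U, (f (z i + δ i) - f (z i)) = ∑ i ∈ Icc 1 t, (f (z i + δ i) - f (z i)) :=
      sum_subset hU fun i _ hi => by rw [hδ i hi]; simp
    rw [this, sum_sub_distrib]
    ring
  have h1 : ∑ i ∈ Icc 1 t, (z i + δ i) = 1 := by
    rw [hsub (fun u => u), h.sum_eq]
    simp [hsum]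
  have hmax := h.max N hN hcard (fun i => z i + δ i) (fun i hi => by
    by_cases hiU : i ∈ U
    · exact hnonneg i hiU
    · simp only [hδ i hiU, add_zero]; exact (h.pos i hi).le) h1
  have e1 := edgeSum_powersetCard_three (Icc 1 t) z
  have e2 := edgeSum_powersetCard_three (Icc 1 t) (fun i => z i + δ i)
  rw [h.sum_eq] at e1
  simp only [h1, hsub (fun u => u ^ 2), hsub (fun u => u ^ 3)] at e2
  have e3 : ∑ i ∈ U, (-(1 / 2) * (2 * z i * δ i + δ i ^ 2)
      + 1 / 3 * (3 * z i ^ 2 * δ i + 3 * z i * δ i ^ 2 + δ i ^ 3))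
      = -(1 / 2) * ∑ i ∈ U, ((z i + δ i) ^ 2 - z i ^ 2)
        + 1 / 3 * ∑ i ∈ U, ((z i + δ i) ^ 3 - z i ^ 3) := by
    rw [mul_sum, mul_sum, ← sum_add_distrib]
    exact sum_congr rfl fun i _ => by ring
  rw [e3]
  unfold triples at hmax
  linarith

theorem sum_le_one (h : ExtremalComplement t M z) {s : Finset ℕ} (hs : s ⊆ Icc 1 t) :
    ∑ i ∈ s, z i ≤ 1 := by
  rw [← h.sum_eq]
  exact sum_le_sum_of_subset_of_nonneg hs fun i hi _ => (h.pos i hi).le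

theorem add_lt_one (h : ExtremalComplement t M z) {i j : ℕ} (hi : i ∈ Icc 1 t)
    (hj : j ∈ Icc 1 t) (hij : i ≠ j) : z i + z j < 1 := by
  have h3 := h.three_le
  obtain ⟨k, hk, hki, hkj⟩ : ∃ k ∈ Icc 1 t, k ≠ i ∧ k ≠ j := by
    by_cases h1 : 1 ≠ i ∧ 1 ≠ j
    · exact ⟨1, mem_Icc.2 (by omega), h1⟩
    by_cases h2 : 2 ≠ i ∧ 2 ≠ j
    · exact ⟨2, mem_Icc.2 (by omega), h2⟩
    · exact ⟨3, mem_Icc.2 (by omega), by omega, by omega⟩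
  have := h.sum_le_one (s := {i, j, k}) (by
    intro l hl
    simp only [mem_insert, mem_singleton] at hl
    rcases hl with rfl | rfl | rfl <;> assumption)
  rw [sum_insert (by simp [hij, hki.symm]), sum_insert (by simp [hkj.symm]), sum_singleton] at this
  linarith [h.pos k hk]

/-- The Lagrange conditions reduce to `(z i - z j) * (1 - z i - z j) = 0`, and a third vertex of
positive weight excludes the second factor. -/
theorem eq_of_edgeDeriv_eq (h : ExtremalComplement t M z) {i j : ℕ} (hi : i ∈ Icc 1 t)
    (hj : j ∈ Icc 1 t) (hd : edgeDeriv M i z = edgeDeriv M j z) : z i = z j := by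
  rcases eq_or_ne i j with rfl | hij
  · rfl
  have h1 := h.lagrange hi hj
  have h2 := h.add_lt_one hi hj hij
  have h3 : (z i - z j) * (1 - z i - z j) = 0 := by linear_combination h1 - hd
  rcases mul_eq_zero.1 h3 with h4 | h4 <;> linarith

end ExtremalComplement

/-! ### Triples, the star of `{1, 2}`, and derivatives of a star with a remainder -/

theorem exists_eq_triple {t : ℕ} {e : Finset ℕ} (he : e ∈ triples t) :
    ∃ a b c, 1 ≤ a ∧ a < b ∧ b < c ∧ c ≤ t ∧ e = {a, b, c} := by
  obtain ⟨hs, hc⟩ := mem_powersetCard.1 he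
  have hm : ∀ p, e.orderEmbOfFin hc p ∈ e := fun p => orderEmbOfFin_mem e hc p
  have himg : Finset.univ.image (e.orderEmbOfFin hc) = e := image_orderEmbOfFin_univ e hc
  refine ⟨e.orderEmbOfFin hc 0, e.orderEmbOfFin hc 1, e.orderEmbOfFin hc 2,
    (mem_Icc.1 (hs (hm 0))).1, ?_, ?_, (mem_Icc.1 (hs (hm 2))).2, ?_⟩
  · exact (e.orderEmbOfFin hc).strictMono (by decide)
  · exact (e.orderEmbOfFin hc).strictMono (by decide)
  · refine himg.symm.trans ?_
    ext k
    rw [mem_image, Fin.exists_fin_succ, Fin.exists_fin_succ, Fin.exists_fin_succ]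
    simp only [mem_univ, true_and, mem_insert, mem_singleton, IsEmpty.exists_iff, or_false,
      eq_comm (b := k)]
    rfl

theorem triple_mem_triples {t a b c : ℕ} (ha : 1 ≤ a) (hab : a < b) (hbc : b < c) (hc : c ≤ t) :
    ({a, b, c} : Finset ℕ) ∈ triples t := by
  refine mem_powersetCard.2 ⟨?_, ?_⟩
  · intro i hi
    simp only [mem_insert, mem_singleton] at hi
    rw [mem_Icc]
    omega
  · rw [card_insert_of_notMem, card_pair hbc.ne]
    simp [hab.ne, (hab.trans hbc).ne]

theorem edgeSum_triple {a b c : ℕ} (hab : a < b) (hbc : b < c) (x : ℕ → ℝ) :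
    ∏ i ∈ ({a, b, c} : Finset ℕ), x i = x a * x b * x c := by
  rw [prod_insert (by simp [hab.ne, (hab.trans hbc).ne]), prod_pair hbc.ne]
  ring

/-- The triples `{1, 2, j}` with `3 ≤ j < p`. -/
def starTriples (p : ℕ) : Finset (Finset ℕ) := (Ico 3 p).image fun j => {1, 2, j}

theorem mem_starTriples {p : ℕ} {e : Finset ℕ} :
    e ∈ starTriples p ↔ ∃ j, 3 ≤ j ∧ j < p ∧ e = {1, 2, j} := by
  simp only [starTriples, mem_image, mem_Ico, and_assoc, eq_comm (a := e)]

theorem injOn_starTriples (p : ℕ) :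
    Set.InjOn (fun j : ℕ => ({1, 2, j} : Finset ℕ)) (Ico 3 p : Finset ℕ) := by
  intro i hi j hj hij
  rw [coe_Ico, Set.mem_Ico] at hi hj
  have : i ∈ ({1, 2, j} : Finset ℕ) := by
    rw [← show ({1, 2, i} : Finset ℕ) = {1, 2, j} from hij]; simp
  simp only [mem_insert, mem_singleton] at this
  omega

theorem card_starTriples (p : ℕ) : #(starTriples p) = p - 3 := by
  rw [starTriples, card_image_of_injOn (injOn_starTriples p), Nat.card_Ico]

theorem starTriples_subset {p t : ℕ} (hp : p ≤ t + 1) : starTriples p ⊆ triples t := by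
  intro e he
  obtain ⟨j, h1, h2, rfl⟩ := mem_starTriples.1 he
  exact triple_mem_triples (by omega) (by omega) (by omega) (by omega)

theorem edgeSum_starTriples (p : ℕ) (x : ℕ → ℝ) :
    edgeSum (starTriples p) x = x 1 * x 2 * ∑ j ∈ Ico 3 p, x j := by
  rw [edgeSum, starTriples, sum_image (injOn_starTriples p), mul_sum]
  exact sum_congr rfl fun j hj => edgeSum_triple (by omega) (by rw [mem_Ico] at hj; omega) x

theorem sum_Ico_update_of_mem {a p i : ℕ} (hi : a ≤ i) (hip : i < p) (x : ℕ → ℝ) (v : ℝ) :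
    ∑ k ∈ Ico a p, Function.update x i v k = v + (∑ k ∈ Ico a p, x k - x i) :=
  sum_update (mem_Ico.2 ⟨hi, hip⟩) x v fun u => u

theorem sum_Ico_update_of_notMem {a p i : ℕ} (hi : i < a ∨ p ≤ i) (x : ℕ → ℝ) (v : ℝ) :
    ∑ k ∈ Ico a p, Function.update x i v k = ∑ k ∈ Ico a p, x k := by
  refine sum_congr rfl fun k hk => Function.update_of_ne ?_ _ _
  rw [mem_Ico] at hk
  omega

section StarForm

variable {M : Finset (Finset ℕ)} {p : ℕ} {P : (ℕ → ℝ) → ℝ}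

theorem edgeDeriv_one_of_star
    (hM : ∀ x, edgeSum M x = x 1 * x 2 * ∑ j ∈ Ico 3 p, x j + P x) (z : ℕ → ℝ) :
    edgeDeriv M 1 z = z 2 * ∑ j ∈ Ico 3 p, z j
      + (P (Function.update z 1 1) - P (Function.update z 1 0)) := by
  rw [edgeDeriv_eq_update, hM, hM, sum_Ico_update_of_notMem (by omega),
    sum_Ico_update_of_notMem (by omega)]
  simp [Function.update]
  ring

theorem edgeDeriv_two_of_star
    (hM : ∀ x, edgeSum M x = x 1 * x 2 * ∑ j ∈ Ico 3 p, x j + P x) (z : ℕ → ℝ) :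
    edgeDeriv M 2 z = z 1 * ∑ j ∈ Ico 3 p, z j
      + (P (Function.update z 2 1) - P (Function.update z 2 0)) := by
  rw [edgeDeriv_eq_update, hM, hM, sum_Ico_update_of_notMem (by omega),
    sum_Ico_update_of_notMem (by omega)]
  simp [Function.update]
  ring

theorem edgeDeriv_of_star
    (hM : ∀ x, edgeSum M x = x 1 * x 2 * ∑ j ∈ Ico 3 p, x j + P x) (z : ℕ → ℝ) {i : ℕ}
    (hi : 3 ≤ i) (hip : i < p) :
    edgeDeriv M i z = z 1 * z 2
      + (P (Function.update z i 1) - P (Function.update z i 0)) := by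
  rw [edgeDeriv_eq_update, hM, hM, sum_Ico_update_of_mem hi hip, sum_Ico_update_of_mem hi hip,
    Function.update_of_ne (by omega), Function.update_of_ne (by omega),
    Function.update_of_ne (by omega), Function.update_of_ne (by omega)]
  ring

theorem edgeDeriv_of_star_of_le
    (hM : ∀ x, edgeSum M x = x 1 * x 2 * ∑ j ∈ Ico 3 p, x j + P x) (z : ℕ → ℝ) {i : ℕ}
    (hi : 3 ≤ i) (hip : p ≤ i) :
    edgeDeriv M i z = P (Function.update z i 1) - P (Function.update z i 0) := by
  rw [edgeDeriv_eq_update, hM, hM, sum_Ico_update_of_notMem (by omega),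
    sum_Ico_update_of_notMem (by omega),
    Function.update_of_ne (by omega), Function.update_of_ne (by omega),
    Function.update_of_ne (by omega), Function.update_of_ne (by omega)]
  ring

end StarForm

/-! ### Remainders of at most three triples, excluded one by one -/

namespace ExtremalComplement

variable {t : ℕ} {M : Finset (Finset ℕ)} {z : ℕ → ℝ}

/-- The pattern of all these exclusions: the competitor is the longer star of the same size. It
treats the vertices from `3` to its end alike, so weight is moved to level vertices of the remainder
with the newly covered ones. Multiples of the Lagrange equations turn the comparison into a
polynomial inequality that fails. -/
theorem not_star_add_134 (h : ExtremalComplement t M z) {p : ℕ} (hp : 5 ≤ p) (hpt : p ≤ t)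
    (hM : ∀ x, edgeSum M x = x 1 * x 2 * ∑ j ∈ Ico 3 p, x j + x 1 * x 3 * x 4)
    (hcard : #M = p - 3 + 1) : False := by
  have hmem : ∀ i, 1 ≤ i → i ≤ t → i ∈ Icc 1 t := fun i h1 h2 => mem_Icc.2 ⟨h1, h2⟩
  have d2 := edgeDeriv_two_of_star hM z
  have d3 := edgeDeriv_of_star hM z (i := 3) (by omega) (by omega)
  have d4 := edgeDeriv_of_star hM z (i := 4) (by omega) (by omega)
  have dp := edgeDeriv_of_star_of_le hM z (i := p) (by omega) le_rfl
  have p1 : (1 : ℕ) ≠ p := by omega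
  have p2 : (2 : ℕ) ≠ p := by omega
  have p3 : (3 : ℕ) ≠ p := by omega
  have p4 : (4 : ℕ) ≠ p := by omega
  simp [Function.update, p1, p3, p4] at d2 d3 d4 dp
  have l23 := h.lagrange (hmem 2 (by omega) (by omega)) (hmem 3 (by omega) (by omega))
  have l34 := h.lagrange (hmem 3 (by omega) (by omega)) (hmem 4 (by omega) (by omega))
  have l3p := h.lagrange (hmem 3 (by omega) (by omega)) (hmem p (by omega) (by omega))
  have hS : ∀ x : ℕ → ℝ, ∑ j ∈ Ico 3 p, x j = x 3 + (x 4 + ∑ j ∈ Ico 5 p, x j) := by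
    intro x
    rw [sum_eq_sum_Ico_succ_bot (by omega), sum_eq_sum_Ico_succ_bot (by omega)]
  have hS0 : 0 ≤ ∑ j ∈ Ico 5 p, z j := sum_nonneg fun j hj => by
    rw [mem_Ico] at hj
    exact (h.pos j (hmem j (by omega) (by omega))).le
  have hs := h.sum_le_one (s := {1, 2, 3, 4, p}) (by
    intro i hi
    simp only [mem_insert, mem_singleton] at hi
    rw [mem_Icc]
    omega)
  simp [p1, p2, p3, p4] at hs
  have z1 := h.pos 1 (hmem 1 (by omega) (by omega))
  have z2 := h.pos 2 (hmem 2 (by omega) (by omega))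
  have z3 := h.pos 3 (hmem 3 (by omega) (by omega))
  have z4 := h.pos 4 (hmem 4 (by omega) (by omega))
  have zp := h.pos p (hmem p (by omega) (by omega))
  have m23 := h.mono 2 3 (by omega) (by omega) (by omega)
  have m3p := h.mono 3 p (by omega) (by omega) (by omega)
  rw [hS] at d2
  obtain ⟨S, hSdef⟩ : ∃ S, S = ∑ j ∈ Ico 5 p, z j := ⟨_, rfl⟩
  rw [← hSdef] at d2 hS0
  have e34 : z 4 = z 3 := by
    have : (z 4 - z 3) * (1 - z 3 - z 4 - z 1) = 0 := by
      linear_combination -l34 + d3 - d4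
    rcases mul_eq_zero.1 this with h0 | h0 <;> linarith
  rw [e34] at d2 d3 hs
  obtain ⟨ε, hε⟩ : ∃ ε, ε = (z p - z 3) / 2 := ⟨_, rfl⟩
  have hc : z p = z 3 + 2 * ε := by rw [hε]; ring
  have hL : 2 * ε * (1 - z 3 - z p) = z 1 * (z 2 + z 3) := by
    rw [hε]; linear_combination d3 - l3p - dp
  have hL2 : (z 3 - z 2) * (1 - z 1 - z 2 - z 3) = z 1 * S := by
    linear_combination d2 - d3 - l23
  have hpos : 0 < 1 - z 3 - z p := by linarith
  have hε1 : 2 * ε ≤ z 1 := by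
    refine le_of_mul_le_mul_right ?_ hpos
    rw [hL]
    exact mul_le_mul_of_nonneg_left (by linarith) z1.le
  have hε0 : 0 < ε := by
    have : 0 < 2 * ε := pos_of_mul_pos_left (by rw [hL]; positivity) hpos.le
    linarith
  -- Vertices `3`, `4` and `p` all end with weight `z 3 + ε`; vertex `2` balances the total.
  obtain ⟨δ, hδ⟩ : ∃ δ : ℕ → ℝ, δ = fun i => if i = 2 then -ε else if i = 3 then ε else if i = 4 then ε else
    if i = p then -ε else 0 := ⟨_, rfl⟩
  have δp : δ p = -ε := by simp [hδ, p2.symm, p3.symm, p4.symm]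
  have δ1 : δ 1 = 0 := by simp [hδ, p1]
  have δ2 : δ 2 = -ε := by simp [hδ]
  have δ3 : δ 3 = ε := by simp [hδ]
  have δ4 : δ 4 = ε := by simp [hδ]
  have hδS : ∑ j ∈ Ico 5 p, (z j + δ j) = S := hSdef ▸ sum_congr rfl fun j hj => by
    rw [mem_Ico] at hj
    simp [hδ, show j ≠ 2 by omega, show j ≠ 3 by omega, show j ≠ 4 by omega,
      show j ≠ p by omega]
  have hmax := h.max_newton (N := starTriples (p + 1)) (starTriples_subset (by omega))
    (by rw [card_starTriples, hcard]; omega) (δ := δ) (U := {2, 3, 4, p})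
    (by
      intro i hi
      simp only [mem_insert, mem_singleton] at hi
      rw [mem_Icc]
      omega)
    (by
      intro i hi
      simp only [mem_insert, mem_singleton, not_or] at hi
      simp [hδ, hi])
    (by simp [p2, p3, p4, δ2, δ3, δ4, δp])
    (by
      have m12 := h.mono 1 2 (by omega) (by omega) (by omega)
      intro i hi
      simp only [mem_insert, mem_singleton] at hi
      rcases hi with rfl | rfl | rfl | rfl
      · rw [δ2]; linarith
      · rw [δ3]; linarith
      · rw [δ4]; linarith
      · rw [δp]; linarith)
  rw [edgeSum_starTriples, sum_Ico_succ_top (by omega), hS, hδS, hM, hS] at hmax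
  simp [p2, p3, p4, δ1, δ2, δ3, δ4, δp] at hmax
  rw [← hSdef, e34, hc] at hmax
  rw [hc] at hL
  have hd : 0 ≤ z 3 - z 2 := by linarith
  have key : z 1 * (3 * ε ^ 2 + (z 3 - z 2) * z 3 + 3 * (z 3 - z 2) * ε)
      - ε * (z 3 - z 2) * (z 1 + ε) - 2 * ε ^ 3 ≤ 0 := by
    linear_combination hmax + ε * hL2
  have k1 : 0 < z 1 * ε ^ 2 := by positivity
  have k2 : 2 * ε * ε ^ 2 ≤ z 1 * ε ^ 2 := mul_le_mul_of_nonneg_right hε1 (by positivity)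
  have k3 : 0 ≤ z 1 * ((z 3 - z 2) * z 3) := by positivity
  have k4 : 0 ≤ ε * (z 3 - z 2) * (z 1 - ε) := by
    have : 0 ≤ z 1 - ε := by linarith
    positivity
  have k5 : 0 ≤ z 1 * ((z 3 - z 2) * ε) := by positivity
  linarith

end ExtremalComplement

/-- The value of `η` maximises `-η ^ 2 + 4 * a * (b + ε) * η`, a gain of `4 a² (b + ε)²`. The loss
`ε a (x + y)` is at most `a² (x + y)²`, hence no larger than the gain; the remaining `η² (a + x +
y)` makes the inequality strict. -/
theorem real_ineq_134_135 {a x y b ε η : ℝ} (ha : 0 < a) (hax : a ≤ x) (hxy : x ≤ y)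
    (hyb : y ≤ b) (hε : 0 ≤ ε) (hη : η = 2 * a * (b + ε))
    (hs : a + (x + (y + (b + (b + (b + 2 * ε + (b + 2 * ε)))))) ≤ 1)
    (hL : 2 * ε * (1 - b - (b + 2 * ε)) = a * (x + y))
    (key : -η ^ 2 * (1 - a - x - y) + 2 * a * (b + ε) * (2 * η + y - x)
      - ε * a * (x + y) ≤ 0) : False := by
  have hm : 0 < b + ε := by linarith
  have k1 : (x + y) ^ 2 ≤ 4 * (b + ε) ^ 2 := by
    have : x + y ≤ 2 * (b + ε) := by linarith
    calc (x + y) ^ 2 ≤ (2 * (b + ε)) ^ 2 := pow_le_pow_left₀ (by linarith) this 2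
      _ = 4 * (b + ε) ^ 2 := by ring
  have k2 : ε ≤ a * (x + y) := by
    rw [← hL]
    have : 0 ≤ ε * (1 - 2 * b - 2 * b - 4 * ε) := mul_nonneg hε (by linarith)
    linarith
  have k3 : ε * (a * (x + y)) ≤ a * (x + y) * (a * (x + y)) :=
    mul_le_mul_of_nonneg_right k2 (by nlinarith)
  have k4 : a ^ 2 * (x + y) ^ 2 ≤ a ^ 2 * (4 * (b + ε) ^ 2) :=
    mul_le_mul_of_nonneg_left k1 (by positivity)
  have k5 : 0 < a ^ 2 * (b + ε) ^ 2 * (a + x + y) := by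
    have : 0 < a + x + y := by linarith
    positivity
  have k6 : 0 ≤ a * (b + ε) * (y - x) := by
    have : 0 ≤ y - x := by linarith
    positivity
  subst hη
  linarith

namespace ExtremalComplement

variable {t : ℕ} {M : Finset (Finset ℕ)} {z : ℕ → ℝ}

theorem not_star_add_134_135 (h : ExtremalComplement t M z) {p : ℕ} (hp : 6 ≤ p) (hpt : p + 1 ≤ t)
    (hM : ∀ x, edgeSum M x = x 1 * x 2 * ∑ j ∈ Ico 3 p, x j + (x 1 * x 3 * x 4 + x 1 * x 3 * x 5))
    (hcard : #M = p - 3 + 2) : False := by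
  have hmem : ∀ i, 1 ≤ i → i ≤ t → i ∈ Icc 1 t := fun i h1 h2 => mem_Icc.2 ⟨h1, h2⟩
  have d2 := edgeDeriv_two_of_star hM z
  have d3 := edgeDeriv_of_star hM z (i := 3) (by omega) (by omega)
  have d4 := edgeDeriv_of_star hM z (i := 4) (by omega) (by omega)
  have d5 := edgeDeriv_of_star hM z (i := 5) (by omega) (by omega)
  have dp := edgeDeriv_of_star_of_le hM z (i := p) (by omega) le_rfl
  have dq := edgeDeriv_of_star_of_le hM z (i := p + 1) (by omega) (by omega)
  have p1 : (1 : ℕ) ≠ p := by omega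
  have p2 : (2 : ℕ) ≠ p := by omega
  have p3 : (3 : ℕ) ≠ p := by omega
  have p4 : (4 : ℕ) ≠ p := by omega
  have p5 : (5 : ℕ) ≠ p := by omega
  have p0' : p ≠ 0 := by omega
  have p1' : p ≠ 1 := by omega
  have p2' : p ≠ 2 := by omega
  have p3' : p ≠ 3 := by omega
  have p4' : p ≠ 4 := by omega
  have p5' : p ≠ 5 := by omega
  simp [Function.update, p1, p3, p4, p5, p0', p2', p3', p4'] at d2 d3 d4 d5 dp dq
  have l23 := h.lagrange (hmem 2 (by omega) (by omega)) (hmem 3 (by omega) (by omega))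
  have e54 := h.eq_of_edgeDeriv_eq (hmem 5 (by omega) (by omega)) (hmem 4 (by omega) (by omega))
    (d5.trans d4.symm)
  have l4p := h.lagrange (hmem 4 (by omega) (by omega)) (hmem p (by omega) (by omega))
  have eq := h.eq_of_edgeDeriv_eq (hmem (p + 1) (by omega) (by omega))
    (hmem p (by omega) (by omega)) (dq.trans dp.symm)
  have hS : ∀ x : ℕ → ℝ, ∑ j ∈ Ico 3 p, x j = x 3 + (x 4 + (x 5 + ∑ j ∈ Ico 6 p, x j)) := by
    intro x
    rw [sum_eq_sum_Ico_succ_bot (by omega), sum_eq_sum_Ico_succ_bot (by omega),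
      sum_eq_sum_Ico_succ_bot (by omega)]
  have hs := h.sum_le_one (s := {1, 2, 3, 4, 5, p, p + 1}) (by
    intro i hi
    simp only [mem_insert, mem_singleton] at hi
    rw [mem_Icc]
    omega)
  simp [p1, p2, p3, p4, p5, p0', p1', p2', p3', p4'] at hs
  have hS0 : 0 ≤ ∑ j ∈ Ico 6 p, z j := sum_nonneg fun j hj => by
    rw [mem_Ico] at hj
    exact (h.pos j (hmem j (by omega) (by omega))).le
  have z1 := h.pos 1 (hmem 1 (by omega) (by omega))
  have m12 := h.mono 1 2 (by omega) (by omega) (by omega)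
  have m23 := h.mono 2 3 (by omega) (by omega) (by omega)
  have m34 := h.mono 3 4 (by omega) (by omega) (by omega)
  have m4p := h.mono 4 p (by omega) (by omega) (by omega)
  rw [hS] at d2
  obtain ⟨S, hSdef⟩ : ∃ S, S = ∑ j ∈ Ico 6 p, z j := ⟨_, rfl⟩
  rw [← hSdef] at d2 hS0
  rw [e54] at d2 d3
  rw [e54, eq] at hs
  obtain ⟨ε, hε⟩ : ∃ ε, ε = (z p - z 4) / 2 := ⟨_, rfl⟩
  have hc : z p = z 4 + 2 * ε := by rw [hε]; ring
  have hL : 2 * ε * (1 - z 4 - z p) = z 1 * (z 2 + z 3) := by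
    rw [hε]; linear_combination d4 - l4p - dp
  have hL2 : (z 3 - z 2) * (1 - z 1 - z 2 - z 3) = z 1 * S := by
    linear_combination d2 - d3 - l23
  have hε0 : 0 ≤ ε := by linarith
  obtain ⟨η, hη⟩ : ∃ η, η = 2 * z 1 * (z 4 + ε) := ⟨_, rfl⟩
  have hη0 : 0 ≤ η := by
    rw [hη]
    exact mul_nonneg (by linarith) (by linarith)
  have hη2 : η ≤ z 2 := by
    have : z 1 * (2 * (z 4 + ε)) ≤ z 1 * 1 := mul_le_mul_of_nonneg_left (by linarith) z1.le
    rw [hη]; linarith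
  -- Vertices `4`, `5`, `p`, `p + 1` are levelled at `z 4 + ε`, and independently `η` passes from
  -- `2` to `3`.
  obtain ⟨δ, hδ⟩ : ∃ δ : ℕ → ℝ, δ = fun i => if i = 2 then -η else if i = 3 then η else if i = 4 then ε else
    if i = 5 then ε else if i = p then -ε else if i = p + 1 then -ε else 0 := ⟨_, rfl⟩
  have δp : δ p = -ε := by simp [hδ, p2', p3', p4', p5']
  have δq : δ (p + 1) = -ε := by simp [hδ, p1', p2', p3', p4']
  have δ1 : δ 1 = 0 := by simp [hδ, p1, p0']
  have δ2 : δ 2 = -η := by simp [hδ]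
  have δ3 : δ 3 = η := by simp [hδ]
  have δ4 : δ 4 = ε := by simp [hδ]
  have δ5 : δ 5 = ε := by simp [hδ]
  have hδS : ∑ j ∈ Ico 6 p, (z j + δ j) = S := hSdef ▸ sum_congr rfl fun j hj => by
    rw [mem_Ico] at hj
    simp [hδ, show j ≠ 2 by omega, show j ≠ 3 by omega, show j ≠ 4 by omega,
      show j ≠ 5 by omega, show j ≠ p by omega, show j ≠ p + 1 by omega]
  have hmax := h.max_newton (N := starTriples (p + 2)) (starTriples_subset (by omega))
    (by rw [card_starTriples, hcard]; omega) (δ := δ) (U := {2, 3, 4, 5, p, p + 1})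
    (by
      intro i hi
      simp only [mem_insert, mem_singleton] at hi
      rw [mem_Icc]
      omega)
    (by
      intro i hi
      simp only [mem_insert, mem_singleton, not_or] at hi
      simp [hδ, hi])
    (by simp [p2, p3, p4, p5, p1', p2', p3', p4', δ2, δ3, δ4, δ5, δp, δq])
    (by
      intro i hi
      simp only [mem_insert, mem_singleton] at hi
      rcases hi with rfl | rfl | rfl | rfl | rfl | rfl
      · rw [δ2]; linarith
      · rw [δ3]; linarith
      · rw [δ4]; linarith
      · rw [δ5]; linarith
      · rw [δp]; linarith
      · rw [δq]; linarith)
  rw [edgeSum_starTriples, sum_Ico_succ_top (by omega), sum_Ico_succ_top (by omega), hS, hδS, hM,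
    hS] at hmax
  simp [p2, p3, p4, p5, p1', p2', p3', p4', δ1, δ2, δ3, δ4, δ5, δp, δq] at hmax
  rw [← hSdef, eq, e54, hc] at hmax
  rw [hc] at hL hs
  have key : -η ^ 2 * (1 - z 1 - z 2 - z 3) + 2 * z 1 * (z 4 + ε) * (2 * η + z 3 - z 2)
      - ε * z 1 * (z 2 + z 3) ≤ 0 := by
    linear_combination hmax + η * hL2 - ε * hL
  exact real_ineq_134_135 z1 m12 m23 m34 hε0 hη hs hL key

end ExtremalComplement

set_option linter.unusedSimpArgs false

/-- As with two extra triples: `η` now maximises `-η ^ 2 + 6 * a * (b + ε) * η`, and the gain `9 a²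
(b + ε)²` beats a loss of at most `6 a² (b + ε)²`. -/
theorem real_ineq_134_135_136 {a x y b ε η : ℝ} (ha : 0 < a) (hax : a ≤ x) (hxy : x ≤ y)
    (hyb : y ≤ b) (hε : 0 ≤ ε) (hη : η = 3 * a * (b + ε))
    (hs : 2 * (b + (b + 2 * ε)) ≤ 1)
    (hL : 2 * ε * (1 - b - (b + 2 * ε)) = a * (x + y))
    (key : -η ^ 2 * (1 - a - x - y) + 3 * a * (b + ε) * (2 * η + y - x)
      - 3 / 2 * ε * a * (x + y) ≤ 0) : False := by
  have hm : 0 < b + ε := by linarith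
  have k1 : (x + y) ^ 2 ≤ 4 * (b + ε) ^ 2 := by
    have : x + y ≤ 2 * (b + ε) := by linarith
    calc (x + y) ^ 2 ≤ (2 * (b + ε)) ^ 2 := pow_le_pow_left₀ (by linarith) this 2
      _ = 4 * (b + ε) ^ 2 := by ring
  have k2 : ε ≤ a * (x + y) := by
    rw [← hL]
    have : 0 ≤ ε * (1 - 2 * b - 2 * b - 4 * ε) := mul_nonneg hε (by linarith)
    linarith
  have k3 : ε * (a * (x + y)) ≤ a * (x + y) * (a * (x + y)) :=
    mul_le_mul_of_nonneg_right k2 (by nlinarith)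
  have k4 : a ^ 2 * (x + y) ^ 2 ≤ a ^ 2 * (4 * (b + ε) ^ 2) :=
    mul_le_mul_of_nonneg_left k1 (by positivity)
  have k5 : 0 < a ^ 2 * (b + ε) ^ 2 * (a + x + y) := by
    have : 0 < a + x + y := by linarith
    positivity
  have k7 : 0 < a ^ 2 * (b + ε) ^ 2 := by positivity
  have k6 : 0 ≤ a * (b + ε) * (y - x) := by
    have : 0 ≤ y - x := by linarith
    positivity
  subst hη
  linarith

/-- `key` bounds `b - a` above by `ε a / (2 b)`, while `hL2` with `b ≤ S` bounds it below.
Eliminating `ε` by `hL` gives `4 X ≤ 3 Y`, which contradicts the bound on the total weight. -/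
theorem real_ineq_134_234 {a b ε S : ℝ} (ha : 0 < a) (hab : a ≤ b) (hε : 0 ≤ ε) (hS : b ≤ S)
    (hs : 2 * a + 2 * b + S + 2 * (b + 2 * ε) ≤ 1)
    (hL : 2 * ε * (1 - b - (b + 2 * ε)) = a * (a + 2 * b))
    (hL2 : (b - a) * (1 - 2 * a - 2 * b) = a * S)
    (key : a * (2 * b * (b - a) + ε * (2 * b - 3 * a)) ≤ 0) : False := by
  have hb : 0 < b := by linarith
  obtain ⟨X, hX⟩ : ∃ X, X = 1 - b - (b + 2 * ε) := ⟨_, rfl⟩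
  obtain ⟨Y, hY⟩ : ∃ Y, Y = 1 - 2 * a - 2 * b := ⟨_, rfl⟩
  rw [← hX] at hL
  rw [← hY] at hL2
  have hX0 : 0 < X := by linarith
  have hY0 : 0 < Y := by linarith
  have key' : 2 * b * (b - a) + ε * (2 * b - 3 * a) ≤ 0 := by
    by_contra hcon
    push Not at hcon
    linarith [mul_pos ha hcon]
  have hεa : 2 * ε ≤ a := by
    refine le_of_mul_le_mul_right ?_ hX0
    rw [hL]
    exact mul_le_mul_of_nonneg_left (by linarith) ha.le
  have h1 : 2 * b * (b - a) ≤ ε * a := by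
    have : 0 ≤ ε * (b - a) := mul_nonneg hε (by linarith)
    linarith
  have h2 : 2 * b * (a * b) ≤ ε * a * Y := by
    calc 2 * b * (a * b) ≤ 2 * b * (a * S) := by gcongr
      _ = 2 * b * (b - a) * Y := by rw [← hL2]; ring
      _ ≤ ε * a * Y := mul_le_mul_of_nonneg_right h1 hY0.le
  have h3 : 2 * b ^ 2 ≤ ε * Y := by
    refine le_of_mul_le_mul_left ?_ ha
    linarith
  have h4 : 4 * b ^ 2 * X ≤ a * (a + 2 * b) * Y := by
    rw [← hL]
    have := mul_le_mul_of_nonneg_right h3 hX0.le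
    linarith
  have h5 : a * (a + 2 * b) * Y ≤ 3 * b ^ 2 * Y := by
    refine mul_le_mul_of_nonneg_right ?_ hY0.le
    nlinarith
  have h6 : 4 * X ≤ 3 * Y := by
    refine le_of_mul_le_mul_left ?_ (pow_pos hb 2)
    linarith
  linarith

namespace ExtremalComplement

variable {t : ℕ} {M : Finset (Finset ℕ)} {z : ℕ → ℝ}

theorem not_star_add_134_135_136 (h : ExtremalComplement t M z) {p : ℕ} (hp : 7 ≤ p) (hpt : p + 2 ≤ t)
    (hM : ∀ x, edgeSum M x = x 1 * x 2 * ∑ j ∈ Ico 3 p, x j + (x 1 * x 3 * x 4 + x 1 * x 3 * x 5 + x 1 * x 3 * x 6))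
    (hcard : #M = p - 3 + 3) : False := by
  have hmem : ∀ i, 1 ≤ i → i ≤ t → i ∈ Icc 1 t := fun i h1 h2 => mem_Icc.2 ⟨h1, h2⟩
  have d1 := edgeDeriv_one_of_star hM z
  have d2 := edgeDeriv_two_of_star hM z
  have d3 := edgeDeriv_of_star hM z (i := 3) (by omega) (by omega)
  have d4 := edgeDeriv_of_star hM z (i := 4) (by omega) (by omega)
  have d5 := edgeDeriv_of_star hM z (i := 5) (by omega) (by omega)
  have d6 := edgeDeriv_of_star hM z (i := 6) (by omega) (by omega)
  have dp := edgeDeriv_of_star_of_le hM z (i := p) (by omega) (by omega)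
  have dq := edgeDeriv_of_star_of_le hM z (i := p + 1) (by omega) (by omega)
  have dr := edgeDeriv_of_star_of_le hM z (i := p + 2) (by omega) (by omega)
  have p1 : (1 : ℕ) ≠ p := by omega
  have p2 : (2 : ℕ) ≠ p := by omega
  have p3 : (3 : ℕ) ≠ p := by omega
  have p4 : (4 : ℕ) ≠ p := by omega
  have p5 : (5 : ℕ) ≠ p := by omega
  have p6 : (6 : ℕ) ≠ p := by omega
  have p0' : p ≠ 0 := by omega
  have p1' : p ≠ 1 := by omega
  have p2' : p ≠ 2 := by omega
  have p3' : p ≠ 3 := by omega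
  have p4' : p ≠ 4 := by omega
  have p5' : p ≠ 5 := by omega
  have p6' : p ≠ 6 := by omega
  simp [Function.update, p1, p2, p3, p4, p5, p6, p0', p1', p2', p3', p4', p5', p6'] at d1 d2 d3 d4 d5 d6 dp dq dr
  have eq := h.eq_of_edgeDeriv_eq (hmem (p + 1) (by omega) (by omega))
    (hmem p (by omega) (by omega)) (dq.trans dp.symm)
  have er := h.eq_of_edgeDeriv_eq (hmem (p + 2) (by omega) (by omega))
    (hmem p (by omega) (by omega)) (dr.trans dp.symm)
  have hS : ∀ x : ℕ → ℝ, ∑ j ∈ Ico 3 p, x j = x 3 + (x 4 + (x 5 + (x 6 + (∑ j ∈ Ico 7 p, x j)))) := by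
    intro x
    rw [sum_eq_sum_Ico_succ_bot (by omega), sum_eq_sum_Ico_succ_bot (by omega), sum_eq_sum_Ico_succ_bot (by omega), sum_eq_sum_Ico_succ_bot (by omega)]
  have hs := h.sum_le_one (s := {1, 2, 3, 4, 5, 6, p, p + 1, p + 2} ∪ Ico 7 p) (by
    intro i hi
    simp only [mem_union, mem_insert, mem_singleton, mem_Ico] at hi
    rw [mem_Icc]
    omega)
  rw [sum_union (by
    rw [disjoint_left]
    intro i hi hi'
    simp only [mem_insert, mem_singleton, mem_Ico] at hi hi'
    omega)] at hs
  simp [p1, p2, p3, p4, p5, p6, p0', p1', p2', p3', p4', p5', p6'] at hs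
  have hS0 : 0 ≤ ∑ j ∈ Ico 7 p, z j := sum_nonneg fun j hj => by
    rw [mem_Ico] at hj
    exact (h.pos j (hmem j (by omega) (by omega))).le
  have z1 := h.pos 1 (hmem 1 (by omega) (by omega))
  have m12 := h.mono 1 2 (by omega) (by omega) (by omega)
  have m23 := h.mono 2 3 (by omega) (by omega) (by omega)
  have m34 := h.mono 3 4 (by omega) (by omega) (by omega)
  have m45 := h.mono 4 5 (by omega) (by omega) (by omega)
  have m56 := h.mono 5 6 (by omega) (by omega) (by omega)
  have m6p := h.mono 6 p (by omega) (by omega) (by omega)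
  rw [hS] at d1 d2
  obtain ⟨S, hSdef⟩ : ∃ S, S = ∑ j ∈ Ico 7 p, z j := ⟨_, rfl⟩
  rw [← hSdef] at d1 d2 hS0 hs
  rw [eq, er] at hs
  have l23 := h.lagrange (hmem 2 (by omega) (by omega)) (hmem 3 (by omega) (by omega))
  have l4p := h.lagrange (hmem 4 (by omega) (by omega)) (hmem p (by omega) (by omega))
  have e54 := h.eq_of_edgeDeriv_eq (hmem 5 (by omega) (by omega)) (hmem 4 (by omega) (by omega))
    (d5.trans d4.symm)
  have e64 := h.eq_of_edgeDeriv_eq (hmem 6 (by omega) (by omega)) (hmem 4 (by omega) (by omega))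
    (d6.trans d4.symm)
  rw [e54, e64] at d2 d3 hs
  obtain ⟨ε, hε⟩ : ∃ ε, ε = (z p - z 4) / 2 := ⟨_, rfl⟩
  have hc : z p = z 4 + 2 * ε := by rw [hε]; ring
  have hL : 2 * ε * (1 - z 4 - z p) = z 1 * (z 2 + z 3) := by
    rw [hε]; linear_combination d4 - l4p - dp
  have hL2 : (z 3 - z 2) * (1 - z 1 - z 2 - z 3) = z 1 * S := by
    linear_combination d2 - d3 - l23
  have hε0 : 0 ≤ ε := by linarith
  obtain ⟨η, hη⟩ : ∃ η, η = 3 * z 1 * (z 4 + ε) := ⟨_, rfl⟩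
  have hη0 : 0 ≤ η := by
    rw [hη]
    exact mul_nonneg (by linarith) (by linarith)
  have hη2 : η ≤ z 2 := by
    have : z 1 * (3 * (z 4 + ε)) ≤ z 1 * 1 := mul_le_mul_of_nonneg_left (by linarith) z1.le
    rw [hη]; linarith
  obtain ⟨δ, hδ⟩ : ∃ δ : ℕ → ℝ, δ = fun i =>
    if i = 2 then -η else if i = 3 then η else if i = 4 then ε else if i = 5 then ε else
    if i = 6 then ε else if i = p then -ε else if i = p + 1 then -ε else
    if i = p + 2 then -ε else 0 := ⟨_, rfl⟩
  have δp : δ p = -ε := by simp [hδ, p0', p1', p2', p3', p4', p5', p6']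
  have δq : δ (p + 1) = -ε := by simp [hδ, p0', p1', p2', p3', p4', p5', p6']
  have δr : δ (p + 2) = -ε := by simp [hδ, p0', p1', p2', p3', p4', p5', p6']
  have δ1 : δ 1 = 0 := by simp [hδ, p1, p2, p3, p4, p5, p6, p0', p1', p2', p3', p4', p5', p6']
  have δ2 : δ 2 = -η := by simp [hδ]
  have δ3 : δ 3 = η := by simp [hδ]
  have δ4 : δ 4 = ε := by simp [hδ]
  have δ5 : δ 5 = ε := by simp [hδ]
  have δ6 : δ 6 = ε := by simp [hδ]
  have hδS : ∑ j ∈ Ico 7 p, (z j + δ j) = S := hSdef ▸ sum_congr rfl fun j hj => by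
    rw [mem_Ico] at hj
    simp [hδ, show j ≠ 2 by omega, show j ≠ 3 by omega, show j ≠ 4 by omega, show j ≠ 5 by omega, show j ≠ 6 by omega, show j ≠ p by omega, show j ≠ p + 1 by omega, show j ≠ p + 2 by omega]
  have hmax := h.max_newton (N := starTriples (p + 3)) (starTriples_subset (by omega))
    (by rw [card_starTriples, hcard]; omega) (δ := δ) (U := {2, 3, 4, 5, 6, p, p + 1, p + 2})
    (by
      intro i hi
      simp only [mem_insert, mem_singleton] at hi
      rw [mem_Icc]
      omega)
    (by
      intro i hi
      simp only [mem_insert, mem_singleton, not_or] at hi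
      simp [hδ, hi])
    (by
      simp [p1, p2, p3, p4, p5, p6, p0', p1', p2', p3', p4', p5', p6', δ1, δ2, δ3, δ4, δ5, δ6, δp, δq, δr]
      try ring)
    (by
      intro i hi
      simp only [mem_insert, mem_singleton] at hi
      rcases hi with rfl | rfl | rfl | rfl | rfl | rfl | rfl | rfl
      · rw [δ2]; linarith
      · rw [δ3]; linarith
      · rw [δ4]; linarith
      · rw [δ5]; linarith
      · rw [δ6]; linarith
      · rw [δp]; linarith
      · rw [δq]; linarith
      · rw [δr]; linarith)
  rw [edgeSum_starTriples, sum_Ico_succ_top (by omega), sum_Ico_succ_top (by omega), sum_Ico_succ_top (by omega), hS, hδS, hM,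
    hS] at hmax
  simp [p1, p2, p3, p4, p5, p6, p0', p1', p2', p3', p4', p5', p6', δ1, δ2, δ3, δ4, δ5, δ6, δp, δq, δr] at hmax
  rw [← hSdef] at hmax
  rw [eq, er, e54, e64, hc] at hmax
  rw [hc] at hL hs
  have key : -η ^ 2 * (1 - z 1 - z 2 - z 3) + 3 * z 1 * (z 4 + ε) * (2 * η + z 3 - z 2)
      - 3 / 2 * ε * z 1 * (z 2 + z 3) ≤ 0 := by
    linear_combination hmax + η * hL2 - 3 / 2 * ε * hL
  exact real_ineq_134_135_136 z1 m12 m23 m34 hε0 hη (by linarith) hL key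

theorem not_star_add_134_135_145 (h : ExtremalComplement t M z) {p : ℕ} (hp : 6 ≤ p) (hpt : p + 2 ≤ t)
    (hM : ∀ x, edgeSum M x = x 1 * x 2 * ∑ j ∈ Ico 3 p, x j + (x 1 * x 3 * x 4 + x 1 * x 3 * x 5 + x 1 * x 4 * x 5))
    (hcard : #M = p - 3 + 3) : False := by
  have hmem : ∀ i, 1 ≤ i → i ≤ t → i ∈ Icc 1 t := fun i h1 h2 => mem_Icc.2 ⟨h1, h2⟩
  have d1 := edgeDeriv_one_of_star hM z
  have d2 := edgeDeriv_two_of_star hM z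
  have d3 := edgeDeriv_of_star hM z (i := 3) (by omega) (by omega)
  have d4 := edgeDeriv_of_star hM z (i := 4) (by omega) (by omega)
  have d5 := edgeDeriv_of_star hM z (i := 5) (by omega) (by omega)
  have dp := edgeDeriv_of_star_of_le hM z (i := p) (by omega) (by omega)
  have dq := edgeDeriv_of_star_of_le hM z (i := p + 1) (by omega) (by omega)
  have dr := edgeDeriv_of_star_of_le hM z (i := p + 2) (by omega) (by omega)
  have p1 : (1 : ℕ) ≠ p := by omega
  have p2 : (2 : ℕ) ≠ p := by omega
  have p3 : (3 : ℕ) ≠ p := by omega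
  have p4 : (4 : ℕ) ≠ p := by omega
  have p5 : (5 : ℕ) ≠ p := by omega
  have p0' : p ≠ 0 := by omega
  have p1' : p ≠ 1 := by omega
  have p2' : p ≠ 2 := by omega
  have p3' : p ≠ 3 := by omega
  have p4' : p ≠ 4 := by omega
  have p5' : p ≠ 5 := by omega
  simp [Function.update, p1, p2, p3, p4, p5, p0', p1', p2', p3', p4', p5'] at d1 d2 d3 d4 d5 dp dq dr
  have eq := h.eq_of_edgeDeriv_eq (hmem (p + 1) (by omega) (by omega))
    (hmem p (by omega) (by omega)) (dq.trans dp.symm)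
  have er := h.eq_of_edgeDeriv_eq (hmem (p + 2) (by omega) (by omega))
    (hmem p (by omega) (by omega)) (dr.trans dp.symm)
  have hS : ∀ x : ℕ → ℝ, ∑ j ∈ Ico 3 p, x j = x 3 + (x 4 + (x 5 + (∑ j ∈ Ico 6 p, x j))) := by
    intro x
    rw [sum_eq_sum_Ico_succ_bot (by omega), sum_eq_sum_Ico_succ_bot (by omega), sum_eq_sum_Ico_succ_bot (by omega)]
  have hs := h.sum_le_one (s := {1, 2, 3, 4, 5, p, p + 1, p + 2} ∪ Ico 6 p) (by
    intro i hi
    simp only [mem_union, mem_insert, mem_singleton, mem_Ico] at hi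
    rw [mem_Icc]
    omega)
  rw [sum_union (by
    rw [disjoint_left]
    intro i hi hi'
    simp only [mem_insert, mem_singleton, mem_Ico] at hi hi'
    omega)] at hs
  simp [p1, p2, p3, p4, p5, p0', p1', p2', p3', p4', p5'] at hs
  have hS0 : 0 ≤ ∑ j ∈ Ico 6 p, z j := sum_nonneg fun j hj => by
    rw [mem_Ico] at hj
    exact (h.pos j (hmem j (by omega) (by omega))).le
  have z1 := h.pos 1 (hmem 1 (by omega) (by omega))
  have m12 := h.mono 1 2 (by omega) (by omega) (by omega)
  have m23 := h.mono 2 3 (by omega) (by omega) (by omega)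
  have m34 := h.mono 3 4 (by omega) (by omega) (by omega)
  have m45 := h.mono 4 5 (by omega) (by omega) (by omega)
  have m5p := h.mono 5 p (by omega) (by omega) (by omega)
  rw [hS] at d1 d2
  obtain ⟨S, hSdef⟩ : ∃ S, S = ∑ j ∈ Ico 6 p, z j := ⟨_, rfl⟩
  rw [← hSdef] at d1 d2 hS0 hs
  rw [eq, er] at hs
  have l23 := h.lagrange (hmem 2 (by omega) (by omega)) (hmem 3 (by omega) (by omega))
  have l34 := h.lagrange (hmem 3 (by omega) (by omega)) (hmem 4 (by omega) (by omega))
  have l35 := h.lagrange (hmem 3 (by omega) (by omega)) (hmem 5 (by omega) (by omega))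
  have l3p := h.lagrange (hmem 3 (by omega) (by omega)) (hmem p (by omega) (by omega))
  have e43 : z 4 = z 3 := by
    have : (z 4 - z 3) * (1 - z 3 - z 4 - z 1) = 0 := by
      linear_combination -l34 + d3 - d4
    rcases mul_eq_zero.1 this with h0 | h0 <;> linarith
  have e53 : z 5 = z 3 := by
    have : (z 5 - z 3) * (1 - z 3 - z 5 - z 1) = 0 := by
      linear_combination -l35 + d3 - d5
    rcases mul_eq_zero.1 this with h0 | h0 <;> linarith
  rw [e43, e53] at d2 d3 hs
  obtain ⟨ε, hε⟩ : ∃ ε, ε = (z p - z 3) / 3 := ⟨_, rfl⟩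
  have hc : z p = z 3 + 3 * ε := by rw [hε]; ring
  have hL : 3 * ε * (1 - z 3 - z p) = z 1 * (z 2 + 2 * z 3) := by
    rw [hε]; linear_combination d3 - l3p - dp
  have hL2 : (z 3 - z 2) * (1 - z 1 - z 2 - z 3) = z 1 * S := by
    linear_combination d2 - d3 - l23
  have hε0 : 0 ≤ ε := by linarith
  have hpos : 0 < 1 - z 3 - z p := by linarith
  have hε1 : 3 * ε ≤ z 1 := by
    refine le_of_mul_le_mul_right ?_ hpos
    rw [hL]
    exact mul_le_mul_of_nonneg_left (by linarith) z1.le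
  -- The remainder is symmetric in `3, 4, 5`, so these have equal weights. All of `3, 4, 5, p, p +
  -- 1, p + 2` are levelled at `z 3 + 2 * ε`, and vertex `2` pays `3 * ε`.
  obtain ⟨δ, hδ⟩ : ∃ δ : ℕ → ℝ, δ = fun i =>
    if i = 2 then -(3 * ε) else if i = 3 then 2 * ε else if i = 4 then 2 * ε else
    if i = 5 then 2 * ε else if i = p then -ε else if i = p + 1 then -ε else
    if i = p + 2 then -ε else 0 := ⟨_, rfl⟩
  have δp : δ p = -ε := by simp [hδ, p0', p1', p2', p3', p4', p5']
  have δq : δ (p + 1) = -ε := by simp [hδ, p0', p1', p2', p3', p4', p5']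
  have δr : δ (p + 2) = -ε := by simp [hδ, p0', p1', p2', p3', p4', p5']
  have δ1 : δ 1 = 0 := by simp [hδ, p1, p2, p3, p4, p5, p0', p1', p2', p3', p4', p5']
  have δ2 : δ 2 = -(3 * ε) := by simp [hδ]
  have δ3 : δ 3 = 2 * ε := by simp [hδ]
  have δ4 : δ 4 = 2 * ε := by simp [hδ]
  have δ5 : δ 5 = 2 * ε := by simp [hδ]
  have hδS : ∑ j ∈ Ico 6 p, (z j + δ j) = S := hSdef ▸ sum_congr rfl fun j hj => by
    rw [mem_Ico] at hj
    simp [hδ, show j ≠ 2 by omega, show j ≠ 3 by omega, show j ≠ 4 by omega, show j ≠ 5 by omega, show j ≠ p by omega, show j ≠ p + 1 by omega, show j ≠ p + 2 by omega]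
  have hmax := h.max_newton (N := starTriples (p + 3)) (starTriples_subset (by omega))
    (by rw [card_starTriples, hcard]; omega) (δ := δ) (U := {2, 3, 4, 5, p, p + 1, p + 2})
    (by
      intro i hi
      simp only [mem_insert, mem_singleton] at hi
      rw [mem_Icc]
      omega)
    (by
      intro i hi
      simp only [mem_insert, mem_singleton, not_or] at hi
      simp [hδ, hi])
    (by
      simp [p1, p2, p3, p4, p5, p0', p1', p2', p3', p4', p5', δ1, δ2, δ3, δ4, δ5, δp, δq, δr]
      try ring)
    (by
      intro i hi
      simp only [mem_insert, mem_singleton] at hi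
      rcases hi with rfl | rfl | rfl | rfl | rfl | rfl | rfl
      · rw [δ2]; linarith
      · rw [δ3]; linarith
      · rw [δ4]; linarith
      · rw [δ5]; linarith
      · rw [δp]; linarith
      · rw [δq]; linarith
      · rw [δr]; linarith)
  rw [edgeSum_starTriples, sum_Ico_succ_top (by omega), sum_Ico_succ_top (by omega), sum_Ico_succ_top (by omega), hS, hδS, hM,
    hS] at hmax
  simp [p1, p2, p3, p4, p5, p0', p1', p2', p3', p4', p5', δ1, δ2, δ3, δ4, δ5, δp, δq, δr] at hmax
  rw [← hSdef] at hmax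
  rw [eq, er, e43, e53, hc] at hmax
  rw [hc] at hL
  have key : 3 * z 1 * z 3 * ε + 36 * z 1 * ε ^ 2 - 29 * ε ^ 3 + 4 * ε * z 1 * (z 3 - z 2)
      - 9 * ε ^ 2 * (z 3 - z 2) + 3 * z 1 * (z 3 - z 2) * z 3 + 6 * z 1 * (z 3 - z 2) * ε ≤ 0 := by
    linear_combination hmax + 3 * ε * hL2 + ε * hL
  have hε2 : 0 < ε := by
    have : 0 < 3 * ε := pos_of_mul_pos_left (by rw [hL]; exact mul_pos z1 (by linarith))
      (by rw [← hc]; exact hpos.le)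
    linarith
  have hd : 0 ≤ z 3 - z 2 := by linarith
  have z3 : 0 < z 3 := by linarith
  have k1 : 0 < z 1 * z 3 * ε := by positivity
  have k2 : 0 ≤ (z 1 - ε) * ε ^ 2 := mul_nonneg (by linarith) (by positivity)
  have k3 : 0 ≤ ε * (z 3 - z 2) * (z 1 - ε) := mul_nonneg (by positivity) (by linarith)
  have k4 : 0 ≤ z 1 * (z 3 - z 2) * z 3 := by positivity
  have k5 : 0 ≤ z 1 * ε ^ 2 := by positivity
  have k6 : 0 ≤ z 1 * (z 3 - z 2) * ε := by positivity
  linarith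

/-- Here `M` is the complete family on `[4]`, so `z 1 = z 2 = z 3 = z 4`. The case is separate
because no star vertex beyond `4` is left to force `z 1 < z 3`. -/
theorem not_complete_four (h : ExtremalComplement t M z) {p : ℕ} (hp : p = 5) (hpt : p + 1 ≤ t)
    (hM : ∀ x, edgeSum M x = x 1 * x 2 * ∑ j ∈ Ico 3 p, x j + (x 1 * x 3 * x 4 + x 2 * x 3 * x 4))
    (hcard : #M = p - 3 + 2) : False := by
  have hmem : ∀ i, 1 ≤ i → i ≤ t → i ∈ Icc 1 t := fun i h1 h2 => mem_Icc.2 ⟨h1, h2⟩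
  have d1 := edgeDeriv_one_of_star hM z
  have d2 := edgeDeriv_two_of_star hM z
  have d3 := edgeDeriv_of_star hM z (i := 3) (by omega) (by omega)
  have d4 := edgeDeriv_of_star hM z (i := 4) (by omega) (by omega)
  have dp := edgeDeriv_of_star_of_le hM z (i := p) (by omega) (by omega)
  have dq := edgeDeriv_of_star_of_le hM z (i := p + 1) (by omega) (by omega)
  have p1 : (1 : ℕ) ≠ p := by omega
  have p2 : (2 : ℕ) ≠ p := by omega
  have p3 : (3 : ℕ) ≠ p := by omega
  have p4 : (4 : ℕ) ≠ p := by omega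
  have p0' : p ≠ 0 := by omega
  have p1' : p ≠ 1 := by omega
  have p2' : p ≠ 2 := by omega
  have p3' : p ≠ 3 := by omega
  have p4' : p ≠ 4 := by omega
  simp [Function.update, p1, p2, p3, p4, p0', p1', p2', p3', p4'] at d1 d2 d3 d4 dp dq
  have eq := h.eq_of_edgeDeriv_eq (hmem (p + 1) (by omega) (by omega))
    (hmem p (by omega) (by omega)) (dq.trans dp.symm)
  have hS : ∀ x : ℕ → ℝ, ∑ j ∈ Ico 3 p, x j = x 3 + (x 4 + (∑ j ∈ Ico 5 p, x j)) := by
    intro x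
    rw [sum_eq_sum_Ico_succ_bot (by omega), sum_eq_sum_Ico_succ_bot (by omega)]
  have hs := h.sum_le_one (s := {1, 2, 3, 4, p, p + 1} ∪ Ico 5 p) (by
    intro i hi
    simp only [mem_union, mem_insert, mem_singleton, mem_Ico] at hi
    rw [mem_Icc]
    omega)
  rw [sum_union (by
    rw [disjoint_left]
    intro i hi hi'
    simp only [mem_insert, mem_singleton, mem_Ico] at hi hi'
    omega)] at hs
  simp [p1, p2, p3, p4, p0', p1', p2', p3', p4'] at hs
  have hS0 : 0 ≤ ∑ j ∈ Ico 5 p, z j := sum_nonneg fun j hj => by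
    rw [mem_Ico] at hj
    exact (h.pos j (hmem j (by omega) (by omega))).le
  have z1 := h.pos 1 (hmem 1 (by omega) (by omega))
  have m12 := h.mono 1 2 (by omega) (by omega) (by omega)
  have m23 := h.mono 2 3 (by omega) (by omega) (by omega)
  have m34 := h.mono 3 4 (by omega) (by omega) (by omega)
  have m4p := h.mono 4 p (by omega) (by omega) (by omega)
  rw [hS] at d1 d2
  obtain ⟨S, hSdef⟩ : ∃ S, S = ∑ j ∈ Ico 5 p, z j := ⟨_, rfl⟩
  rw [← hSdef] at d1 d2 hS0 hs
  rw [eq] at hs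
  have l12 := h.lagrange (hmem 1 (by omega) (by omega)) (hmem 2 (by omega) (by omega))
  have l23 := h.lagrange (hmem 2 (by omega) (by omega)) (hmem 3 (by omega) (by omega))
  have l34 := h.lagrange (hmem 3 (by omega) (by omega)) (hmem 4 (by omega) (by omega))
  have l3p := h.lagrange (hmem 3 (by omega) (by omega)) (hmem p (by omega) (by omega))
  have hS00 : S = 0 := by rw [hSdef, hp]; simp
  rw [hS00] at d1 d2 hs
  have e43 : z 4 = z 3 := by
    have : (z 4 - z 3) * (1 - z 3 - z 4 - z 1 - z 2) = 0 := by
      linear_combination -l34 + d3 - d4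
    rcases mul_eq_zero.1 this with h0 | h0 <;> linarith
  rw [e43] at d1 d2 d3 hs
  have e21 : z 2 = z 1 := by
    have : (z 2 - z 1) * (1 - z 1 - z 2 - 2 * z 3) = 0 := by
      linear_combination -l12 + d1 - d2
    rcases mul_eq_zero.1 this with h0 | h0 <;> linarith
  rw [e21] at d3 hs l23
  have e31 : z 3 = z 1 := by
    have : (z 3 - z 1) * (1 - 2 * z 1 - 2 * z 3) = 0 := by
      linear_combination -l23 + d2 - d3
    rcases mul_eq_zero.1 this with h0 | h0 <;> linarith
  rw [e31] at d3 hs l3p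
  obtain ⟨ε, hε⟩ : ∃ ε, ε = (z p - z 1) / 3 := ⟨_, rfl⟩
  have hc : z p = z 1 + 3 * ε := by rw [hε]; ring
  have hL : 3 * ε * (1 - z 1 - z p) = 3 * z 1 ^ 2 := by
    rw [hε]; linear_combination d3 - l3p - dp
  have hε0 : 0 ≤ ε := by linarith
  have hε1 : 4 * ε ≤ z 1 := by
    have hpos : 0 < 1 - z 1 - z p := by linarith
    refine le_of_mul_le_mul_right ?_ hpos
    have : z 1 * (4 * z 1) ≤ z 1 * (1 - z 1 - z p) :=
      mul_le_mul_of_nonneg_left (by linarith) z1.le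
    linarith
  -- The competitor is the star on `[6]`: `3, 4, p, p + 1` are levelled at `z 1 + 2 * ε`, and both
  -- centres `1` and `2` pay `ε`.
  obtain ⟨δ, hδ⟩ : ∃ δ : ℕ → ℝ, δ = fun i =>
    if i = 1 then -ε else if i = 2 then -ε else if i = 3 then 2 * ε else
    if i = 4 then 2 * ε else if i = p then -ε else if i = p + 1 then -ε else 0 := ⟨_, rfl⟩
  have δp : δ p = -ε := by simp [hδ, p0', p1', p2', p3', p4']
  have δq : δ (p + 1) = -ε := by simp [hδ, p0', p1', p2', p3', p4']
  have δ1 : δ 1 = -ε := by simp [hδ]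
  have δ2 : δ 2 = -ε := by simp [hδ]
  have δ3 : δ 3 = 2 * ε := by simp [hδ]
  have δ4 : δ 4 = 2 * ε := by simp [hδ]
  have hδS : ∑ j ∈ Ico 5 p, (z j + δ j) = S := hSdef ▸ sum_congr rfl fun j hj => by
    rw [mem_Ico] at hj
    simp [hδ, show j ≠ 1 by omega, show j ≠ 2 by omega, show j ≠ 3 by omega, show j ≠ 4 by omega, show j ≠ p by omega, show j ≠ p + 1 by omega]
  have hmax := h.max_newton (N := starTriples (p + 2)) (starTriples_subset (by omega))
    (by rw [card_starTriples, hcard]; omega) (δ := δ) (U := {1, 2, 3, 4, p, p + 1})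
    (by
      intro i hi
      simp only [mem_insert, mem_singleton] at hi
      rw [mem_Icc]
      omega)
    (by
      intro i hi
      simp only [mem_insert, mem_singleton, not_or] at hi
      simp [hδ, hi])
    (by
      simp [p1, p2, p3, p4, p0', p1', p2', p3', p4', δ1, δ2, δ3, δ4, δp, δq]
      try ring)
    (by
      intro i hi
      simp only [mem_insert, mem_singleton] at hi
      rcases hi with rfl | rfl | rfl | rfl | rfl | rfl
      · rw [δ1]; linarith
      · rw [δ2]; linarith
      · rw [δ3]; linarith
      · rw [δ4]; linarith
      · rw [δp]; linarith
      · rw [δq]; linarith)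
  rw [edgeSum_starTriples, sum_Ico_succ_top (by omega), sum_Ico_succ_top (by omega), hS, hδS, hM,
    hS] at hmax
  simp [p1, p2, p3, p4, p0', p1', p2', p3', p4', δ1, δ2, δ3, δ4, δp, δq] at hmax
  rw [← hSdef] at hmax
  rw [eq, e43, e21, e31, hc, hS00] at hmax
  rw [hc] at hL
  have key : 4 * ε ^ 2 * (3 * z 1 - 4 * ε) ≤ 0 := by
    linear_combination hmax
  have hε2 : 0 < ε := by
    rcases hε0.eq_or_lt with h0 | h0
    · rw [← h0] at hL
      nlinarith
    · exact h0
  have : 0 < 4 * ε ^ 2 * (3 * z 1 - 4 * ε) := mul_pos (by positivity) (by linarith)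
  linarith

theorem not_star_add_134_234 (h : ExtremalComplement t M z) {p : ℕ} (hp : 6 ≤ p) (hpt : p + 1 ≤ t)
    (hM : ∀ x, edgeSum M x = x 1 * x 2 * ∑ j ∈ Ico 3 p, x j + (x 1 * x 3 * x 4 + x 2 * x 3 * x 4))
    (hcard : #M = p - 3 + 2) : False := by
  have hmem : ∀ i, 1 ≤ i → i ≤ t → i ∈ Icc 1 t := fun i h1 h2 => mem_Icc.2 ⟨h1, h2⟩
  have d1 := edgeDeriv_one_of_star hM z
  have d2 := edgeDeriv_two_of_star hM z
  have d3 := edgeDeriv_of_star hM z (i := 3) (by omega) (by omega)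
  have d4 := edgeDeriv_of_star hM z (i := 4) (by omega) (by omega)
  have dp := edgeDeriv_of_star_of_le hM z (i := p) (by omega) (by omega)
  have dq := edgeDeriv_of_star_of_le hM z (i := p + 1) (by omega) (by omega)
  have p1 : (1 : ℕ) ≠ p := by omega
  have p2 : (2 : ℕ) ≠ p := by omega
  have p3 : (3 : ℕ) ≠ p := by omega
  have p4 : (4 : ℕ) ≠ p := by omega
  have p0' : p ≠ 0 := by omega
  have p1' : p ≠ 1 := by omega
  have p2' : p ≠ 2 := by omega
  have p3' : p ≠ 3 := by omega
  have p4' : p ≠ 4 := by omega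
  simp [Function.update, p1, p2, p3, p4, p0', p1', p2', p3', p4'] at d1 d2 d3 d4 dp dq
  have eq := h.eq_of_edgeDeriv_eq (hmem (p + 1) (by omega) (by omega))
    (hmem p (by omega) (by omega)) (dq.trans dp.symm)
  have hS : ∀ x : ℕ → ℝ, ∑ j ∈ Ico 3 p, x j = x 3 + (x 4 + (∑ j ∈ Ico 5 p, x j)) := by
    intro x
    rw [sum_eq_sum_Ico_succ_bot (by omega), sum_eq_sum_Ico_succ_bot (by omega)]
  have hs := h.sum_le_one (s := {1, 2, 3, 4, p, p + 1} ∪ Ico 5 p) (by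
    intro i hi
    simp only [mem_union, mem_insert, mem_singleton, mem_Ico] at hi
    rw [mem_Icc]
    omega)
  rw [sum_union (by
    rw [disjoint_left]
    intro i hi hi'
    simp only [mem_insert, mem_singleton, mem_Ico] at hi hi'
    omega)] at hs
  simp [p1, p2, p3, p4, p0', p1', p2', p3', p4'] at hs
  have hS0 : 0 ≤ ∑ j ∈ Ico 5 p, z j := sum_nonneg fun j hj => by
    rw [mem_Ico] at hj
    exact (h.pos j (hmem j (by omega) (by omega))).le
  have z1 := h.pos 1 (hmem 1 (by omega) (by omega))
  have m12 := h.mono 1 2 (by omega) (by omega) (by omega)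
  have m23 := h.mono 2 3 (by omega) (by omega) (by omega)
  have m34 := h.mono 3 4 (by omega) (by omega) (by omega)
  have m4p := h.mono 4 p (by omega) (by omega) (by omega)
  have hS5 : 5 < p → z 5 ≤ ∑ j ∈ Ico 5 p, z j := fun hlt =>
    single_le_sum (f := z) (fun j hj => by
      rw [mem_Ico] at hj
      exact (h.pos j (hmem j (by omega) (by omega))).le) (mem_Ico.2 ⟨le_rfl, hlt⟩)
  rw [hS] at d1 d2
  obtain ⟨S, hSdef⟩ : ∃ S, S = ∑ j ∈ Ico 5 p, z j := ⟨_, rfl⟩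
  rw [← hSdef] at d1 d2 hS0 hs hS5
  rw [eq] at hs
  have l12 := h.lagrange (hmem 1 (by omega) (by omega)) (hmem 2 (by omega) (by omega))
  have l13 := h.lagrange (hmem 1 (by omega) (by omega)) (hmem 3 (by omega) (by omega))
  have l34 := h.lagrange (hmem 3 (by omega) (by omega)) (hmem 4 (by omega) (by omega))
  have l3p := h.lagrange (hmem 3 (by omega) (by omega)) (hmem p (by omega) (by omega))
  have m45 := h.mono 4 5 (by omega) (by omega) (by omega)
  have hS6 := hS5 (by omega)
  have e43 : z 4 = z 3 := by
    have : (z 4 - z 3) * (1 - z 3 - z 4 - z 1 - z 2) = 0 := by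
      linear_combination -l34 + d3 - d4
    rcases mul_eq_zero.1 this with h0 | h0 <;> linarith
  rw [e43] at d1 d2 d3 hs
  have e21 : z 2 = z 1 := by
    have : (z 2 - z 1) * (1 - z 1 - z 2 - 2 * z 3 - S) = 0 := by
      linear_combination -l12 + d1 - d2
    rcases mul_eq_zero.1 this with h0 | h0 <;> linarith
  rw [e21] at d3 hs d1
  obtain ⟨ε, hε⟩ : ∃ ε, ε = (z p - z 3) / 2 := ⟨_, rfl⟩
  have hc : z p = z 3 + 2 * ε := by rw [hε]; ring
  have hL : 2 * ε * (1 - z 3 - z p) = z 1 * (z 1 + 2 * z 3) := by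
    rw [hε]; linear_combination d3 - l3p - dp
  have hL2 : (z 3 - z 1) * (1 - 2 * z 1 - 2 * z 3) = z 1 * S := by
    linear_combination d1 - d3 - l13
  have hε0 : 0 ≤ ε := by linarith
  -- Symmetry gives `z 1 = z 2` and `z 3 = z 4`; levelling `3, 4, p, p + 1` suffices, because vertex
  -- `5` lies in the star and bounds `S` from below.
  obtain ⟨δ, hδ⟩ : ∃ δ : ℕ → ℝ, δ = fun i =>
    if i = 3 then ε else if i = 4 then ε else if i = p then -ε else if i = p + 1 then -ε else 0 := ⟨_, rfl⟩
  have δp : δ p = -ε := by simp [hδ, p0', p1', p2', p3', p4']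
  have δq : δ (p + 1) = -ε := by simp [hδ, p0', p1', p2', p3', p4']
  have δ1 : δ 1 = 0 := by simp [hδ, p1, p2, p3, p4, p0', p1', p2', p3', p4']
  have δ2 : δ 2 = 0 := by simp [hδ, p1, p2, p3, p4, p0', p1', p2', p3', p4']
  have δ3 : δ 3 = ε := by simp [hδ]
  have δ4 : δ 4 = ε := by simp [hδ]
  have hδS : ∑ j ∈ Ico 5 p, (z j + δ j) = S := hSdef ▸ sum_congr rfl fun j hj => by
    rw [mem_Ico] at hj
    simp [hδ, show j ≠ 3 by omega, show j ≠ 4 by omega, show j ≠ p by omega, show j ≠ p + 1 by omega]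
  have hmax := h.max_newton (N := starTriples (p + 2)) (starTriples_subset (by omega))
    (by rw [card_starTriples, hcard]; omega) (δ := δ) (U := {3, 4, p, p + 1})
    (by
      intro i hi
      simp only [mem_insert, mem_singleton] at hi
      rw [mem_Icc]
      omega)
    (by
      intro i hi
      simp only [mem_insert, mem_singleton, not_or] at hi
      simp [hδ, hi])
    (by
      simp [p1, p2, p3, p4, p0', p1', p2', p3', p4', δ1, δ2, δ3, δ4, δp, δq]
      try ring)
    (by
      intro i hi
      simp only [mem_insert, mem_singleton] at hi
      rcases hi with rfl | rfl | rfl | rfl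
      · rw [δ3]; linarith
      · rw [δ4]; linarith
      · rw [δp]; linarith
      · rw [δq]; linarith)
  rw [edgeSum_starTriples, sum_Ico_succ_top (by omega), sum_Ico_succ_top (by omega), hS, hδS, hM,
    hS] at hmax
  simp [p1, p2, p3, p4, p0', p1', p2', p3', p4', δ1, δ2, δ3, δ4, δp, δq] at hmax
  rw [← hSdef] at hmax
  rw [eq, e43, e21, hc] at hmax
  rw [hc] at hL hs
  have key : z 1 * (2 * z 3 * (z 3 - z 1) + ε * (2 * z 3 - 3 * z 1)) ≤ 0 := by
    linear_combination hmax - ε * hL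
  exact real_ineq_134_234 z1 (by linarith) hε0 (by linarith) (by linarith) hL hL2 key

end ExtremalComplement

set_option linter.unusedSimpArgs false

/-- This remainder has no symmetry, so `b` and `u` differ. The total weight gives `5 h ≤ a`; the
swap inequality `hswap` and the Lagrange equations give `κ b ≤ c h` and then `4 c ≤ 7 b`. With
these, `key` reduces to an inequality between `b` and `c` alone. -/
theorem real_ineq_134_135_234 {a x y b u c h S κ : ℝ} (ha : 0 < a) (hax : a ≤ x) (hxy : x ≤ y)
    (hyb : y ≤ b) (hbu : b ≤ u) (huc : u ≤ c) (hh : 0 < h) (hc : c = u + 2 * h) (hκ : κ = u - b)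
    (hS : 0 ≤ S) (hs : a + x + y + b + u + 3 * c + S ≤ 1) (hswap : y * b ≤ a * c)
    (hL5 : 2 * h * (1 - c - u) = a * (x + y)) (hL45 : κ * (1 - b - u) = x * y)
    (key : a * y * b + a * y * u + x * y * b - 3 * a * x * c
      + h * (a * (3 * y + 2 * b + 2 * u + 3 * x + 6 * c) + 2 * x * y + 2 * x * b - 2 * y * b)
      + h ^ 2 * (-8 + 4 * x + 4 * y + 4 * b + u + 3 * c + 4 * a) + 2 * h ^ 3 ≤ 0) : False := by
  have hx : 0 < x := by linarith
  have hy : 0 < y := by linarith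
  have hb : 0 < b := by linarith
  have hκ0 : 0 ≤ κ := by linarith
  have hc0 : 0 < c := by linarith
  have hD : 5 / 2 * (x + y) ≤ 1 - c - u := by linarith
  have hD0 : 0 < 1 - c - u := by linarith
  -- `h ≤ a / 5`
  have hha : 5 * h ≤ a := by
    have h1 : 2 * h * (5 / 2 * (x + y)) ≤ a * (x + y) := by
      rw [← hL5]
      exact mul_le_mul_of_nonneg_left hD (by linarith)
    refine le_of_mul_le_mul_right ?_ (show 0 < x + y by linarith)
    linarith
  -- `κ b ≤ c h`
  have hκb : κ * b ≤ c * h := by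
    have h1 : 0 < 1 - b - u := by linarith
    have h2 : κ * b * (1 - b - u) ≤ c * h * (1 - b - u) := by
      have e1 : κ * b * (1 - b - u) = x * (y * b) := by rw [mul_right_comm, hL45]; ring
      have e2 : x * (y * b) ≤ x * (a * c) := mul_le_mul_of_nonneg_left hswap hx.le
      have e3 : (2 * x) * (a * c) ≤ (x + y) * (a * c) :=
        mul_le_mul_of_nonneg_right (by linarith) (by positivity)
      have e4 : (x + y) * (a * c) = 2 * (c * h * (1 - c - u)) := by
        linear_combination -c * hL5
      have e5 : c * h * (1 - c - u) ≤ c * h * (1 - b - u) :=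
        mul_le_mul_of_nonneg_left (by linarith) (by positivity)
      linarith
    exact le_of_mul_le_mul_right h2 h1
  -- `c ≤ 7 / 4 b`
  have hcb : 4 * c ≤ 7 * b := by
    have h1 : c * h ≤ c * (b / 5) := mul_le_mul_of_nonneg_left (by linarith) hc0.le
    have h2 : κ ≤ c / 5 := by
      refine le_of_mul_le_mul_right ?_ hb
      linarith
    linarith
  have hT : h ^ 2 * (7 * u + 5 * c - 4 * x - 4 * y - 4 * b)
      ≤ h * a / 5 * (7 * u + 5 * c - 4 * x - 4 * y - 4 * b) := by
    refine mul_le_mul_of_nonneg_right ?_ (by linarith)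
    have := mul_le_mul_of_nonneg_left hha hh.le
    linarith
  have hσ : 0 ≤ (a - 2 * h) * ((y - x) * b) :=
    mul_nonneg (by linarith) (mul_nonneg (by linarith) hb.le)
  have hσ2 : 0 ≤ a * ((y - x) * u) :=
    mul_nonneg ha.le (mul_nonneg (by linarith) (by linarith))
  have hya : 0 ≤ h * (x * (y - a)) := mul_nonneg hh.le (mul_nonneg hx.le (by linarith))
  have hya2 : 0 ≤ x * u * (y - a) := mul_nonneg (mul_nonneg hx.le (by linarith)) (by linarith)
  have h3 : 0 < h ^ 3 := pow_pos hh 3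
  have hha2 : 0 ≤ h ^ 2 * a := by positivity
  have step : h * a * (6 * c + 2 * b + 2 * u - y - 5 * x)
      - h * a / 5 * (7 * u + 5 * c - 4 * x - 4 * y - 4 * b) < (a + y) * x * κ := by
    have hL5' : h ^ 2 * (1 - c - u) = h * (a * (x + y)) / 2 := by linear_combination h / 2 * hL5
    subst hκ
    have : c * a * x = (u + 2 * h) * a * x := by rw [hc]
    linarith
  have hk : (a + y) * x * κ * b ^ 2 ≤ a * (b + c) * c * x * h := by
    have e1 : (a + y) * b ≤ a * (b + c) := by linarith
    calc (a + y) * x * κ * b ^ 2 = ((a + y) * b) * (κ * b) * x := by ring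
      _ ≤ (a * (b + c)) * (c * h) * x := by
        refine mul_le_mul_of_nonneg_right ?_ hx.le
        exact mul_le_mul e1 hκb (by positivity) (by positivity)
      _ = a * (b + c) * c * x * h := by ring
  have h5 : (6 * c + 2 * b + 2 * u - y - 5 * x - (7 * u + 5 * c - 4 * x - 4 * y - 4 * b) / 5) * b ^ 2
      < (b + c) * c * x := by
    have h6 := mul_lt_mul_of_pos_right step (show 0 < b ^ 2 by positivity)
    refine lt_of_mul_lt_mul_left ?_ (mul_nonneg hh.le ha.le)
    linarith
  have h7 : (5 * c + 16 / 5 * b - 21 / 5 * x) * b ^ 2 < (b + c) * c * x :=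
    lt_of_le_of_lt (mul_le_mul_of_nonneg_right (by linarith) (by positivity)) h5
  have h8 : (b + c) * c * x ≤ (b + c) * c * b :=
    mul_le_mul_of_nonneg_left (by linarith) (by positivity)
  have h9 : (5 * c - b) * b ^ 2 ≤ (5 * c + 16 / 5 * b - 21 / 5 * x) * b ^ 2 :=
    mul_le_mul_of_nonneg_right (by linarith) (by positivity)
  have h10 : (5 * c - b) * b < (b + c) * c := by
    refine lt_of_mul_lt_mul_right ?_ hb.le
    linarith
  -- `h10` says `c² - 4 b c + b² > 0`, which is false for `b ≤ c ≤ 7 b / 4`.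
  nlinarith

namespace ExtremalComplement

variable {t : ℕ} {M : Finset (Finset ℕ)} {z : ℕ → ℝ}

theorem not_star_add_134_135_234 (h : ExtremalComplement t M z) {p : ℕ} (hp : 6 ≤ p) (hpt : p + 2 ≤ t)
    (hM : ∀ x, edgeSum M x = x 1 * x 2 * ∑ j ∈ Ico 3 p, x j + (x 1 * x 3 * x 4 + x 1 * x 3 * x 5 + x 2 * x 3 * x 4))
    (hcard : #M = p - 3 + 3)
    (hswap : z 3 * z 4 ≤ z 1 * z p) : False := by
  have hmem : ∀ i, 1 ≤ i → i ≤ t → i ∈ Icc 1 t := fun i h1 h2 => mem_Icc.2 ⟨h1, h2⟩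
  have d1 := edgeDeriv_one_of_star hM z
  have d2 := edgeDeriv_two_of_star hM z
  have d3 := edgeDeriv_of_star hM z (i := 3) (by omega) (by omega)
  have d4 := edgeDeriv_of_star hM z (i := 4) (by omega) (by omega)
  have d5 := edgeDeriv_of_star hM z (i := 5) (by omega) (by omega)
  have dp := edgeDeriv_of_star_of_le hM z (i := p) (by omega) (by omega)
  have dq := edgeDeriv_of_star_of_le hM z (i := p + 1) (by omega) (by omega)
  have dr := edgeDeriv_of_star_of_le hM z (i := p + 2) (by omega) (by omega)
  have p1 : (1 : ℕ) ≠ p := by omega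
  have p2 : (2 : ℕ) ≠ p := by omega
  have p3 : (3 : ℕ) ≠ p := by omega
  have p4 : (4 : ℕ) ≠ p := by omega
  have p5 : (5 : ℕ) ≠ p := by omega
  have p0' : p ≠ 0 := by omega
  have p1' : p ≠ 1 := by omega
  have p2' : p ≠ 2 := by omega
  have p3' : p ≠ 3 := by omega
  have p4' : p ≠ 4 := by omega
  have p5' : p ≠ 5 := by omega
  simp [Function.update, p1, p2, p3, p4, p5, p0', p1', p2', p3', p4', p5'] at d1 d2 d3 d4 d5 dp dq dr
  have eq := h.eq_of_edgeDeriv_eq (hmem (p + 1) (by omega) (by omega))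
    (hmem p (by omega) (by omega)) (dq.trans dp.symm)
  have er := h.eq_of_edgeDeriv_eq (hmem (p + 2) (by omega) (by omega))
    (hmem p (by omega) (by omega)) (dr.trans dp.symm)
  have hS : ∀ x : ℕ → ℝ, ∑ j ∈ Ico 3 p, x j = x 3 + (x 4 + (x 5 + (∑ j ∈ Ico 6 p, x j))) := by
    intro x
    rw [sum_eq_sum_Ico_succ_bot (by omega), sum_eq_sum_Ico_succ_bot (by omega), sum_eq_sum_Ico_succ_bot (by omega)]
  have hs := h.sum_le_one (s := {1, 2, 3, 4, 5, p, p + 1, p + 2} ∪ Ico 6 p) (by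
    intro i hi
    simp only [mem_union, mem_insert, mem_singleton, mem_Ico] at hi
    rw [mem_Icc]
    omega)
  rw [sum_union (by
    rw [disjoint_left]
    intro i hi hi'
    simp only [mem_insert, mem_singleton, mem_Ico] at hi hi'
    omega)] at hs
  simp [p1, p2, p3, p4, p5, p0', p1', p2', p3', p4', p5'] at hs
  have hS0 : 0 ≤ ∑ j ∈ Ico 6 p, z j := sum_nonneg fun j hj => by
    rw [mem_Ico] at hj
    exact (h.pos j (hmem j (by omega) (by omega))).le
  have z1 := h.pos 1 (hmem 1 (by omega) (by omega))
  have m12 := h.mono 1 2 (by omega) (by omega) (by omega)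
  have m23 := h.mono 2 3 (by omega) (by omega) (by omega)
  have m34 := h.mono 3 4 (by omega) (by omega) (by omega)
  have m45 := h.mono 4 5 (by omega) (by omega) (by omega)
  have m5p := h.mono 5 p (by omega) (by omega) (by omega)
  rw [hS] at d1 d2
  obtain ⟨S, hSdef⟩ : ∃ S, S = ∑ j ∈ Ico 6 p, z j := ⟨_, rfl⟩
  rw [← hSdef] at d1 d2 hS0 hs
  rw [eq, er] at hs
  have l23 := h.lagrange (hmem 2 (by omega) (by omega)) (hmem 3 (by omega) (by omega))
  have l45 := h.lagrange (hmem 4 (by omega) (by omega)) (hmem 5 (by omega) (by omega))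
  have l5p := h.lagrange (hmem 5 (by omega) (by omega)) (hmem p (by omega) (by omega))
  obtain ⟨ε, hε⟩ : ∃ ε, ε = (z p - z 5) / 2 := ⟨_, rfl⟩
  have hc : z p = z 5 + 2 * ε := by rw [hε]; ring
  have hL5' : (z p - z 5) * (1 - z p - z 5) = z 1 * (z 2 + z 3) := by
    linear_combination d5 - l5p - dp
  have hL5 : 2 * ε * (1 - z p - z 5) = z 1 * (z 2 + z 3) := by
    rw [hε]; linear_combination hL5'
  have hL45 : (z 5 - z 4) * (1 - z 4 - z 5) = z 2 * z 3 := by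
    linear_combination d4 - l45 - d5
  have hL23 : (z 3 - z 2) * (1 - z 1 - z 2 - z 3 - z 4) = z 1 * S := by
    linear_combination d2 - d3 - l23
  have hpos : 0 < 1 - z p - z 5 := by linarith
  have hε0 : 0 < ε := by
    have : 0 < 2 * ε := pos_of_mul_pos_left (by rw [hL5]; exact mul_pos z1 (by linarith)) hpos.le
    linarith
  have hε1 : 2 * ε ≤ z 1 := by
    refine le_of_mul_le_mul_right ?_ hpos
    rw [hL5]
    exact mul_le_mul_of_nonneg_left (by linarith) z1.le
  -- Vertices `5, p, p + 1, p + 2` are levelled at `z 5 + ε`; the lighter `3` and `4` gain `2 * ε`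
  -- each, and `2` pays `2 * ε`.
  obtain ⟨δ, hδ⟩ : ∃ δ : ℕ → ℝ, δ = fun i =>
    if i = 2 then -(2 * ε) else if i = 3 then 2 * ε else if i = 4 then 2 * ε else
    if i = 5 then ε else if i = p then -ε else if i = p + 1 then -ε else
    if i = p + 2 then -ε else 0 := ⟨_, rfl⟩
  have δp : δ p = -ε := by simp [hδ, p0', p1', p2', p3', p4', p5']
  have δq : δ (p + 1) = -ε := by simp [hδ, p0', p1', p2', p3', p4', p5']
  have δr : δ (p + 2) = -ε := by simp [hδ, p0', p1', p2', p3', p4', p5']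
  have δ1 : δ 1 = 0 := by simp [hδ, p1, p2, p3, p4, p5, p0', p1', p2', p3', p4', p5']
  have δ2 : δ 2 = -(2 * ε) := by simp [hδ]
  have δ3 : δ 3 = 2 * ε := by simp [hδ]
  have δ4 : δ 4 = 2 * ε := by simp [hδ]
  have δ5 : δ 5 = ε := by simp [hδ]
  have hδS : ∑ j ∈ Ico 6 p, (z j + δ j) = S := hSdef ▸ sum_congr rfl fun j hj => by
    rw [mem_Ico] at hj
    simp [hδ, show j ≠ 2 by omega, show j ≠ 3 by omega, show j ≠ 4 by omega, show j ≠ 5 by omega, show j ≠ p by omega, show j ≠ p + 1 by omega, show j ≠ p + 2 by omega]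
  have hmax := h.max_newton (N := starTriples (p + 3)) (starTriples_subset (by omega))
    (by rw [card_starTriples, hcard]; omega) (δ := δ) (U := {2, 3, 4, 5, p, p + 1, p + 2})
    (by
      intro i hi
      simp only [mem_insert, mem_singleton] at hi
      rw [mem_Icc]
      omega)
    (by
      intro i hi
      simp only [mem_insert, mem_singleton, not_or] at hi
      simp [hδ, hi])
    (by
      simp [p1, p2, p3, p4, p5, p0', p1', p2', p3', p4', p5', δ1, δ2, δ3, δ4, δ5, δp, δq, δr]
      try ring)
    (by
      intro i hi
      simp only [mem_insert, mem_singleton] at hi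
      rcases hi with rfl | rfl | rfl | rfl | rfl | rfl | rfl
      · rw [δ2]; linarith
      · rw [δ3]; linarith
      · rw [δ4]; linarith
      · rw [δ5]; linarith
      · rw [δp]; linarith
      · rw [δq]; linarith
      · rw [δr]; linarith)
  rw [edgeSum_starTriples, sum_Ico_succ_top (by omega), sum_Ico_succ_top (by omega), sum_Ico_succ_top (by omega), hS, hδS, hM,
    hS] at hmax
  simp [p1, p2, p3, p4, p5, p0', p1', p2', p3', p4', p5', δ1, δ2, δ3, δ4, δ5, δp, δq, δr] at hmax
  rw [← hSdef] at hmax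
  rw [eq, er] at hmax
  refine real_ineq_134_135_234 z1 m12 m23 m34 m45 m5p hε0 hc rfl hS0 (by linarith) hswap hL5 hL45 ?_
  linear_combination hmax + 2 * ε * hL23 - 2 * ε * hL45 - 3 * ε * hL5'

end ExtremalComplement

/-! ### Classification of small remainders outside the star -/

theorem notMem_starTriples {p a b c : ℕ} (hab : a < b) (hb : 3 ≤ b) (hbc : b < c) :
    ({a, b, c} : Finset ℕ) ∉ starTriples p := by
  intro h
  obtain ⟨j, hj, _, he⟩ := mem_starTriples.1 h
  have h1 : 1 ∈ ({a, b, c} : Finset ℕ) := by rw [he]; simp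
  have h2 : 2 ∈ ({a, b, c} : Finset ℕ) := by rw [he]; simp
  simp only [mem_insert, mem_singleton] at h1 h2
  omega

namespace ExtremalComplement

variable {t : ℕ} {M : Finset (Finset ℕ)} {z : ℕ → ℝ}

theorem exists_cut (h : ExtremalComplement t M z) :
    ∃ p, 3 ≤ p ∧ p ≤ t ∧ ∀ j, 3 ≤ j → (({1, 2, j} : Finset ℕ) ∈ M ↔ j < p) := by
  classical
  have hex : ∃ p, 3 ≤ p ∧ ({1, 2, p} : Finset ℕ) ∉ M := ⟨t, h.three_le, h.notMem⟩
  refine ⟨Nat.find hex, (Nat.find_spec hex).1, Nat.find_min' hex ⟨h.three_le, h.notMem⟩,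
    fun j hj => ⟨fun hjM => ?_, fun hjp => ?_⟩⟩
  · by_contra hcon
    exact (Nat.find_spec hex).2 (h.down 1 2 j 1 2 _ le_rfl (by omega)
      (by have := (Nat.find_spec hex).1; omega) le_rfl le_rfl (by omega) (by omega) (by omega) hjM)
  · by_contra hcon
    exact Nat.find_min hex hjp ⟨hj, hcon⟩

theorem starTriples_subset_of_cut {p : ℕ}
    (hp : ∀ j, 3 ≤ j → (({1, 2, j} : Finset ℕ) ∈ M ↔ j < p)) : starTriples p ⊆ M := by
  intro e he
  obtain ⟨j, h1, h2, rfl⟩ := mem_starTriples.1 he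
  exact (hp j h1).2 h2

theorem edgeSum_of_cut {p : ℕ} (hp : ∀ j, 3 ≤ j → (({1, 2, j} : Finset ℕ) ∈ M ↔ j < p))
    (x : ℕ → ℝ) : edgeSum M x
      = x 1 * x 2 * ∑ j ∈ Ico 3 p, x j + edgeSum (M \ starTriples p) x := by
  rw [← edgeSum_starTriples, edgeSum, edgeSum, edgeSum,
    ← sum_sdiff (starTriples_subset_of_cut hp), add_comm]

theorem card_of_cut {p : ℕ} (hp : ∀ j, 3 ≤ j → (({1, 2, j} : Finset ℕ) ∈ M ↔ j < p)) :
    #M = p - 3 + #(M \ starTriples p) := by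
  rw [← card_starTriples, add_comm, card_sdiff_add_card_eq_card (starTriples_subset_of_cut hp)]

/-- The bound `c < p` holds since `{1, 2, c}` lies below `{a, b, c}`, and `b = 2` would give a
triple of the star. -/
theorem exists_of_mem_sdiff (h : ExtremalComplement t M z) {p : ℕ}
    (hp : ∀ j, 3 ≤ j → (({1, 2, j} : Finset ℕ) ∈ M ↔ j < p)) {e : Finset ℕ}
    (he : e ∈ M \ starTriples p) :
    ∃ a b c, 1 ≤ a ∧ a < b ∧ 3 ≤ b ∧ b < c ∧ c < p ∧ e = {a, b, c} := by
  obtain ⟨heM, heS⟩ := mem_sdiff.1 he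
  obtain ⟨a, b, c, ha, hab, hbc, hc, rfl⟩ := exists_eq_triple (h.subset heM)
  have hcp : c < p := by
    rw [← hp c (by omega)]
    exact h.down a b c 1 2 c le_rfl (by omega) (by omega) ha (by omega) le_rfl hab hbc heM
  refine ⟨a, b, c, ha, hab, ?_, hbc, hcp, rfl⟩
  by_contra hb
  refine heS (mem_starTriples.2 ⟨c, by omega, hcp, ?_⟩)
  rw [show a = 1 by omega, show b = 2 by omega]

theorem mem_sdiff_of_le (h : ExtremalComplement t M z) {p a b c a' b' c' : ℕ} (ha : 1 ≤ a')
    (hab' : a' < b') (hb' : 3 ≤ b') (hbc' : b' < c') (h1 : a' ≤ a) (h2 : b' ≤ b) (h3 : c' ≤ c)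
    (hab : a < b) (hbc : b < c) (he : ({a, b, c} : Finset ℕ) ∈ M \ starTriples p) :
    ({a', b', c'} : Finset ℕ) ∈ M \ starTriples p :=
  mem_sdiff.2 ⟨h.down a b c a' b' c' ha hab' hbc' h1 h2 h3 hab hbc (mem_sdiff.1 he).1,
    notMem_starTriples hab' hb' hbc'⟩

/-- There are no extremal complements with few triples outside the star of the pair `{1, 2}`. -/
theorem sdiff_starTriples_eq_empty (h : ExtremalComplement t M z) {p : ℕ}
    (hp : ∀ j, 3 ≤ j → (({1, 2, j} : Finset ℕ) ∈ M ↔ j < p))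
    (hD : #(M \ starTriples p) ≤ 3) (hpt : p + #(M \ starTriples p) ≤ t + 1) :
    M \ starTriples p = ∅ := by
  have hM := edgeSum_of_cut hp
  have hcard := card_of_cut hp
  have hex : ∀ e ∈ M \ starTriples p, _ := fun e he => h.exists_of_mem_sdiff hp he
  have hle : ∀ a b c a' b' c' : ℕ, 1 ≤ a' → a' < b' → 3 ≤ b' → b' < c' → a' ≤ a → b' ≤ b →
      c' ≤ c → a < b → b < c → ({a, b, c} : Finset ℕ) ∈ M \ starTriples p →
      ({a', b', c'} : Finset ℕ) ∈ M \ starTriples p :=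
    fun a b c a' b' c' g1 g2 g3 g4 g5 g6 g7 g8 g9 g => h.mem_sdiff_of_le g1 g2 g3 g4 g5 g6 g7 g8 g9 g
  generalize hDdef : M \ starTriples p = D at *
  by_contra hne
  obtain ⟨e, he⟩ := nonempty_iff_ne_empty.2 hne
  obtain ⟨a, b, c, ha, hab, hb, hbc, hcp, rfl⟩ := hex e he
  -- `{1, 3, 4}` is the least triple outside the star; the next possible ones are `{1, 3, 5}` and
  -- `{2, 3, 4}`, so few down-closed remainders exist.
  have h134 := hle a b c 1 3 4 le_rfl (by omega) le_rfl (by omega) ha hb (by omega) hab hbc he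
  have hlt : ∀ i j k : ℕ, i < j → j < k → ({i, j, k} : Finset ℕ) ∈ D → k < p := by
    intro i j k hij hjk hm
    obtain ⟨a, b, c, ha, hab, hb, hbc, hcp, he⟩ := hex _ hm
    have : k ∈ ({a, b, c} : Finset ℕ) := by rw [← he]; simp
    simp only [mem_insert, mem_singleton] at this
    omega
  have hpos : 0 < #D := card_pos.2 ⟨_, h134⟩
  have s134 : ∀ x : ℕ → ℝ, ∏ i ∈ ({1, 3, 4} : Finset ℕ), x i = x 1 * x 3 * x 4 :=
    fun x => edgeSum_triple (by omega) (by omega) x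
  have s135 : ∀ x : ℕ → ℝ, ∏ i ∈ ({1, 3, 5} : Finset ℕ), x i = x 1 * x 3 * x 5 :=
    fun x => edgeSum_triple (by omega) (by omega) x
  have s136 : ∀ x : ℕ → ℝ, ∏ i ∈ ({1, 3, 6} : Finset ℕ), x i = x 1 * x 3 * x 6 :=
    fun x => edgeSum_triple (by omega) (by omega) x
  have s145 : ∀ x : ℕ → ℝ, ∏ i ∈ ({1, 4, 5} : Finset ℕ), x i = x 1 * x 4 * x 5 :=
    fun x => edgeSum_triple (by omega) (by omega) x
  have s234 : ∀ x : ℕ → ℝ, ∏ i ∈ ({2, 3, 4} : Finset ℕ), x i = x 2 * x 3 * x 4 :=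
    fun x => edgeSum_triple (by omega) (by omega) x
  rcases (show #D = 1 ∨ 1 < #D by omega) with h1 | h1
  · have hDe : D = {{1, 3, 4}} := by
      symm
      apply eq_of_subset_of_card_le
      · simpa using h134
      · rw [h1]; simp
    refine h.not_star_add_134 (hlt 1 3 4 (by omega) (by omega) h134) (by omega) (fun x => ?_)
      (by omega)
    rw [hM, hDe, edgeSum, sum_singleton, s134]
  have hsec : ({2, 3, 4} : Finset ℕ) ∈ D ∨ ({1, 3, 5} : Finset ℕ) ∈ D := by
    obtain ⟨f, hf, hne⟩ := exists_mem_ne h1 {1, 3, 4}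
    obtain ⟨a, b, c, ha, hab, hb, hbc, hcp, rfl⟩ := hex f hf
    by_cases ha2 : 2 ≤ a
    · exact Or.inl (hle a b c 2 3 4 (by omega) (by omega) le_rfl (by omega) ha2 hb (by omega)
        hab hbc hf)
    · have ha1 : a = 1 := by omega
      have hc5 : 5 ≤ c := by
        by_contra hc
        apply hne
        rw [ha1, show b = 3 by omega, show c = 4 by omega]
      exact Or.inr (hle a b c 1 3 5 (by omega) (by omega) le_rfl (by omega) ha hb hc5
        hab hbc hf)
  rcases (show #D = 2 ∨ #D = 3 by omega) with h2 | h3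
  · rcases hsec with h234 | h135
    · have hDe : D = {{1, 3, 4}, {2, 3, 4}} := by
        symm
        apply eq_of_subset_of_card_le
        · intro f hf
          simp only [mem_insert, mem_singleton] at hf
          rcases hf with rfl | rfl <;> assumption
        · rw [h2]; decide
      have h5 := hlt 1 3 4 (by omega) (by omega) h134
      have hM' : ∀ x, edgeSum M x = x 1 * x 2 * ∑ j ∈ Ico 3 p, x j
          + (x 1 * x 3 * x 4 + x 2 * x 3 * x 4) := by
        intro x
        rw [hM, hDe, edgeSum, sum_pair (by decide), s134, s234]
      rcases (show p = 5 ∨ 6 ≤ p by omega) with h6 | h6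
      · exact h.not_complete_four h6 (by omega) hM' (by omega)
      · exact h.not_star_add_134_234 h6 (by omega) hM' (by omega)
    · have hDe : D = {{1, 3, 4}, {1, 3, 5}} := by
        symm
        apply eq_of_subset_of_card_le
        · intro f hf
          simp only [mem_insert, mem_singleton] at hf
          rcases hf with rfl | rfl <;> assumption
        · rw [h2]; decide
      refine h.not_star_add_134_135 (hlt 1 3 5 (by omega) (by omega) h135) (by omega)
        (fun x => ?_) (by omega)
      rw [hM, hDe, edgeSum, sum_pair (by decide), s134, s135]
  · have hthree : ∀ f g : Finset ℕ, f ∈ D → g ∈ D → #({{1, 3, 4}, f, g} : Finset (Finset ℕ)) = 3 →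
        D = {{1, 3, 4}, f, g} := by
      intro f g hf hg hc
      symm
      apply eq_of_subset_of_card_le
      · intro u hu
        simp only [mem_insert, mem_singleton] at hu
        rcases hu with rfl | rfl | rfl <;> assumption
      · rw [h3, hc]
    by_cases h135 : ({1, 3, 5} : Finset ℕ) ∈ D
    · have h5 := hlt 1 3 5 (by omega) (by omega) h135
      by_cases h234 : ({2, 3, 4} : Finset ℕ) ∈ D
      · have hDe := hthree _ _ h135 h234 (by decide)
        have hM' : ∀ x, edgeSum M x = x 1 * x 2 * ∑ j ∈ Ico 3 p, x j
            + (x 1 * x 3 * x 4 + x 1 * x 3 * x 5 + x 2 * x 3 * x 4) := by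
          intro x
          rw [hM, hDe, edgeSum, sum_insert (by decide), sum_pair (by decide), s134, s135, s234]
          ring
        refine h.not_star_add_134_135_234 h5 (by omega) hM' (by omega) ?_
        have hdis : Disjoint (starTriples (p + 1)) {{1, 3, 4}, {1, 3, 5}} := by
          rw [disjoint_right]
          intro f hf
          simp only [mem_insert, mem_singleton] at hf
          rcases hf with rfl | rfl <;> exact notMem_starTriples (by omega) (by omega) (by omega)
        -- Exchanging `{2, 3, 4}` for `{1, 2, p}` at the same weighting cannot help; dividing by `z
        -- 2` gives the swap inequality.
        have hmax := h.max (starTriples (p + 1) ∪ {{1, 3, 4}, {1, 3, 5}})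
          (union_subset (starTriples_subset (by omega)) (by
            intro f hf
            simp only [mem_insert, mem_singleton] at hf
            rcases hf with rfl | rfl <;>
              exact triple_mem_triples (by omega) (by omega) (by omega) (by omega)))
          (by
            rw [card_union_of_disjoint hdis, card_starTriples, card_pair (by decide)]
            omega) z (fun i hi => (h.pos i hi).le) h.sum_eq
        have hN : edgeSum (starTriples (p + 1) ∪ {{1, 3, 4}, {1, 3, 5}}) z
            = z 1 * z 2 * (∑ j ∈ Ico 3 p, z j + z p) + (z 1 * z 3 * z 4 + z 1 * z 3 * z 5) := by
          rw [edgeSum, sum_union hdis, ← edgeSum, edgeSum_starTriples, sum_Ico_succ_top (by omega),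
            sum_pair (by decide), s134, s135]
        rw [hN, hM'] at hmax
        have z2 := h.pos 2 (mem_Icc.2 (by omega))
        refine le_of_mul_le_mul_left ?_ z2
        linarith
      · obtain ⟨f, hf, hne⟩ : ∃ f ∈ D, f ∉ ({{1, 3, 4}, {1, 3, 5}} : Finset (Finset ℕ)) :=
          exists_mem_notMem_of_card_lt_card (by rw [h3]; decide)
        simp only [mem_insert, mem_singleton, not_or] at hne
        obtain ⟨a, b, c, ha, hab, hb, hbc, hcp, rfl⟩ := hex f hf
        have ha1 : a = 1 := by
          by_contra ha1
          exact h234 (hle a b c 2 3 4 (by omega) (by omega) le_rfl (by omega) (by omega) hb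
            (by omega) hab hbc hf)
        subst ha1
        by_cases hb4 : 4 ≤ b
        · have h145 := hle 1 b c 1 4 5 le_rfl (by omega) (by omega) (by omega) le_rfl hb4
            (by omega) hab hbc hf
          have hDe := hthree _ _ h135 h145 (by decide)
          refine h.not_star_add_134_135_145 h5 (by omega) (fun x => ?_) (by omega)
          rw [hM, hDe, edgeSum, sum_insert (by decide), sum_pair (by decide), s134, s135, s145]
          ring
        · have hb3 : b = 3 := by omega
          subst hb3
          have hc6 : 6 ≤ c := by
            by_contra hc
            rcases (show c = 4 ∨ c = 5 by omega) with rfl | rfl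
            · exact hne.1 rfl
            · exact hne.2 rfl
          have h136 := hle 1 3 c 1 3 6 le_rfl (by omega) (by omega) (by omega) le_rfl le_rfl
            (by omega) hab hbc hf
          have hDe := hthree _ _ h135 h136 (by decide)
          refine h.not_star_add_134_135_136 (hlt 1 3 6 (by omega) (by omega) h136) (by omega)
            (fun x => ?_) (by omega)
          rw [hM, hDe, edgeSum, sum_insert (by decide), sum_pair (by decide), s134, s135, s136]
          ring
    · have h234 := hsec.resolve_right h135
      obtain ⟨f, hf, hne⟩ : ∃ f ∈ D, f ∉ ({{1, 3, 4}, {2, 3, 4}} : Finset (Finset ℕ)) :=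
        exists_mem_notMem_of_card_lt_card (by rw [h3]; decide)
      simp only [mem_insert, mem_singleton, not_or] at hne
      obtain ⟨a, b, c, ha, hab, hb, hbc, hcp, rfl⟩ := hex f hf
      have hc4 : c = 4 := by
        by_contra hc4
        exact h135 (hle a b c 1 3 5 le_rfl (by omega) le_rfl (by omega) ha hb (by omega) hab hbc hf)
      subst hc4
      have hb3 : b = 3 := by omega
      subst hb3
      rcases (show a = 1 ∨ a = 2 by omega) with rfl | rfl
      · exact hne.1 rfl
      · exact hne.2 rfl

end ExtremalComplement

/-! ### Real inequalities for the merging argument -/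

/-- In this and the next two lemmas `h` comes from the Lagrange equation of the vertices `4` and
`p`, with `E = 1 - b - c` and `N` the derivative at `4` of the link of `2`. Such bounds on `c / b`
limit how much heavier the uncovered vertices can be. -/
theorem le_two_mul_of_le {a x y b c E N : ℝ} (ha : 0 < a) (hax : a ≤ x) (hxy : x ≤ y)
    (hyb : y ≤ b) (hE : a + x + y ≤ E) (hN : N ≤ y)
    (h : (c - b) * E ≤ a * (E - a) + x * N) : c ≤ 2 * b := by
  have hE0 : 0 < E := by linarith
  have h1 : x * N ≤ x * y := mul_le_mul_of_nonneg_left hN (by linarith)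
  have h2 : (b - a) * (a + x + y) ≤ (b - a) * E := mul_le_mul_of_nonneg_left hE (by linarith)
  have h3 : (y - a) * (a + x + y) ≤ (b - a) * (a + x + y) :=
    mul_le_mul_of_nonneg_right (by linarith) (by linarith)
  have h4 : a * x ≤ y * y := mul_le_mul (by linarith) hxy (by linarith) (by linarith)
  have h5 : (c - b) * E ≤ b * E := by linarith
  linarith [le_of_mul_le_mul_right h5 hE0]

theorem le_two_mul_of_le' {a x y b u c E N : ℝ} (ha : 0 < a) (hax : a ≤ x) (hxy : x ≤ y)
    (hyb : y ≤ b) (hbu : b ≤ u) (huc : u ≤ c) (hE : a + x + y + u + c ≤ E) (hN : N ≤ y + u)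
    (h : (c - b) * E ≤ a * (E - a - c) + x * N) : c ≤ 2 * b := by
  have hE0 : 0 < E := by linarith
  have h1 : x * N ≤ x * (y + u) := mul_le_mul_of_nonneg_left hN (by linarith)
  have h2 : (b - a) * (a + x + y + c) ≤ (b - a) * E :=
    mul_le_mul_of_nonneg_left (by linarith) (by linarith)
  have h3 : (y - a) * (a + x + y) ≤ (b - a) * (a + x + y) :=
    mul_le_mul_of_nonneg_right (by linarith) (by linarith)
  have h4 : a * x ≤ y * y := mul_le_mul (by linarith) hxy (by linarith) (by linarith)
  have h6 : x * u ≤ b * c := mul_le_mul (by linarith) huc (by linarith) (by linarith)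
  have h5 : (c - b) * E ≤ b * E := by linarith
  linarith [le_of_mul_le_mul_right h5 hE0]

theorem le_three_mul_of_le {a x y b u c E N : ℝ} (ha : 0 < a) (hax : a ≤ x) (hxy : x ≤ y)
    (hyb : y ≤ b) (hbu : b ≤ u) (hE : a + x + y + u ≤ E) (hN : N ≤ y + u)
    (h : (c - b) * E ≤ a * (E - a) + x * N) : c ≤ 3 * b := by
  have hE0 : 0 < E := by linarith
  have h1 : x * N ≤ x * (y + u) := mul_le_mul_of_nonneg_left hN (by linarith)
  have h2 : x * (y + u) ≤ b * E := mul_le_mul (by linarith) (by linarith) (by linarith) (by linarith)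
  have h3 : a * (E - a) ≤ b * E := mul_le_mul (by linarith) (by linarith) (by linarith) (by linarith)
  have h5 : (c - b) * E ≤ 2 * b * E := by linarith
  linarith [le_of_mul_le_mul_right h5 hE0]

theorem real_ineq_cut_one {a x y b c k : ℝ} (ha : 0 < a) (hax : a ≤ x) (hxy : x ≤ y)
    (hyb : y ≤ b) (hk : 0 ≤ k) (hi : (a + x) * (k * (y * b)) < a ^ 2 * (1 * c)) : 2 * k * b < c := by
  have h1 : (2 * a) * (k * (a * b)) ≤ (a + x) * (k * (y * b)) := by
    have hb : 0 < b := by linarith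
    have h2 : k * (a * b) ≤ k * (y * b) :=
      mul_le_mul_of_nonneg_left (mul_le_mul_of_nonneg_right (by linarith) hb.le) hk
    exact mul_le_mul (by linarith) h2 (by positivity) (by linarith)
  refine lt_of_mul_lt_mul_left ?_ (sq_nonneg a)
  linarith

/-- With `x ≤ y` and `c ≤ a + b`, the assumption collapses to `b < x`. -/
theorem real_ineq_star {a x y b c d : ℝ} (ha : 0 < a) (hax : a ≤ x) (hxy : x ≤ y)
    (hyb : y ≤ b) (hd : 0 < d) (hc : c ≤ a + b)
    (hii : (a + x) * (d * (y * b)) < x ^ 2 * (d * c)) : False := by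
  have hx : 0 < x := by linarith
  have hb : 0 < b := by linarith
  have h1 : (a + x) * (y * b) < x ^ 2 * c := by
    refine lt_of_mul_lt_mul_left ?_ hd.le
    linarith
  have h2 : (a + x) * (x * b) ≤ (a + x) * (y * b) :=
    mul_le_mul_of_nonneg_left (mul_le_mul_of_nonneg_right hxy hb.le) (by linarith)
  have h3 : x ^ 2 * c ≤ x ^ 2 * (a + b) := mul_le_mul_of_nonneg_left hc (by positivity)
  have h4 : x * (a * b) < x * (a * x) := by linarith
  have h5 := lt_of_mul_lt_mul_left (lt_of_mul_lt_mul_left h4 hx.le) ha.le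
  linarith

/-- Bounds on the weights in the form in which the contradictions below use them. -/
theorem merge_bounds {a x y b c d k₁ k₂ ρ : ℝ} (ha : 0 < a) (hax : a ≤ x) (hxy : x ≤ y)
    (hyb : y ≤ b) (hd : 0 ≤ d) (hk₁ : 0 ≤ k₁) (hk₂ : 0 ≤ k₂) (hc : c ≤ ρ * b)
    (hi : (a + x) * (k₂ * (y * b)) < a ^ 2 * (d * c))
    (hii : (a + x) * (k₁ * (y * b)) < x ^ 2 * (d * c)) :
    k₂ * (a + x) * x < d * ρ * a ^ 2 ∧ k₁ * (a + x) < d * ρ * x := by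
  have hx : 0 < x := by linarith
  have hb : 0 < b := by linarith
  have h0 : d * c ≤ d * (ρ * b) := mul_le_mul_of_nonneg_left hc hd
  have h1 : ∀ k : ℝ, 0 ≤ k → (a + x) * (k * (x * b)) ≤ (a + x) * (k * (y * b)) := fun k hk =>
    mul_le_mul_of_nonneg_left (mul_le_mul_of_nonneg_left
      (mul_le_mul_of_nonneg_right hxy hb.le) hk) (by linarith)
  constructor
  · have h2 := mul_le_mul_of_nonneg_left h0 (sq_nonneg a)
    refine lt_of_mul_lt_mul_right ?_ hb.le
    linarith [h1 k₂ hk₂]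
  · have h2 := mul_le_mul_of_nonneg_left h0 (sq_nonneg x)
    refine lt_of_mul_lt_mul_right ?_ (mul_nonneg hx.le hb.le)
    linarith [h1 k₁ hk₁]

/-- Used when `d = 2` and the links of `1` and `2` have two pairs and one pair, where `c ≤ 2 b` is
too weak. -/
theorem real_ineq_cut_two_aux {a x y b u c E : ℝ} (ha : 0 < a) (hax : a ≤ x) (hxy : x ≤ y)
    (hyb : y ≤ b) (hbu : b ≤ u) (hE : a + x + y + u + c ≤ E)
    (h : (c - b) * E ≤ a * x + a * y + x * y) : c ≤ 8 / 5 * b := by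
  by_contra hcon
  push Not at hcon
  have h1 : 3 / 5 * b * (a + x + y + 13 / 5 * b) ≤ (c - b) * E :=
    mul_le_mul (by linarith) (by linarith) (by linarith) (by linarith)
  have h2 : x * y ≤ x * b := mul_le_mul_of_nonneg_left hyb (by linarith)
  have h3 : a * y ≤ a * b := mul_le_mul_of_nonneg_left hyb (by linarith)
  have h4 : a * x ≤ a * b := mul_le_mul_of_nonneg_left (by linarith) (by linarith)
  have h5 : a * b ≤ b * b := mul_le_mul_of_nonneg_right (by linarith) (by linarith)
  have h6 : x * b ≤ b * b := mul_le_mul_of_nonneg_right (by linarith) (by linarith)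
  have h7 : 0 ≤ (b - x) * (b - y) := mul_nonneg (by linarith) (by linarith)
  have h8 : 0 ≤ (b - a) * (b - y) := mul_nonneg (by linarith) (by linarith)
  have h9 : 0 ≤ (b - a) * (b - x) := mul_nonneg (by linarith) (by linarith)
  nlinarith

/-- Used when `d = 3` and the link of `1` has three pairs. The key is that `hii` gives `a b < x (c -
b)`, so `a` is small against `x` as soon as `c` is close to `b`. -/
theorem real_ineq_cut_three_aux {a x y b u c E : ℝ} (ha : 0 < a) (hax : a ≤ x) (hxy : x ≤ y)
    (hyb : y ≤ b) (hbu : b ≤ u) (hbc : b ≤ c) (hE : a + x + y + u + 2 * c ≤ E)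
    (hii : (a + x) * (y * b) < x ^ 2 * c)
    (h : (c - b) * E ≤ a * x + a * (y + u) + x * y) : c ≤ 7 / 5 * b ∧ 5 * a ≤ 2 * x := by
  have hx : 0 < x := by linarith
  have hb : 0 < b := by linarith
  have hab : a * b < x * (c - b) := by
    have h1 : (a + x) * (x * b) ≤ (a + x) * (y * b) :=
      mul_le_mul_of_nonneg_left (mul_le_mul_of_nonneg_right hxy hb.le) (by linarith)
    refine lt_of_mul_lt_mul_left ?_ hx.le
    linarith
  have hE' : (c - b) * (a + x + y + u + 2 * c) ≤ (c - b) * E :=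
    mul_le_mul_of_nonneg_left hE (by linarith)
  have h2 : a * b * (x + y + u) ≤ x * (c - b) * (x + y + u) :=
    mul_le_mul_of_nonneg_right hab.le (by linarith)
  have h3 : x * (c - b) * (x + y + u) ≤ b * ((c - b) * (x + y + u)) := by
    have : 0 ≤ (c - b) * (x + y + u) := mul_nonneg (by linarith) (by linarith)
    have := mul_le_mul_of_nonneg_right (show x ≤ b by linarith) this
    linarith
  have h4 : x * y * b ≤ b * b * b :=
    mul_le_mul_of_nonneg_right (mul_le_mul (by linarith) hyb (by linarith) hb.le) hb.le
  have h5 : b * ((c - b) * (a + 2 * c)) ≤ b * (b * b) := by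
    have := mul_le_mul_of_nonneg_left (hE'.trans h) hb.le
    linarith
  have h6 : (c - b) * (a + 2 * c) ≤ b * b := le_of_mul_le_mul_left h5 hb
  have hc : c ≤ 7 / 5 * b := by
    by_contra hcon
    push Not at hcon
    have : 2 / 5 * b * (14 / 5 * b) ≤ (c - b) * (a + 2 * c) :=
      mul_le_mul (by linarith) (by linarith) (by linarith) (by linarith)
    nlinarith [mul_pos hb hb]
  refine ⟨hc, ?_⟩
  have : x * (c - b) ≤ x * (2 / 5 * b) := mul_le_mul_of_nonneg_left (by linarith) hx.le
  have h7 : a * b ≤ 2 / 5 * x * b := by linarith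
  linarith [le_of_mul_le_mul_right h7 hb]

/-- The case `d = 3` with both links of size two, where `x = a`. `hm` and `h4` give `b E ≤ 9 a²`,
hence `b ≤ 5 a / 4`; then `h34` gives `2 b² ≤ 17 a (b - a) / 2`, impossible for such `b`. -/
theorem real_ineq_two_two {a y b c g : ℝ} (ha : 0 < a) (hay : a ≤ y) (hyb : y ≤ b)
    (hbc : b ≤ c) (hg : 0 ≤ g) (hs : 2 * a + y + 2 * b + g + 3 * c = 1)
    (h4 : (c - b) * (1 - b - c) = a ^ 2 + 2 * a * y)
    (h34 : (b - y) * (1 - 2 * a - b - y) = 2 * a * b) (hm : 4 * (y * b) < 3 * (a * c)) : False := by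
  have hy : 0 < y := by linarith
  have hb : 0 < b := by linarith
  obtain ⟨E, hE⟩ : ∃ E, E = 1 - b - c := ⟨_, rfl⟩
  obtain ⟨Z, hZ⟩ : ∃ Z, Z = 1 - 2 * a - b - y := ⟨_, rfl⟩
  rw [← hE] at h4
  rw [← hZ] at h34
  have hE0 : 0 < E := by linarith
  have h1 : y * b ≤ 3 * (a * (c - b)) := by
    have : a * b ≤ y * b := mul_le_mul_of_nonneg_right hay hb.le
    linarith
  have h2 : b * E ≤ 9 * a ^ 2 := by
    have e1 := mul_le_mul_of_nonneg_right h1 hE0.le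
    have e2 : 3 * (a * (c - b)) * E = 3 * a * (a ^ 2 + 2 * a * y) := by rw [← h4]; ring
    have e3 : 3 * a * (a ^ 2 + 2 * a * y) ≤ y * (9 * a ^ 2) := by
      have := mul_le_mul_of_nonneg_left hay (show 0 ≤ 3 * a ^ 2 by positivity)
      linarith
    refine le_of_mul_le_mul_left ?_ hy
    linarith
  have hc43 : 4 * b < 3 * c := by
    have : a * b ≤ y * b := mul_le_mul_of_nonneg_right hay hb.le
    refine lt_of_mul_lt_mul_left ?_ ha.le
    linarith
  have hEb : 3 * a + 11 / 3 * b ≤ E := by linarith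
  have hb54 : b ≤ 5 / 4 * a := by
    by_contra hcon
    push Not at hcon
    have e1 : b * (3 * a + 11 / 3 * b) ≤ b * E := mul_le_mul_of_nonneg_left hEb hb.le
    have e2 : 5 / 4 * a * (3 * a + 11 / 3 * (5 / 4 * a)) ≤ b * (3 * a + 11 / 3 * b) :=
      mul_le_mul hcon.le (by linarith) (by positivity) hb.le
    nlinarith [mul_pos ha ha]
  have hZE : Z ≤ 3 / 2 * E - 9 / 2 * a - b / 2 := by linarith
  have hZb : b * Z ≤ 17 / 2 * a ^ 2 := by
    have e1 : b * Z ≤ b * (3 / 2 * E - 9 / 2 * a - b / 2) := mul_le_mul_of_nonneg_left hZE hb.le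
    have e2 : a * a ≤ a * b := mul_le_mul_of_nonneg_left (by linarith) ha.le
    have e3 : a * b ≤ b * b := mul_le_mul_of_nonneg_right (by linarith) hb.le
    linarith
  have h5 : b * (2 * a * b) ≤ (b - a) * (17 / 2 * a ^ 2) := by
    have e1 : b * (2 * a * b) = (b - y) * (b * Z) := by rw [← h34]; ring
    rw [e1]
    have hZ0 : 0 < Z := by linarith
    exact mul_le_mul (by linarith) hZb (by positivity) (by linarith)
  have h6 : 2 * b ^ 2 ≤ 17 / 2 * (a * (b - a)) := by
    refine le_of_mul_le_mul_left ?_ ha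
    linarith
  have h7 : a * (b - a) ≤ a * (a / 4) := mul_le_mul_of_nonneg_left (by linarith) ha.le
  nlinarith [mul_pos ha ha, mul_le_mul (show a ≤ b by linarith) (show a ≤ b by linarith) ha.le hb.le]

/-! ### Down-closed families of pairs and the links of the vertices `1` and `2` -/

theorem edgeSum_congr {F : Finset (Finset ℕ)} {x y : ℕ → ℝ} (h : ∀ e ∈ F, ∀ i ∈ e, x i = y i) :
    edgeSum F x = edgeSum F y :=
  sum_congr rfl fun e he => prod_congr rfl fun i hi => h e he i hi

theorem edgeDeriv_le_edgeDeriv {F F' : Finset (Finset ℕ)} {i : ℕ} {x : ℕ → ℝ}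
    (h : ∀ e ∈ F, i ∈ e → e ∈ F') (hx : ∀ e ∈ F', ∀ k ∈ e, 0 ≤ x k) :
    edgeDeriv F i x ≤ edgeDeriv F' i x := by
  refine sum_le_sum_of_subset_of_nonneg (fun e he => ?_) fun e he _ => ?_
  · rw [mem_filter] at he ⊢
    exact ⟨h e he.1 he.2, he.2⟩
  · rw [mem_filter] at he
    exact prod_nonneg fun k hk => hx e he.1 k (mem_of_mem_erase hk)

/-- A family of pairs in `[3, p)` closed under decreasing the entries of a pair. -/
structure IsDownPairs (p : ℕ) (W : Finset (Finset ℕ)) : Prop where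
  exists_eq : ∀ f ∈ W, ∃ b c, 3 ≤ b ∧ b < c ∧ c < p ∧ f = {b, c}
  down : ∀ b c b' c', 3 ≤ b' → b' < c' → b' ≤ b → c' ≤ c → b < c → ({b, c} : Finset ℕ) ∈ W →
    ({b', c'} : Finset ℕ) ∈ W

namespace IsDownPairs

variable {p : ℕ} {W : Finset (Finset ℕ)} {z : ℕ → ℝ}

theorem mem_Ico_of_mem (hW : IsDownPairs p W) {f : Finset ℕ} (hf : f ∈ W) {i : ℕ} (hi : i ∈ f) :
    3 ≤ i ∧ i < p := by
  obtain ⟨b, c, h1, h2, h3, rfl⟩ := hW.exists_eq f hf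
  simp only [mem_insert, mem_singleton] at hi
  omega

theorem mem_three_four (hW : IsDownPairs p W) (h : 1 ≤ #W) :
    ({3, 4} : Finset ℕ) ∈ W := by
  obtain ⟨f, hf⟩ := card_pos.1 h
  obtain ⟨b, c, h1, h2, h3, rfl⟩ := hW.exists_eq f hf
  exact hW.down b c 3 4 le_rfl (by omega) h1 (by omega) h2 hf

theorem mem_three_five (hW : IsDownPairs p W) (h : 2 ≤ #W) :
    ({3, 5} : Finset ℕ) ∈ W := by
  obtain ⟨f, hf, hne⟩ := exists_mem_ne (show 1 < #W by omega) {3, 4}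
  obtain ⟨b, c, h1, h2, h3, rfl⟩ := hW.exists_eq f hf
  refine hW.down b c 3 5 le_rfl (by omega) h1 ?_ h2 hf
  by_contra hc
  exact hne (by rw [show b = 3 by omega, show c = 4 by omega])

theorem five_le (hW : IsDownPairs p W) (h : 1 ≤ #W) : 5 ≤ p :=
  (hW.mem_Ico_of_mem (hW.mem_three_four h) (i := 4) (by simp)).2

theorem six_le (hW : IsDownPairs p W) (h : 2 ≤ #W) : 6 ≤ p :=
  (hW.mem_Ico_of_mem (hW.mem_three_five h) (i := 5) (by simp)).2

theorem three_le_card (hW : IsDownPairs p W) (h : ({4, 5} : Finset ℕ) ∈ W) : 3 ≤ #W := by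
  have h1 : ({{3, 4}, {3, 5}, {4, 5}} : Finset (Finset ℕ)) ⊆ W := by
    intro f hf
    simp only [mem_insert, mem_singleton] at hf
    rcases hf with rfl | rfl | rfl
    · exact hW.down 4 5 3 4 le_rfl (by omega) (by omega) (by omega) (by omega) h
    · exact hW.down 4 5 3 5 le_rfl (by omega) (by omega) (by omega) (by omega) h
    · exact h
  exact (show 3 = #({{3, 4}, {3, 5}, {4, 5}} : Finset (Finset ℕ)) by decide).le.trans
    (card_le_card h1)

theorem four_le_card (hW : IsDownPairs p W) (h : ({4, 6} : Finset ℕ) ∈ W) : 4 ≤ #W := by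
  have h1 : ({{3, 4}, {3, 5}, {4, 5}, {4, 6}} : Finset (Finset ℕ)) ⊆ W := by
    intro f hf
    simp only [mem_insert, mem_singleton] at hf
    rcases hf with rfl | rfl | rfl | rfl
    · exact hW.down 4 6 3 4 le_rfl (by omega) (by omega) (by omega) (by omega) h
    · exact hW.down 4 6 3 5 le_rfl (by omega) (by omega) (by omega) (by omega) h
    · exact hW.down 4 6 4 5 (by omega) (by omega) (by omega) (by omega) (by omega) h
    · exact h
  exact (show 4 = #({{3, 4}, {3, 5}, {4, 5}, {4, 6}} : Finset (Finset ℕ)) by decide).le.trans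
    (card_le_card h1)

theorem eq_of_card_eq_two (hW : IsDownPairs p W) (h : #W = 2) : W = {{3, 4}, {3, 5}} := by
  symm
  apply eq_of_subset_of_card_le
  · intro f hf
    simp only [mem_insert, mem_singleton] at hf
    rcases hf with rfl | rfl
    · exact hW.mem_three_four (by omega)
    · exact hW.mem_three_five (by omega)
  · rw [h]; decide

theorem card_mul_le (hW : IsDownPairs p W) (hz : ∀ i j, 3 ≤ i → i ≤ j → j < p → z i ≤ z j)
    (h3 : 3 < p → 0 ≤ z 3) : #W * (z 3 * z 4) ≤ edgeSum W z := by
  rw [← nsmul_eq_mul, edgeSum]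
  refine card_nsmul_le_sum _ _ _ fun f hf => ?_
  obtain ⟨b, c, hb, hbc, hc, rfl⟩ := hW.exists_eq f hf
  rw [prod_pair hbc.ne]
  have h0 := h3 (by omega)
  have h1 := hz 3 b le_rfl hb (by omega)
  have h2 := hz 4 c (by omega) (by omega) hc
  have h4 := hz 3 4 le_rfl (by omega) (by omega)
  exact mul_le_mul h1 h2 (by linarith) (by linarith)

theorem exists_eq_of_four_mem (hW : IsDownPairs p W) {f : Finset ℕ} (hf : f ∈ W) (h4 : 4 ∈ f) :
    f = {3, 4} ∨ ∃ c, 5 ≤ c ∧ f = {4, c} := by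
  obtain ⟨b, c, h1, h2, h3, rfl⟩ := hW.exists_eq f hf
  simp only [mem_insert, mem_singleton] at h4
  rcases h4 with rfl | rfl
  · exact Or.inr ⟨c, by omega, rfl⟩
  · exact Or.inl (by rw [show b = 3 by omega])

theorem edgeDeriv_pair (x : ℕ → ℝ) {i b c : ℕ} (hbc : b ≠ c) :
    edgeDeriv {{b, c}} i x = if i = b then x c else if i = c then x b else 0 := by
  rw [edgeDeriv, filter_singleton]
  by_cases h1 : i = b
  · subst h1
    simp [hbc]
  · by_cases h2 : i = c
    · subst h2
      simp [h1, Finset.pair_comm b i]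
    · simp [h1, h2]

theorem edgeDeriv_four_le_of_notMem (hW : IsDownPairs p W) (h45 : ({4, 5} : Finset ℕ) ∉ W)
    (h3 : 0 ≤ z 3) (h4 : 0 ≤ z 4) : edgeDeriv W 4 z ≤ z 3 := by
  have h : edgeDeriv W 4 z ≤ edgeDeriv {{3, 4}} 4 z := by
    refine edgeDeriv_le_edgeDeriv (fun f hf hf4 => ?_) fun e he k hk => ?_
    · rcases hW.exists_eq_of_four_mem hf hf4 with rfl | ⟨c, hc, rfl⟩
      · simp
      · exact absurd (hW.down 4 c 4 5 (by omega) (by omega) le_rfl hc (by omega) hf) h45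
    · rw [mem_singleton] at he
      subst he
      simp only [mem_insert, mem_singleton] at hk
      rcases hk with rfl | rfl <;> assumption
  rw [edgeDeriv_pair z (by omega)] at h
  simpa using h

/-- A pair `{4, c}` with `c ≥ 6` would drag in `{3, 4}`, `{3, 5}`, `{4, 5}` and `{4, 6}`, so `4` has
no neighbours besides `3` and `5`. -/
theorem edgeDeriv_four_le_of_card (hW : IsDownPairs p W) (hc : #W ≤ 3)
    (h3 : 0 ≤ z 3) (h4 : 0 ≤ z 4) (h5 : 0 ≤ z 5) : edgeDeriv W 4 z ≤ z 3 + z 5 := by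
  have h : edgeDeriv W 4 z ≤ edgeDeriv {{3, 4}, {4, 5}} 4 z := by
    refine edgeDeriv_le_edgeDeriv (fun f hf hf4 => ?_) fun e he k hk => ?_
    · rcases hW.exists_eq_of_four_mem hf hf4 with rfl | ⟨c, hc, rfl⟩
      · simp
      · have : c < 6 := by
          by_contra hc6
          have := hW.four_le_card
            (hW.down 4 c 4 6 (by omega) (by omega) le_rfl (by omega) (by omega) hf)
          omega
        rw [show c = 5 by omega]
        simp
    · simp only [mem_insert, mem_singleton] at he
      rcases he with rfl | rfl <;> simp only [mem_insert, mem_singleton] at hk <;>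
        rcases hk with rfl | rfl <;> assumption
  have e : edgeDeriv {{3, 4}, {4, 5}} 4 z = edgeDeriv {{3, 4}} 4 z + edgeDeriv {{4, 5}} 4 z := by
    simp only [edgeDeriv, sum_filter]
    rw [sum_pair (by decide), sum_singleton, sum_singleton]
  rw [e, edgeDeriv_pair z (by omega), edgeDeriv_pair z (by omega)] at h
  simpa using h

theorem edgeDeriv_four_le (hW : IsDownPairs p W) (hp : 5 ≤ p) (hz : ∀ i, 3 ≤ i → i < p → 0 ≤ z i) :
    edgeDeriv W 4 z ≤ ∑ i ∈ Ico 3 p, z i - z 4 := by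
  have h4 : 4 ∈ Ico 3 p := mem_Ico.2 (by omega)
  have h : edgeDeriv W 4 z ≤ edgeDeriv (powersetCard 2 (Ico 3 p)) 4 z := by
    refine edgeDeriv_le_edgeDeriv (fun f hf _ => mem_powersetCard.2 ⟨fun i hi => ?_, ?_⟩)
      fun e he k hk => ?_
    · exact mem_Ico.2 (hW.mem_Ico_of_mem hf hi)
    · obtain ⟨b, c, h1, h2, h3, rfl⟩ := hW.exists_eq f hf
      exact card_pair h2.ne
    · have := mem_Ico.1 ((mem_powersetCard.1 he).1 hk)
      exact hz k this.1 this.2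
  refine h.trans (le_of_eq ?_)
  have e : ∀ v, 2 * edgeSum (powersetCard 2 (Ico 3 p)) (Function.update z 4 v)
      = (v + (∑ i ∈ Ico 3 p, z i - z 4)) ^ 2 - (v ^ 2 + (∑ i ∈ Ico 3 p, z i ^ 2 - z 4 ^ 2)) := by
    intro v
    rw [edgeSum_powersetCard_two, sum_update h4 z v (fun u => u), sum_update h4 z v (fun u => u ^ 2)]
  rw [edgeDeriv_eq_update]
  linear_combination (e 1 - e 0) / 2

end IsDownPairs

/-- The pairs `f` such that `insert v f` belongs to `D`. -/
def pairLink (p : ℕ) (D : Finset (Finset ℕ)) (v : ℕ) : Finset (Finset ℕ) :=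
  {f ∈ powersetCard 2 (Ico 3 p) | insert v f ∈ D}

namespace ExtremalComplement

variable {t : ℕ} {M : Finset (Finset ℕ)} {z : ℕ → ℝ}

theorem isDownPairs_pairLink (h : ExtremalComplement t M z) {p v : ℕ} (hv : 1 ≤ v) (hv3 : v < 3) :
    IsDownPairs p (pairLink p (M \ starTriples p) v) := by
  have hex : ∀ f ∈ powersetCard 2 (Ico 3 p), ∃ b c, 3 ≤ b ∧ b < c ∧ c < p ∧ f = {b, c} := by
    intro f hf
    obtain ⟨hs, hc⟩ := mem_powersetCard.1 hf
    obtain ⟨b, c, hbc, rfl⟩ := card_eq_two.1 hc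
    have hb := mem_Ico.1 (hs (mem_insert_self b _))
    have hc := mem_Ico.1 (hs (mem_insert_of_mem (mem_singleton_self c)))
    rcases hbc.lt_or_gt with hlt | hlt
    · exact ⟨b, c, hb.1, hlt, hc.2, rfl⟩
    · exact ⟨c, b, hc.1, hlt, hb.2, pair_comm _ _⟩
  refine ⟨fun f hf => hex f (mem_filter.1 hf).1, fun b c b' c' h1 h2 h3 h4 h5 hm => ?_⟩
  obtain ⟨hm1, hm2⟩ := mem_filter.1 hm
  have hc := mem_Ico.1 ((mem_powersetCard.1 hm1).1 (mem_insert_of_mem (mem_singleton_self c)))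
  refine mem_filter.2 ⟨mem_powersetCard.2 ⟨fun i hi => ?_, card_pair h2.ne⟩,
    h.mem_sdiff_of_le hv (by omega) h1 h2 le_rfl h3 h4 (by omega) h5 hm2⟩
  simp only [mem_insert, mem_singleton] at hi
  rw [mem_Ico]
  omega

theorem pairLink_two_subset (h : ExtremalComplement t M z) {p : ℕ} :
    pairLink p (M \ starTriples p) 2 ⊆ pairLink p (M \ starTriples p) 1 := by
  intro f hf
  obtain ⟨b, c, h1, h2, h3, rfl⟩ :=
    (h.isDownPairs_pairLink (by omega) (by omega)).exists_eq f hf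
  rw [pairLink, mem_filter] at hf ⊢
  exact ⟨hf.1, h.mem_sdiff_of_le le_rfl (by omega) h1 h2 (by omega) le_rfl le_rfl (by omega) h2 hf.2⟩

theorem injOn_insert_pairLink {p : ℕ} {D : Finset (Finset ℕ)} {v : ℕ} (hv : v < 3) :
    Set.InjOn (fun f : Finset ℕ => insert v f) (pairLink p D v : Finset (Finset ℕ)) := by
  have hnot : ∀ f ∈ pairLink p D v, v ∉ f := by
    intro f hf hvf
    have := mem_Ico.1 ((mem_powersetCard.1 (mem_filter.1 hf).1).1 hvf)
    omega
  intro f hf g hg hfg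
  have := congrArg (fun u => Finset.erase u v) hfg
  simpa [erase_insert, hnot f hf, hnot g hg] using this

theorem edgeSum_image_insert_pairLink {p : ℕ} {D : Finset (Finset ℕ)} {v : ℕ} (hv : v < 3)
    (x : ℕ → ℝ) : edgeSum ((pairLink p D v).image fun f => insert v f) x
      = x v * edgeSum (pairLink p D v) x := by
  rw [edgeSum, sum_image (injOn_insert_pairLink hv), edgeSum, mul_sum]
  refine sum_congr rfl fun f hf => prod_insert fun hvf => ?_
  have := mem_Ico.1 ((mem_powersetCard.1 (mem_filter.1 hf).1).1 hvf)
  omega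

theorem sdiff_starTriples_eq_union (h : ExtremalComplement t M z) {p : ℕ}
    (hp : ∀ j, 3 ≤ j → (({1, 2, j} : Finset ℕ) ∈ M ↔ j < p))
    (h3 : #{e ∈ M | 1 ∉ e} ≤ 3) :
    M \ starTriples p = (pairLink p (M \ starTriples p) 1).image (fun f => insert 1 f) ∪
      (pairLink p (M \ starTriples p) 2).image fun f => insert 2 f := by
  ext e
  rw [mem_union, mem_image, mem_image]
  constructor
  · intro he
    obtain ⟨a, b, c, ha, hab, hb, hbc, hc, rfl⟩ := h.exists_of_mem_sdiff hp he
    have hmem : ({b, c} : Finset ℕ) ∈ powersetCard 2 (Ico 3 p) := by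
      refine mem_powersetCard.2 ⟨fun i hi => ?_, card_pair hbc.ne⟩
      simp only [mem_insert, mem_singleton] at hi
      rw [mem_Ico]
      omega
    -- A triple inside `[3, p)` lies above four triples that avoid `1`, against `h3`; so the
    -- remainder is carried by the links of `1` and `2`.
    have ha3 : a < 3 := by
      by_contra hcon
      have hM := (mem_sdiff.1 he).1
      have hsub : ({{2, 3, 4}, {2, 3, 5}, {2, 4, 5}, {3, 4, 5}} : Finset (Finset ℕ))
          ⊆ {e ∈ M | 1 ∉ e} := by
        intro f hf
        simp only [mem_insert, mem_singleton] at hf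
        rw [mem_filter]
        rcases hf with rfl | rfl | rfl | rfl
        all_goals
          refine ⟨h.down a b c _ _ _ ?_ ?_ ?_ ?_ ?_ ?_ hab hbc hM, by decide⟩ <;> omega
      have := (show 4 = #({{2, 3, 4}, {2, 3, 5}, {2, 4, 5}, {3, 4, 5}} : Finset (Finset ℕ)) by
        decide).le.trans (card_le_card hsub)
      omega
    rcases (show a = 1 ∨ a = 2 by omega) with rfl | rfl
    · exact Or.inl ⟨{b, c}, mem_filter.2 ⟨hmem, he⟩, rfl⟩
    · exact Or.inr ⟨{b, c}, mem_filter.2 ⟨hmem, he⟩, rfl⟩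
  · rintro (⟨f, hf, rfl⟩ | ⟨f, hf, rfl⟩) <;> exact (mem_filter.1 hf).2

theorem disjoint_image_insert_pairLink {p : ℕ} {D : Finset (Finset ℕ)} :
    Disjoint ((pairLink p D 1).image fun f => insert 1 f)
      ((pairLink p D 2).image fun f => insert 2 f) := by
  rw [disjoint_left]
  intro e he he'
  obtain ⟨f, hf, rfl⟩ := mem_image.1 he
  obtain ⟨g, hg, hgf⟩ := mem_image.1 he'
  have h1 : 1 ∈ insert 2 g := by rw [hgf]; exact mem_insert_self _ _
  have h2 : 1 ∈ g := (mem_insert.1 h1).resolve_left (by omega)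
  have := mem_Ico.1 ((mem_powersetCard.1 (mem_filter.1 hg).1).1 h2)
  omega

theorem card_sdiff_starTriples (h : ExtremalComplement t M z) {p : ℕ}
    (hp : ∀ j, 3 ≤ j → (({1, 2, j} : Finset ℕ) ∈ M ↔ j < p))
    (h3 : #{e ∈ M | 1 ∉ e} ≤ 3) :
    #(M \ starTriples p) = #(pairLink p (M \ starTriples p) 1)
      + #(pairLink p (M \ starTriples p) 2) := by
  conv_lhs => rw [h.sdiff_starTriples_eq_union hp h3]
  rw [card_union_of_disjoint disjoint_image_insert_pairLink,
    card_image_of_injOn (injOn_insert_pairLink (by omega)),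
    card_image_of_injOn (injOn_insert_pairLink (by omega))]

theorem edgeSum_sdiff_starTriples (h : ExtremalComplement t M z) {p : ℕ}
    (hp : ∀ j, 3 ≤ j → (({1, 2, j} : Finset ℕ) ∈ M ↔ j < p))
    (h3 : #{e ∈ M | 1 ∉ e} ≤ 3) (x : ℕ → ℝ) :
    edgeSum (M \ starTriples p) x = x 1 * edgeSum (pairLink p (M \ starTriples p) 1) x
      + x 2 * edgeSum (pairLink p (M \ starTriples p) 2) x := by
  conv_lhs => rw [h.sdiff_starTriples_eq_union hp h3]
  rw [edgeSum, sum_union disjoint_image_insert_pairLink]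
  exact congrArg₂ (· + ·) (edgeSum_image_insert_pairLink (by omega) x)
    (edgeSum_image_insert_pairLink (by omega) x)

theorem card_pairLink_two_le {p : ℕ} (h3 : #{e ∈ M | 1 ∉ e} ≤ 3) :
    #(pairLink p (M \ starTriples p) 2) ≤ 3 := by
  refine le_trans ?_ h3
  rw [← card_image_of_injOn (injOn_insert_pairLink (by omega))]
  refine card_le_card fun e he => ?_
  obtain ⟨f, hf, rfl⟩ := mem_image.1 he
  obtain ⟨hf1, hf2⟩ := mem_filter.1 hf
  refine mem_filter.2 ⟨(mem_sdiff.1 hf2).1, fun h1 => ?_⟩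
  have := mem_Ico.1 ((mem_powersetCard.1 hf1).1 ((mem_insert.1 h1).resolve_left (by omega)))
  omega

end ExtremalComplement

/-! ### Many triples outside the star: merging the two lightest vertices -/

namespace ExtremalComplement

variable {t : ℕ} {M : Finset (Finset ℕ)} {z : ℕ → ℝ}

/-- If many triples lie outside the star of `{1, 2}`, then merging the two lightest vertices is
profitable. -/
theorem mul_le_edgeSum (h : ExtremalComplement t M z) {p d : ℕ}
    (hp : ∀ j, 3 ≤ j → (({1, 2, j} : Finset ℕ) ∈ M ↔ j < p)) (hd : p + d = t + 1) (hd1 : 1 ≤ d)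
    (hd3 : d ≤ 3) (hD : d + 1 ≤ #(M \ starTriples p)) (h3 : #{e ∈ M | 1 ∉ e} ≤ 3) :
    z 1 * z 2 * (1 - z 1 - z 2) ≤ edgeSum M z := by
  have hM : ∀ x, edgeSum M x = x 1 * x 2 * ∑ j ∈ Ico 3 p, x j
      + (x 1 * edgeSum (pairLink p (M \ starTriples p) 1) x
        + x 2 * edgeSum (pairLink p (M \ starTriples p) 2) x) := fun x => by
    rw [edgeSum_of_cut hp, h.edgeSum_sdiff_starTriples hp h3]
  have hcard := h.card_sdiff_starTriples hp h3
  have hW1 := h.isDownPairs_pairLink (p := p) (v := 1) (by omega) (by omega)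
  have hW2 := h.isDownPairs_pairLink (p := p) (v := 2) (by omega) (by omega)
  have hsub := h.pairLink_two_subset (p := p)
  have hk2 := card_pairLink_two_le (p := p) h3
  generalize pairLink p (M \ starTriples p) 1 = W₁ at *
  generalize pairLink p (M \ starTriples p) 2 = W₂ at *
  have hk := card_le_card hsub
  rw [hcard] at hD
  have hp5 : 5 ≤ p := hW1.five_le (by omega)
  have hmem : ∀ i, 1 ≤ i → i ≤ t → i ∈ Icc 1 t := fun i h1 h2 => mem_Icc.2 ⟨h1, h2⟩
  have hupd : ∀ (W : Finset (Finset ℕ)) (i : ℕ) (v : ℝ), IsDownPairs p W → i < 3 ∨ p ≤ i →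
      edgeSum W (Function.update z i v) = edgeSum W z := by
    intro W i v hW hi
    refine edgeSum_congr fun f hf k hk => Function.update_of_ne ?_ _ _
    have := hW.mem_Ico_of_mem hf hk
    omega
  have d1 := edgeDeriv_one_of_star hM z
  have d2 := edgeDeriv_two_of_star hM z
  simp only [hupd W₁ 1 _ hW1 (by omega), hupd W₂ 1 _ hW2 (by omega), Function.update_self,
    Function.update_of_ne (show (2 : ℕ) ≠ 1 by omega)] at d1
  simp only [hupd W₁ 2 _ hW1 (by omega), hupd W₂ 2 _ hW2 (by omega), Function.update_self,
    Function.update_of_ne (show (1 : ℕ) ≠ 2 by omega)] at d2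
  have d3 : ∀ i, 3 ≤ i → i < p →
      edgeDeriv M i z = z 1 * z 2 + (z 1 * edgeDeriv W₁ i z + z 2 * edgeDeriv W₂ i z) := by
    intro i hi hip
    have e := edgeDeriv_of_star hM z hi hip
    rw [Function.update_of_ne (by omega), Function.update_of_ne (by omega),
      Function.update_of_ne (by omega), Function.update_of_ne (by omega)] at e
    rw [e, edgeDeriv_eq_update, edgeDeriv_eq_update]
    ring
  have dp : ∀ i, p ≤ i → edgeDeriv M i z = 0 := by
    intro i hip
    have e := edgeDeriv_of_star_of_le hM z (by omega) hip
    rw [hupd W₁ i _ hW1 (by omega), hupd W₁ i _ hW1 (by omega), hupd W₂ i _ hW2 (by omega),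
      hupd W₂ i _ hW2 (by omega), Function.update_of_ne (by omega),
      Function.update_of_ne (by omega), Function.update_of_ne (by omega),
      Function.update_of_ne (by omega)] at e
    rw [e, sub_self]
  -- The `d` vertices from `p` to `t` lie in no triple of `M`, so they share the weight `z p`.
  have hsum : z 1 + z 2 + ∑ j ∈ Ico 3 p, z j + d * z p = 1 := by
    have e1 : ∑ j ∈ Ico p (t + 1), z j = d * z p := by
      rw [sum_congr rfl fun j hj => h.eq_of_edgeDeriv_eq (j := p)
        (hmem j (by rw [mem_Ico] at hj; omega) (by rw [mem_Ico] at hj; omega))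
        (hmem p (by omega) (by omega))
        (by rw [dp j (mem_Ico.1 hj).1, dp p le_rfl])]
      rw [sum_const, Nat.card_Ico, nsmul_eq_mul, ← hd, Nat.add_sub_cancel_left]
    have e2 := h.sum_eq
    rw [show Icc 1 t = Ico 1 (t + 1) from rfl, sum_eq_sum_Ico_succ_bot (by omega),
      sum_eq_sum_Ico_succ_bot (by omega), ← sum_Ico_consecutive _ (show 3 ≤ p by omega)
      (by omega), e1] at e2
    linarith
  have l12 := h.lagrange (hmem 1 (by omega) (by omega)) (hmem 2 (by omega) (by omega))
  have l4p := h.lagrange (hmem 4 (by omega) (by omega)) (hmem p (by omega) (by omega))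
  rw [dp p le_rfl, d3 4 (by omega) (by omega)] at l4p
  rw [d1, d2] at l12
  have ha := h.pos 1 (hmem 1 (by omega) (by omega))
  have hax := h.mono 1 2 (by omega) (by omega) (by omega)
  have hxy := h.mono 2 3 (by omega) (by omega) (by omega)
  have hyb := h.mono 3 4 (by omega) (by omega) (by omega)
  have hbu := h.mono 4 5 (by omega) (by omega) (by omega)
  have huc := h.mono 5 p (by omega) (by omega) (by omega)
  have hmono : ∀ i j, 3 ≤ i → i ≤ j → j < p → z i ≤ z j := fun i j g1 g2 g3 =>
    h.mono i j (by omega) g2 (by omega)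
  have hy : 0 < z 3 := by linarith
  have hb : 0 < z 4 := by linarith
  have hc : 0 < z p := by linarith
  have hw1 := hW1.card_mul_le hmono fun _ => hy.le
  have hw2 := hW2.card_mul_le hmono fun _ => hy.le
  have hN1 := hW1.edgeDeriv_four_le hp5 fun i g1 g2 => (h.pos i (hmem i (by omega) (by omega))).le
  have hS5 : z 3 + z 4 ≤ ∑ j ∈ Ico 3 p, z j := by
    rw [sum_eq_sum_Ico_succ_bot (by omega), sum_eq_sum_Ico_succ_bot (by omega)]
    have : 0 ≤ ∑ j ∈ Ico (3 + 1 + 1) p, z j := sum_nonneg fun j hj => by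
      rw [mem_Ico] at hj
      exact (h.pos j (hmem j (by omega) (by omega))).le
    linarith
  have hS6 : 6 ≤ p → ∃ g, 0 ≤ g ∧ ∑ j ∈ Ico 3 p, z j = z 3 + z 4 + z 5 + g := by
    intro h6
    refine ⟨∑ j ∈ Ico (3 + 1 + 1 + 1) p, z j, sum_nonneg fun j hj => ?_, ?_⟩
    · rw [mem_Ico] at hj
      exact (h.pos j (hmem j (by omega) (by omega))).le
    · rw [sum_eq_sum_Ico_succ_bot (by omega), sum_eq_sum_Ico_succ_bot (by omega),
        sum_eq_sum_Ico_succ_bot (by omega)]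
      ring
  rw [hM]
  obtain ⟨S, hS⟩ : ∃ S, S = ∑ j ∈ Ico 3 p, z j := ⟨_, rfl⟩
  rw [← hS] at hsum l12 hN1 hS5 hS6 ⊢
  obtain ⟨E, hE⟩ : ∃ E, E = 1 - z 4 - z p := ⟨_, rfl⟩
  have h4p : (z p - z 4) * E
      = z 1 * z 2 + (z 1 * edgeDeriv W₁ 4 z + z 2 * edgeDeriv W₂ 4 z) := by
    rw [hE]; linear_combination -l4p
  by_contra hcon
  push Not at hcon
  have hdR : (1 : ℝ) ≤ d := by exact_mod_cast hd1
  have h12 : edgeSum W₁ z - edgeSum W₂ z = (z 2 - z 1) * (d * z p) := by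
    linear_combination l12 - (z 2 - z 1) * hsum
  have hcon' : z 1 * edgeSum W₁ z + z 2 * edgeSum W₂ z < z 1 * z 2 * (d * z p) := by
    have : z 1 * z 2 * (1 - z 1 - z 2) = z 1 * z 2 * S + z 1 * z 2 * (d * z p) := by
      linear_combination (-z 1 * z 2) * hsum
    linarith
  -- The Lagrange equation `h12` for `1` and `2` separates the two links in `hcon'`. As every pair
  -- weighs at least `z 3 * z 4`, `hi` and `hii` bound the link sizes in terms of `z p / z 4`.
  have hi : (z 1 + z 2) * edgeSum W₂ z < z 1 ^ 2 * (d * z p) := by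
    linear_combination hcon' - z 1 * h12
  have hii : (z 1 + z 2) * edgeSum W₁ z < z 2 ^ 2 * (d * z p) := by
    linear_combination hcon' + z 2 * h12
  have hi' : (z 1 + z 2) * (#W₂ * (z 3 * z 4)) < z 1 ^ 2 * (d * z p) :=
    (mul_le_mul_of_nonneg_left hw2 (by linarith)).trans_lt hi
  have hii' : (z 1 + z 2) * (#W₁ * (z 3 * z 4)) < z 2 ^ 2 * (d * z p) :=
    (mul_le_mul_of_nonneg_left hw1 (by linarith)).trans_lt hii
  have hcut : ∀ (k : ℕ) (k' : ℝ), k' ≤ k → (z 1 + z 2) * (k' * (z 3 * z 4))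
      ≤ (z 1 + z 2) * (k * (z 3 * z 4)) := fun k k' hkk =>
    mul_le_mul_of_nonneg_left (mul_le_mul_of_nonneg_right hkk (by positivity)) (by linarith)
  have hpd : (z p - z 4) * E ≤ z 1 * (E - z 1 - (d - 1) * z p) + z 2 * edgeDeriv W₂ 4 z := by
    have := mul_le_mul_of_nonneg_left hN1 ha.le
    have e : E - z 1 - (d - 1) * z p = z 2 + (S - z 4) := by rw [hE]; linear_combination -hsum
    rw [h4p, e]
    linarith
  have hEsum : E = z 1 + z 2 + (S - z 4) + (d - 1) * z p := by rw [hE]; linear_combination -hsum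
  have hdc : 0 ≤ ((d : ℝ) - 1) * z p := mul_nonneg (by linarith) hc.le
  have hE5 : z 1 + z 2 + z 3 ≤ E := by linarith
  have hE6 : 6 ≤ p → z 1 + z 2 + z 3 + z 5 + (d - 1) * z p ≤ E := by
    intro h6
    obtain ⟨g, hg, hSg⟩ := hS6 h6
    linarith
  have hE0 : 0 < E := by linarith
  have h45 : ∀ {W : Finset (Finset ℕ)}, IsDownPairs p W → #W ≤ 2 → edgeDeriv W 4 z ≤ z 3 := by
    intro W hW hWc
    refine hW.edgeDeriv_four_le_of_notMem (fun hm => ?_) hy.le hb.le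
    have := hW.three_le_card hm
    omega
  have h45' : ∀ {W : Finset (Finset ℕ)}, IsDownPairs p W → #W ≤ 3 →
      edgeDeriv W 4 z ≤ z 3 + z 5 := fun hW hWc =>
    hW.edgeDeriv_four_le_of_card hWc hy.le hb.le (by linarith)
  -- If the link of `2` is empty, the Lagrange equation gives `z p ≤ z 4 + z 1`, while all of `D`,
  -- more than `d` triples, sits in the link of `1`.
  rcases Nat.eq_zero_or_pos #W₂ with h0 | hpos
  · have hN2 : edgeDeriv W₂ 4 z = 0 := by
      rw [card_eq_zero.1 h0]
      simp [edgeDeriv]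
    rw [hN2] at hpd
    have hle : (z p - z 4) * E ≤ z 1 * E := by
      have := mul_nonneg ha.le (add_nonneg ha.le hdc)
      linarith
    have hle' := le_of_mul_le_mul_right hle hE0
    refine real_ineq_star (d := d) ha hax hxy hyb (by linarith) (by linarith)
      (lt_of_le_of_lt (hcut _ _ ?_) hii')
    exact_mod_cast (show d ≤ #W₁ by omega)
  rcases (show d = 1 ∨ 2 ≤ d by omega) with rfl | hd2
  · rw [Nat.cast_one] at hi' hpd hdc hE6
    have hpd' : (z p - z 4) * E ≤ z 1 * (E - z 1) + z 2 * edgeDeriv W₂ 4 z := by linarith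
    rcases (show #W₂ = 1 ∨ 2 ≤ #W₂ by omega) with h1 | h2
    · have h5 := real_ineq_cut_one (k := 1) ha hax hxy hyb (by norm_num)
        ((hcut _ _ (by rw [h1]; norm_num)).trans_lt hi')
      have h6 := le_two_mul_of_le ha hax hxy hyb hE5 (h45 hW2 (by omega)) hpd'
      linarith
    · have h5 := real_ineq_cut_one (k := 2) ha hax hxy hyb (by norm_num)
        ((hcut _ _ (by exact_mod_cast h2)).trans_lt hi')
      have h6 := le_three_mul_of_le ha hax hxy hyb hbu (by linarith [hE6 (hW2.six_le h2)])
        (h45' hW2 hk2) hpd'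
      linarith
  have hdR2 : (2 : ℝ) ≤ d := by exact_mod_cast hd2
  have hc2 : z p ≤ 2 * z 4 := by
    by_cases hm : ({4, 5} : Finset ℕ) ∈ W₂
    · have h6 := hW2.six_le (by have := hW2.three_le_card hm; omega)
      have hcd : z p ≤ (d - 1) * z p := le_mul_of_one_le_left hc.le (by linarith)
      refine le_two_mul_of_le' ha hax hxy hyb hbu huc (by linarith [hE6 h6]) (h45' hW2 hk2)
        (hpd.trans ?_)
      have := mul_le_mul_of_nonneg_left hcd ha.le
      linarith
    · refine le_two_mul_of_le ha hax hxy hyb hE5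
        (hW2.edgeDeriv_four_le_of_notMem hm hy.le hb.le) (hpd.trans ?_)
      have := mul_nonneg ha.le hdc
      linarith
  have hmb : ∀ k₁ k₂ : ℕ, k₁ ≤ #W₁ → k₂ ≤ #W₂ → ∀ ρ, z p ≤ ρ * z 4 →
      k₂ * (z 1 + z 2) * z 2 < d * ρ * z 1 ^ 2 ∧ k₁ * (z 1 + z 2) < d * ρ * z 2 := by
    intro k₁ k₂ g1 g2 ρ hρ
    exact merge_bounds ha hax hxy hyb (by linarith) (Nat.cast_nonneg _) (Nat.cast_nonneg _) hρ
      ((hcut _ _ (by exact_mod_cast g2)).trans_lt hi')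
      ((hcut _ _ (by exact_mod_cast g1)).trans_lt hii')
  have haa : z 1 * z 1 ≤ z 1 * z 2 := mul_le_mul_of_nonneg_left hax ha.le
  have hxx : z 1 * z 2 ≤ z 2 * z 2 := mul_le_mul_of_nonneg_right hax (by linarith)
  -- In the cases below the bound on `#W₁` forces `z 2 ≥ s * z 1` for some `s`, and this then
  -- contradicts the bound on `#W₂`.
  have hratio : ∀ s : ℝ, 0 ≤ s → s * z 1 ≤ z 2 →
      (1 + s) * s * z 1 ^ 2 ≤ (z 1 + z 2) * z 2 := by
    intro s hs hsz
    have e : (1 + s) * z 1 * (s * z 1) ≤ (z 1 + z 2) * z 2 :=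
      mul_le_mul (by linarith) hsz (by positivity) (by linarith)
    linarith
  have ha2 : 0 < z 1 ^ 2 := by positivity
  rcases (show d = 2 ∨ d = 3 by omega) with rfl | rfl
  · push_cast at hmb hpd hE6 hdc
    rcases (show 2 ≤ #W₂ ∨ #W₂ = 1 by omega) with h2 | h1
    · have := (hmb 0 2 (by omega) h2 2 hc2).1
      push_cast at this
      linarith
    rcases (show 3 ≤ #W₁ ∨ #W₁ = 2 by omega) with h3 | h2
    · have e := hmb 3 1 h3 (by omega) 2 hc2
      push_cast at e
      have := hratio 3 (by norm_num) (by linarith)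
      linarith
    · have h6 := hW1.six_le (by omega)
      have n1 := mul_le_mul_of_nonneg_left (h45 hW1 (by omega)) ha.le
      have n2 := mul_le_mul_of_nonneg_left (h45 hW2 (by omega)) (ha.le.trans hax)
      have hc3 := real_ineq_cut_two_aux (c := z p) ha hax hxy hyb hbu (by linarith [hE6 h6])
        (by rw [h4p]; linarith)
      have e := hmb 2 1 (by omega) (by omega) _ hc3
      push_cast at e
      have := hratio (5 / 3) (by norm_num) (by linarith)
      linarith
  · push_cast at hmb hpd hE6 hdc hii'
    rcases (show 3 ≤ #W₂ ∨ #W₂ ≤ 2 by omega) with h2 | h2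
    · have := (hmb 0 3 (by omega) h2 2 hc2).1
      push_cast at this
      linarith
    rcases (show 4 ≤ #W₁ ∨ #W₁ = 3 ∨ #W₁ = 2 by omega) with h4 | h4 | h4
    · have e := hmb 4 1 h4 (by omega) 2 hc2
      push_cast at e
      have := hratio 2 (by norm_num) (by linarith)
      linarith
    · have h6 := hW1.six_le (by omega)
      have n1 := mul_le_mul_of_nonneg_left (h45' hW1 (by omega)) ha.le
      have n2 := mul_le_mul_of_nonneg_left (h45 hW2 (by omega)) (ha.le.trans hax)
      rw [h4] at hii'
      push_cast at hii'
      have hc3 := real_ineq_cut_three_aux (c := z p) ha hax hxy hyb hbu (hbu.trans huc)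
        (by linarith [hE6 h6]) (by linarith) (by rw [h4p]; linarith)
      have e := hmb 3 1 (by omega) (by omega) _ hc3.1
      push_cast at e
      have := hratio (5 / 2) (by norm_num) (by linarith)
      linarith
    -- The tightest case: both links are `{{3, 4}, {3, 5}}`, so `z 1 = z 2` and `z 4 = z 5`, and the
    -- Lagrange equation of `3` and `4` is needed as well.
    · have hWW : W₂ = W₁ := eq_of_subset_of_card_le hsub (by omega)
      rw [hWW] at h12 hi d3
      have e34 := hW1.eq_of_card_eq_two h4
      obtain ⟨g, hg, hSg⟩ := hS6 (hW1.six_le (by omega))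
      have hx : z 2 = z 1 := by
        have : (z 2 - z 1) * (((3 : ℕ) : ℝ) * z p) = 0 := by rw [← h12]; ring
        rcases mul_eq_zero.1 this with h0 | h0
        · linarith
        · push_cast at h0
          linarith
      have hs : ∀ x : ℕ → ℝ, edgeSum W₁ x = x 3 * x 4 + x 3 * x 5 := by
        intro x
        rw [e34, edgeSum, sum_pair (by decide), prod_pair (by omega), prod_pair (by omega)]
      have g3 : edgeDeriv W₁ 3 z = z 4 + z 5 := by
        rw [edgeDeriv_eq_update, hs, hs]
        simp [Function.update]
      have g4 : edgeDeriv W₁ 4 z = z 3 := by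
        rw [edgeDeriv_eq_update, hs, hs]
        simp [Function.update]
      have g5 : edgeDeriv W₁ 5 z = z 3 := by
        rw [edgeDeriv_eq_update, hs, hs]
        simp [Function.update]
      have h6 := hW1.six_le (by omega)
      have e45 : z 5 = z 4 := h.eq_of_edgeDeriv_eq (hmem 5 (by omega) (by omega))
        (hmem 4 (by omega) (by omega))
        (by rw [d3 5 (by omega) (by omega), d3 4 (by omega) (by omega), g4, g5])
      have l34 := h.lagrange (hmem 3 (by omega) (by omega)) (hmem 4 (by omega) (by omega))
      rw [d3 3 (by omega) (by omega), d3 4 (by omega) (by omega), g3, g4, e45, hx] at l34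
      rw [hWW, g4, hx, hE] at h4p
      rw [hs, e45, hx] at hi
      push_cast at hi hsum
      rw [hSg, e45, hx] at hsum
      refine real_ineq_two_two ha (hx ▸ hxy) hyb (hbu.trans huc) hg (by linarith)
        (by linarith) (by linear_combination -l34) ?_
      refine lt_of_mul_lt_mul_left ?_ ha.le
      linarith

end ExtremalComplement

/-! ### Reversal of the vertices -/

theorem edgeSum_le_edgeSum {F F' : Finset (Finset ℕ)} {x : ℕ → ℝ} (hx : ∀ i, 0 ≤ x i)
    (h : ∀ e ∈ F, e ∉ F' → ∃ i ∈ e, x i = 0) : edgeSum F x ≤ edgeSum F' x := by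
  have h1 : edgeSum F x = ∑ e ∈ F with e ∈ F', ∏ i ∈ e, x i := by
    rw [sum_filter]
    refine sum_congr rfl fun e he => ?_
    split_ifs with heF
    · rfl
    · obtain ⟨i, hi, hi0⟩ := h e he heF
      exact prod_eq_zero hi hi0
  rw [h1]
  exact sum_le_sum_of_subset_of_nonneg (fun e he => (mem_filter.1 he).2)
    fun e _ _ => prod_nonneg fun i _ => hx i

theorem edgeSum_sdiff {F F' : Finset (Finset ℕ)} (h : F' ⊆ F) (x : ℕ → ℝ) :
    edgeSum (F \ F') x = edgeSum F x - edgeSum F' x := by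
  rw [edgeSum, edgeSum, edgeSum, ← sum_sdiff h]
  ring

/-- The image of a set under the reflection `i ↦ t + 1 - i`. -/
def reflect (t : ℕ) (e : Finset ℕ) : Finset ℕ := e.image fun i => t + 1 - i

theorem reflect_triple (t a b c : ℕ) :
    reflect t {a, b, c} = {t + 1 - a, t + 1 - b, t + 1 - c} := by
  simp [reflect, image_insert]

theorem triple_rev (a b c : ℕ) : ({a, b, c} : Finset ℕ) = {c, b, a} := by
  ext i
  simp only [mem_insert, mem_singleton]
  tauto

theorem reflect_reflect {t : ℕ} {e : Finset ℕ} (he : e ⊆ Icc 1 t) :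
    reflect t (reflect t e) = e := by
  rw [reflect, reflect, image_image]
  conv_rhs => rw [← image_id (s := e)]
  refine image_congr fun i hi => ?_
  have := mem_Icc.1 (he hi)
  simp only [Function.comp, id]
  omega

theorem injOn_sub {t : ℕ} {e : Finset ℕ} (he : e ⊆ Icc 1 t) :
    Set.InjOn (fun i => t + 1 - i) (e : Set ℕ) := by
  intro i hi j hj hij
  have h1 := mem_Icc.1 (he hi)
  have h2 := mem_Icc.1 (he hj)
  simp only at hij
  omega

theorem reflect_mem_triples {t : ℕ} {e : Finset ℕ} (he : e ∈ triples t) :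
    reflect t e ∈ triples t := by
  obtain ⟨hs, hc⟩ := mem_powersetCard.1 he
  refine mem_powersetCard.2 ⟨fun i hi => ?_, ?_⟩
  · obtain ⟨j, hj, rfl⟩ := mem_image.1 hi
    have := mem_Icc.1 (hs hj)
    rw [mem_Icc]
    omega
  · rw [reflect, card_image_of_injOn (injOn_sub hs), hc]

theorem injOn_reflect {t : ℕ} {F : Finset (Finset ℕ)} (hF : F ⊆ triples t) :
    Set.InjOn (reflect t) (F : Set (Finset ℕ)) := by
  intro e he f hf hef
  rw [← reflect_reflect (mem_powersetCard.1 (hF he)).1, hef,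
    reflect_reflect (mem_powersetCard.1 (hF hf)).1]

theorem mem_image_reflect {t : ℕ} {F : Finset (Finset ℕ)} (hF : F ⊆ triples t) {e : Finset ℕ}
    (he : e ∈ triples t) : e ∈ F.image (reflect t) ↔ reflect t e ∈ F := by
  constructor
  · intro h
    obtain ⟨f, hf, rfl⟩ := mem_image.1 h
    rwa [reflect_reflect (mem_powersetCard.1 (hF hf)).1]
  · intro h
    exact mem_image.2 ⟨_, h, reflect_reflect (mem_powersetCard.1 he).1⟩

theorem image_reflect_subset {t : ℕ} {F : Finset (Finset ℕ)} (hF : F ⊆ triples t) :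
    F.image (reflect t) ⊆ triples t := by
  intro e he
  obtain ⟨f, hf, rfl⟩ := mem_image.1 he
  exact reflect_mem_triples (hF hf)

theorem edgeSum_image_reflect {t : ℕ} {F : Finset (Finset ℕ)} (hF : F ⊆ triples t)
    {x y : ℕ → ℝ} (hxy : ∀ i ∈ Icc 1 t, y i = x (t + 1 - i)) :
    edgeSum (F.image (reflect t)) x = edgeSum F y := by
  rw [edgeSum, sum_image (injOn_reflect hF)]
  refine sum_congr rfl fun e he => ?_
  have hs := (mem_powersetCard.1 (hF he)).1
  rw [reflect, prod_image (injOn_sub hs)]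
  exact prod_congr rfl fun i hi => (hxy i (hs hi)).symm

theorem image_reflect_triples (t : ℕ) : (triples t).image (reflect t) = triples t := by
  refine Subset.antisymm (image_reflect_subset (Subset.refl _)) fun e he => ?_
  exact (mem_image_reflect (Subset.refl _) he).2 (reflect_mem_triples he)

theorem edgeSum_reflect_sdiff {t : ℕ} {F : Finset (Finset ℕ)} (hF : F ⊆ triples t) (x : ℕ → ℝ) :
    edgeSum (triples t) (fun i => x (t + 1 - i))
      - edgeSum ((triples t \ F).image (reflect t)) (fun i => x (t + 1 - i)) = edgeSum F x := by
  have e1 : ∀ i ∈ Icc 1 t, x i = x (t + 1 - (t + 1 - i)) := by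
    intro i hi
    rw [mem_Icc] at hi
    rw [show t + 1 - (t + 1 - i) = i by omega]
  have e2 : edgeSum (triples t) (fun i => x (t + 1 - i)) = edgeSum (triples t) x := by
    conv_lhs => rw [← image_reflect_triples t]
    exact edgeSum_image_reflect (Subset.refl _) e1
  rw [edgeSum_image_reflect sdiff_subset e1, e2, edgeSum_sdiff hF]
  ring

theorem sum_Icc_reflect (t : ℕ) (x : ℕ → ℝ) :
    ∑ i ∈ Icc 1 t, x (t + 1 - i) = ∑ i ∈ Icc 1 t, x i := by
  refine sum_bij' (fun i _ => t + 1 - i) (fun i _ => t + 1 - i) ?_ ?_ ?_ ?_ fun _ _ => rfl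
  all_goals
    intro i hi
    rw [mem_Icc] at hi
  · rw [mem_Icc]; omega
  · rw [mem_Icc]; omega
  · omega
  · omega

/-! ### From extremal graphs to extremal complements -/

namespace RGraph

theorem isLegalWeighting_of_support {r t : ℕ} {G : RGraph r} {x : ℕ → ℝ} (hx : ∀ i, 0 ≤ x i)
    (h0 : ∀ i, i ∉ Icc 1 t → x i = 0) (h1 : ∑ i ∈ Icc 1 t, x i = 1) (ht : t ≤ G.n) :
    G.IsLegalWeighting x := by
  refine ⟨fun i _ => hx i, ?_⟩
  rw [← h1]
  symm
  exact sum_subset (Icc_subset_Icc le_rfl ht) fun i _ hi => h0 i hi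

theorem IsLeftCompressed.triple_mem {G : RGraph 3} (hG : G.IsLeftCompressed) {a b c a' b' c' : ℕ}
    (ha : 1 ≤ a') (hab : a' < b') (hbc : b' < c') (h1 : a' ≤ a) (h2 : b' ≤ b) (h3 : c' ≤ c)
    (h : ({a, b, c} : Finset ℕ) ∈ G.edges) : ({a', b', c'} : Finset ℕ) ∈ G.edges := by
  have himg : ∀ u v w : ℕ, Finset.univ.image ![u, v, w] = {u, v, w} := by
    intro u v w
    ext i
    simp [Fin.exists_fin_succ, eq_comm]
  have := hG ![a', b', c'] ![a, b, c] ?_ ?_ ?_ (by rw [himg]; exact h)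
  · rwa [himg] at this
  · intro p q hpq
    fin_cases p <;> fin_cases q <;> simp at hpq ⊢ <;> omega
  · intro p
    fin_cases p <;> simp <;> omega
  · intro p
    fin_cases p <;> simp <;> omega

theorem mem_triples_of_mem_edges {G : RGraph 3} {e : Finset ℕ} (he : e ∈ G.edges) :
    e ∈ triples G.n := mem_powersetCard.2 ⟨G.subset_vertices e he, G.card_eq e he⟩

theorem IsExtremal.weightPoly_le {r : ℕ} {G H : RGraph r} (hG : G.IsExtremal)
    (hH : #H.edges = #G.edges) {x : ℕ → ℝ} (hx : H.IsLegalWeighting x) :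
    H.weightPoly x ≤ G.lagrangian :=
  (H.weightPoly_le_lagrangian hx).trans (hG.2 ⟨H, hH, rfl⟩)

/-- The `3`-graph on `[t]` with a given set of edges. -/
def ofTriples (t : ℕ) (F : Finset (Finset ℕ)) (hF : F ⊆ triples t) : RGraph 3 where
  n := t
  edges := F
  subset_vertices _ he := (mem_powersetCard.1 (hF he)).1
  card_eq _ he := (mem_powersetCard.1 (hF he)).2

/-- All edges of an extremal `3`-graph lie in the support of an optimal weighting, if there is
room for them. -/
theorem IsExtremal.edges_subset {G : RGraph 3} (hG : G.IsExtremal) {x : ℕ → ℝ} {t : ℕ}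
    (hx : G.IsOptimal x) (hpos : ∀ i ∈ Icc 1 t, 0 < x i) (h0 : ∀ i, i ∉ Icc 1 t → x i = 0)
    (hcard : #G.edges ≤ #(triples t)) : G.edges ⊆ triples t := by
  by_contra hcon
  obtain ⟨e, he, het⟩ := not_subset.1 hcon
  have hef : ∃ f ∈ triples t, f ∉ G.edges := by
    by_contra hall
    push Not at hall
    have : triples t = G.edges := eq_of_subset_of_card_le hall hcard
    exact hcon this.ge
  obtain ⟨f, hf, hfG⟩ := hef
  have htn : t ≤ G.n := by
    rcases Nat.eq_zero_or_pos t with h | h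
    · omega
    have := hpos t (mem_Icc.2 ⟨h, le_rfl⟩)
    by_contra hn
    exact this.ne' (hx.eq_zero t (by rw [mem_Icc]; omega))
  -- Exchanging the weightless edge `e` for `f`, of positive weight, keeps the number of edges and
  -- raises the value.
  have hH : insert f (G.edges.erase e) ⊆ triples G.n := by
    intro g hg
    rcases mem_insert.1 hg with rfl | hg
    · exact powersetCard_mono (Icc_subset_Icc le_rfl htn) hf
    · exact mem_triples_of_mem_edges (mem_of_mem_erase hg)
  have hfe : f ∉ G.edges.erase e := fun h => hfG (mem_of_mem_erase h)
  have h1 := hG.weightPoly_le (H := ofTriples G.n _ hH) (x := x)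
    (by
      change #(insert f (G.edges.erase e)) = _
      rw [card_insert_of_notMem hfe, card_erase_add_one he]) hx.legal
  have he0 : ∏ i ∈ e, x i = 0 := by
    have : ¬e ⊆ Icc 1 t := fun hs => het (mem_powersetCard.2 ⟨hs, G.card_eq e he⟩)
    obtain ⟨i, hi, hit⟩ := not_subset.1 this
    exact prod_eq_zero hi (h0 i hit)
  have hfp : 0 < ∏ i ∈ f, x i := prod_pos fun i hi => hpos i ((mem_powersetCard.1 hf).1 hi)
  have h2 : (ofTriples G.n _ hH).weightPoly x = G.weightPoly x + ∏ i ∈ f, x i := by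
    change ∑ g ∈ insert f (G.edges.erase e), _ = _
    rw [sum_insert hfe, weightPoly, ← add_sum_erase _ _ he, he0]
    ring
  rw [hx.lagrangian_eq] at h1
  linarith

/-- Non-edges are closed upwards, hence downwards after reversal; a competitor `N` comes from the
graph whose edges are the reversed triples outside `N`. -/
theorem IsExtremal.extremalComplement {G : RGraph 3} (hG : G.IsExtremal)
    (hcomp : G.IsLeftCompressed) {x : ℕ → ℝ} {t : ℕ}
    (hx : G.IsOptimal x) (hpos : ∀ i ∈ Icc 1 t, 0 < x i) (h0 : ∀ i, i ∉ Icc 1 t → x i = 0)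
    (hanti : ∀ i j, 1 ≤ i → i ≤ j → j ≤ t → x j ≤ x i)
    (ht : 3 ≤ t) (hsub : G.edges ⊆ triples t) (hmem : ({1, t - 1, t} : Finset ℕ) ∈ G.edges) :
    ExtremalComplement t ((triples t \ G.edges).image (reflect t)) (fun i => x (t + 1 - i)) := by
  have hT : triples t \ G.edges ⊆ triples t := sdiff_subset
  have hmemM : ∀ a b c, 1 ≤ a → a < b → b < c → c ≤ t →
      (({a, b, c} : Finset ℕ) ∈ (triples t \ G.edges).image (reflect t) ↔
        ({t + 1 - c, t + 1 - b, t + 1 - a} : Finset ℕ) ∉ G.edges) := by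
    intro a b c h1 h2 h3 h4
    rw [mem_image_reflect hT (triple_mem_triples h1 h2 h3 h4), reflect_triple, triple_rev,
      mem_sdiff, and_iff_right]
    exact triple_mem_triples (by omega) (by omega) (by omega) (by omega)
  have hlt : t ≤ G.n := by
    by_contra hn
    exact (hpos t (mem_Icc.2 (by omega))).ne' (hx.eq_zero t (by rw [mem_Icc]; omega))
  have hsumx : ∑ i ∈ Icc 1 t, x i = 1 := by
    rw [← hx.legal.2]
    exact sum_subset (Icc_subset_Icc le_rfl hlt) fun i _ hi => h0 i hi
  refine ⟨image_reflect_subset hT, ?_, ?_, ?_, ?_, ?_, ht, ?_⟩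
  · intro a b c a' b' c' h1 h2 h3 h4 h5 h6 h7 h8 hM
    have hc : c ≤ t := by
      have := (mem_powersetCard.1 (image_reflect_subset hT hM)).1
        (show c ∈ ({a, b, c} : Finset ℕ) by simp)
      exact (mem_Icc.1 this).2
    rw [hmemM a b c (by omega) h7 h8 hc] at hM
    rw [hmemM a' b' c' h1 h2 h3 (by omega)]
    exact fun h => hM (hcomp.triple_mem (by omega) (by omega) (by omega) (by omega) (by omega)
      (by omega) h)
  · intro i hi
    rw [mem_Icc] at hi
    exact hpos _ (mem_Icc.2 (by omega))
  · intro i j h1 h2 h3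
    exact hanti _ _ (by omega) (by omega) (by omega)
  · rw [sum_Icc_reflect t x, hsumx]
  · intro N hN hNM y hy hy1
    have hTN : triples t \ N ⊆ triples t := sdiff_subset
    have hleg : (ofTriples t _ (image_reflect_subset hTN)).IsLegalWeighting
        (fun i => y (t + 1 - i)) := by
      refine ⟨fun i hi => hy _ ?_, ?_⟩
      · have := mem_Icc.1 hi
        change 1 ≤ i ∧ i ≤ t at this
        rw [mem_Icc]; omega
      · exact (sum_Icc_reflect t y).trans hy1
    have h1 := hG.weightPoly_le (H := ofTriples t _ (image_reflect_subset hTN)) (by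
      change #((triples t \ N).image (reflect t)) = _
      rw [card_image_of_injOn (injOn_reflect hTN), card_sdiff_of_subset hN, hNM,
        card_image_of_injOn (injOn_reflect hT), card_sdiff_of_subset hsub]
      have := card_le_card hsub
      omega) hleg
    have h2 : (ofTriples t _ (image_reflect_subset hTN)).weightPoly (fun i => y (t + 1 - i))
        = edgeSum (triples t) y - edgeSum N y := by
      rw [← edgeSum_sdiff hN]
      refine edgeSum_image_reflect hTN fun i hi => ?_
      rw [mem_Icc] at hi
      rw [show t + 1 - (t + 1 - i) = i by omega]
    have h3 : edgeSum (triples t) (fun i => x (t + 1 - i))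
        - edgeSum ((triples t \ G.edges).image (reflect t)) (fun i => x (t + 1 - i))
        = G.weightPoly x := edgeSum_reflect_sdiff hsub x
    rw [h3, ← hx.lagrangian_eq, ← h2]
    exact h1
  · rw [hmemM 1 2 t le_rfl (by omega) (by omega) le_rfl, not_not]
    rw [show t + 1 - t = 1 by omega, show t + 1 - 2 = t - 1 by omega, Nat.add_sub_cancel]
    exact hmem

end RGraph

namespace ExtremalComplement

variable {t : ℕ} {M : Finset (Finset ℕ)} {z : ℕ → ℝ}

/-- The weighting obtained by merging the two lightest vertices. -/
theorem exists_weighting_of_mul_le_edgeSum (h : ExtremalComplement t M z)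
    (hM : z 1 * z 2 * (1 - z 1 - z 2) ≤ edgeSum M z) :
    ∃ y : ℕ → ℝ, (∀ i ∈ Icc 1 t, 0 ≤ y i) ∧ y 1 = 0 ∧ ∑ i ∈ Icc 1 t, y i = 1 ∧
      edgeSum (triples t) z - edgeSum M z ≤ edgeSum (triples t) y := by
  have h3 := h.three_le
  have m1 : 1 ∈ Icc 1 t := mem_Icc.2 (by omega)
  have m2 : 2 ∈ Icc 1 t := mem_Icc.2 (by omega)
  have hs : ∀ f : ℝ → ℝ, ∑ k ∈ Icc 1 t,
      f (Function.update (Function.update z 1 0) 2 (z 1 + z 2) k)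
      = f (z 1 + z 2) + (f 0 + (∑ k ∈ Icc 1 t, f (z k) - f (z 1)) - f (z 2)) := by
    intro f
    rw [sum_update m2, sum_update m1, Function.update_of_ne (by omega)]
  -- Only triples through both `1` and `2` are lost, so `e₃` drops by exactly `z 1 * z 2 * (1 - z 1
  -- - z 2)`.
  refine ⟨Function.update (Function.update z 1 0) 2 (z 1 + z 2), fun i hi => ?_, ?_, ?_, ?_⟩
  · by_cases i2 : i = 2
    · subst i2
      rw [Function.update_self]
      exact (add_pos (h.pos 1 m1) (h.pos 2 m2)).le
    · rw [Function.update_of_ne i2]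
      by_cases i1 : i = 1
      · subst i1
        rw [Function.update_self]
      · rw [Function.update_of_ne i1]
        exact (h.pos i hi).le
  · rw [Function.update_of_ne (by omega), Function.update_self]
  · rw [hs (fun u => u), h.sum_eq]
    ring
  · have e1 := edgeSum_powersetCard_three (Icc 1 t) z
    have e2 := edgeSum_powersetCard_three (Icc 1 t)
      (Function.update (Function.update z 1 0) 2 (z 1 + z 2))
    rw [hs (fun u => u), hs (fun u => u ^ 2), hs (fun u => u ^ 3), h.sum_eq] at e2
    rw [h.sum_eq] at e1
    unfold triples
    linarith

end ExtremalComplement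

/-! ### Comparison with the colex graph -/

theorem mem_colexFirst_triple_of_le {m i j t : ℕ} (hi : 1 ≤ i) (hij : i ≤ j) (hj : j + 1 < t)
    (h : ({j, t - 1, t} : Finset ℕ) ∈ colexFirst 3 m) :
    ({i, t - 1, t} : Finset ℕ) ∈ colexFirst 3 m := by
  rcases hij.eq_or_lt with rfl | hlt
  · exact h
  refine mem_colexFirst_of_lt h ?_ ?_ ?_
  · exact (mem_powersetCard.1 (triple_mem_triples hi (by omega) (by omega) le_rfl)).2
  · intro k hk
    simp only [mem_insert, mem_singleton] at hk
    omega
  · rw [Finset.Colex.toColex_lt_toColex_iff_exists_forall_lt]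
    refine ⟨j, by simp, ?_, ?_⟩
    · simp only [mem_insert, mem_singleton]
      omega
    · intro k hk hk'
      simp only [mem_insert, mem_singleton] at hk hk'
      omega

theorem mem_colexFirst_triple_of_lt {m i j b t : ℕ} (hi : 1 ≤ i) (hib : i < b) (hb : b + 1 < t)
    (h : ({j, t - 1, t} : Finset ℕ) ∈ colexFirst 3 m) :
    ({i, b, t} : Finset ℕ) ∈ colexFirst 3 m := by
  refine mem_colexFirst_of_lt h ?_ ?_ ?_
  · exact (mem_powersetCard.1 (triple_mem_triples hi hib (by omega) le_rfl)).2
  · intro k hk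
    simp only [mem_insert, mem_singleton] at hk
    omega
  · rw [Finset.Colex.toColex_lt_toColex_iff_exists_forall_lt]
    refine ⟨t - 1, by simp, ?_, ?_⟩
    · simp only [mem_insert, mem_singleton]
      omega
    · intro k hk hk'
      simp only [mem_insert, mem_singleton] at hk hk'
      omega

theorem card_triples (t : ℕ) : #(triples t) = t.choose 3 := by
  rw [triples, card_powersetCard, Nat.card_Icc, Nat.add_sub_cancel]

theorem card_image_reflect_sdiff {t : ℕ} {A B : Finset (Finset ℕ)} :
    #((triples t \ A).image (reflect t) \ (triples t \ B).image (reflect t)) ≤ #(B \ A) := by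
  have hsub : (triples t \ A).image (reflect t) \ (triples t \ B).image (reflect t)
      ⊆ (B \ A).image (reflect t) := by
    intro e he
    obtain ⟨h1, h2⟩ := mem_sdiff.1 he
    obtain ⟨f, hf, rfl⟩ := mem_image.1 h1
    obtain ⟨hfT, hfA⟩ := mem_sdiff.1 hf
    refine mem_image_of_mem _ (mem_sdiff.2 ⟨?_, hfA⟩)
    by_contra hfB
    exact h2 (mem_image_of_mem _ (mem_sdiff.2 ⟨hfT, hfB⟩))
  exact (card_le_card hsub).trans card_image_le

/-- Comparison of an extremal complement with the complement of an initial segment of the colex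
order, which is a lexicographically initial family. -/
theorem ExtremalComplement.eq_or_mul_le_edgeSum {t : ℕ} {M L : Finset (Finset ℕ)} {z : ℕ → ℝ}
    (h : ExtremalComplement t M z) (hL : L ⊆ triples t) (hcard : #M = #L) (hML : #(M \ L) ≤ 3)
    (hLM : #(L \ M) ≤ 3) (h1 : ∀ e ∈ L, 1 ∈ e)
    (hstar : ∀ i j, 3 ≤ i → i ≤ j → j ≤ t → ({1, 2, j} : Finset ℕ) ∈ L →
      ({1, 2, i} : Finset ℕ) ∈ L)
    (hlex : ∀ b c j, 3 ≤ b → b < c → c ≤ t → 3 ≤ j → j ≤ t → ({1, b, c} : Finset ℕ) ∈ L →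
      ({1, 2, j} : Finset ℕ) ∈ L) :
    M = L ∨ z 1 * z 2 * (1 - z 1 - z 2) ≤ edgeSum M z := by
  obtain ⟨p, hp3, hpt, hp⟩ := h.exists_cut
  have hMc := card_of_cut hp
  have hN1 : #{e ∈ M | 1 ∉ e} ≤ 3 := by
    refine le_trans (card_le_card fun e he => ?_) hML
    rw [mem_filter] at he
    exact mem_sdiff.2 ⟨he.1, fun hL => he.2 (h1 e hL)⟩
  by_cases hLs : L ⊆ starTriples (t + 1)
  · left
    have hD3 : #(M \ starTriples p) ≤ 3 := by
      refine le_trans (card_le_card fun e he => ?_) hML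
      obtain ⟨heM, heS⟩ := mem_sdiff.1 he
      refine mem_sdiff.2 ⟨heM, fun heL => heS ?_⟩
      obtain ⟨j, hj3, hjt, rfl⟩ := mem_starTriples.1 (hLs heL)
      exact mem_starTriples.2 ⟨j, hj3, (hp j hj3).1 heM, rfl⟩
    have hLcard := card_le_card hLs
    rw [card_starTriples] at hLcard
    -- The longer star fits into `[t]` because `#M = #L` is at most the size `t - 2` of the full
    -- star.
    have hD := h.sdiff_starTriples_eq_empty hp hD3 (by omega)
    have hMs : M = starTriples p :=
      Subset.antisymm (sdiff_eq_empty_iff_subset.1 hD) (starTriples_subset_of_cut hp)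
    rw [hMs, card_starTriples] at hcard
    rw [hMs]
    symm
    apply eq_of_subset_of_card_le
    · intro e he
      obtain ⟨j, hj3, hjt, rfl⟩ := mem_starTriples.1 (hLs he)
      have hsub : starTriples (j + 1) ⊆ L := by
        intro f hf
        obtain ⟨i, hi3, hij, rfl⟩ := mem_starTriples.1 hf
        exact hstar i j hi3 (by omega) (by omega) he
      have := card_le_card hsub
      rw [card_starTriples] at this
      exact mem_starTriples.2 ⟨j, hj3, by omega, rfl⟩
    · rw [card_starTriples, hcard]
  · right
    obtain ⟨e, heL, heS⟩ := not_subset.1 hLs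
    obtain ⟨a, b, c, ha, hab, hbc, hc, rfl⟩ := exists_eq_triple (hL heL)
    have ha1 : a = 1 := by
      have := h1 _ heL
      simp only [mem_insert, mem_singleton] at this
      omega
    subst ha1
    have hb3 : 3 ≤ b := by
      by_contra hb
      exact heS (mem_starTriples.2 ⟨c, by omega, by omega, by rw [show b = 2 by omega]⟩)
    have hSL : starTriples (t + 1) ⊆ L := by
      intro f hf
      obtain ⟨j, hj3, hjt, rfl⟩ := mem_starTriples.1 hf
      exact hlex b c j hb3 hbc hc hj3 (by omega) heL
    -- Here `L` is the full star and more. With `#M = #L`, the `d` star triples missing from `M` are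
    -- outnumbered by those of `M` outside the star.
    have hlt : #(starTriples (t + 1)) < #L :=
      card_lt_card ⟨hSL, hLs⟩
    rw [card_starTriples] at hlt
    have hd : #(starTriples (t + 1) \ starTriples p) ≤ 3 := by
      refine le_trans (card_le_card fun f hf => ?_) hLM
      obtain ⟨hf1, hf2⟩ := mem_sdiff.1 hf
      refine mem_sdiff.2 ⟨hSL hf1, fun hfM => hf2 ?_⟩
      obtain ⟨j, hj3, hjt, rfl⟩ := mem_starTriples.1 hf1
      exact mem_starTriples.2 ⟨j, hj3, (hp j hj3).1 hfM, rfl⟩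
    have hd' := le_card_sdiff (starTriples p) (starTriples (t + 1))
    rw [card_starTriples, card_starTriples] at hd'
    exact h.mul_le_edgeSum (d := t + 1 - p) hp (by omega) (by omega) (by omega) (by omega) hN1

theorem theorem1p12 (m : ℕ) (hm : 0 < m) (G : RGraph 3) (hGm : G.edges.card = m)
    (hcomp : G.IsLeftCompressed) (hext : G.IsExtremal)
    (hdiff : (symmDiff G.edges (colexGraph 3 m).edges).card ≤ 6) :
    G.lagrangian ≤ (colexGraph 3 m).lagrangian := by
  have hC : (colexGraph 3 m).edges = colexFirst 3 m := rfl
  rw [hC] at hdiff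
  have hCcard : #(colexFirst 3 m) = m := card_colexFirst (by omega)
  -- The two families have equal size, so the symmetric difference splits evenly.
  have hdiff' : #(G.edges \ colexFirst 3 m) ≤ 3 ∧ #(colexFirst 3 m \ G.edges) ≤ 3 := by
    have e1 : #(G.edges \ colexFirst 3 m) + #(colexFirst 3 m \ G.edges) ≤ 6 := by
      rw [← card_union_of_disjoint (disjoint_sdiff_sdiff)]
      exact hdiff
    have e2 := card_sdiff_add_card_inter G.edges (colexFirst 3 m)
    have e3 := card_sdiff_add_card_inter (colexFirst 3 m) G.edges
    rw [inter_comm] at e3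
    omega
  obtain ⟨t, ht3, htm, hmt⟩ : ∃ t, 3 ≤ t ∧ (t - 1).choose 3 < m ∧ m ≤ t.choose 3 := by
    have hex : ∃ t : ℕ, m ≤ t.choose 3 := ⟨m + 3, le_choose_add_self (by omega)⟩
    have hs := Nat.find_spec hex
    have h3 : 3 ≤ Nat.find hex := by
      by_contra hcon
      rw [Nat.choose_eq_zero_of_lt (by omega)] at hs
      omega
    exact ⟨Nat.find hex, h3, not_le.1 (Nat.find_min hex (by omega)), hs⟩
  have hCsub : colexFirst 3 m ⊆ triples t := colexFirst_subset_powersetCard (by omega) hmt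
  have hsubC : triples (t - 1) ⊆ colexFirst 3 m := powersetCard_subset_colexFirst (by omega) htm.le
  have htn : t ≤ (colexGraph 3 m).n := by
    by_contra hcon
    have : colexFirst 3 m ⊆ triples (t - 1) := by
      intro e he
      refine mem_powersetCard.2 ⟨?_, (colexGraph 3 m).card_eq e he⟩
      exact ((colexGraph 3 m).subset_vertices e he).trans (Icc_subset_Icc le_rfl (by omega))
    have := card_le_card this
    rw [hCcard, card_triples] at this
    omega
  have hn : 1 ≤ G.n := by
    obtain ⟨e, he⟩ := card_pos.1 (hGm ▸ hm)
    obtain ⟨i, hi⟩ := card_pos.1 (show 0 < #e by rw [G.card_eq e he]; omega)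
    have := mem_Icc.1 (G.subset_vertices e he hi)
    omega
  obtain ⟨x, k, hx, hpos, h0, hanti, hpair⟩ := hcomp.exists_isOptimal hn
  have hkn : k ≤ G.n := by
    rcases Nat.eq_zero_or_pos k with h | h
    · omega
    by_contra hk
    exact (hpos k (mem_Icc.2 ⟨h, le_rfl⟩)).ne' (hx.eq_zero k (by rw [mem_Icc]; omega))
  have hsumx : ∑ i ∈ Icc 1 k, x i = 1 := by
    rw [← hx.legal.2]
    exact sum_subset (Icc_subset_Icc le_rfl hkn) fun i _ hi => h0 i hi
  -- The pair `{k - 1, k}` is covered by an edge inside `[k]`, whose third vertex compresses to `1`.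
  have hlast : 3 ≤ k → ({1, k - 1, k} : Finset ℕ) ∈ G.edges := by
    intro hk
    obtain ⟨e, he, h1, h2, h3⟩ := hpair (k - 1) (mem_Icc.2 (by omega)) k (mem_Icc.2 (by omega))
      (by omega)
    obtain ⟨a, b, c, ha, hab, hbc, hc, rfl⟩ :=
      exists_eq_triple (t := k) (mem_powersetCard.2 ⟨h3, G.card_eq e he⟩)
    simp only [mem_insert, mem_singleton] at h1 h2
    exact hcomp.triple_mem le_rfl (by omega) (by omega) ha (by omega) (by omega) he
  have hlegal : k ≤ t → (colexGraph 3 m).IsLegalWeighting x := fun hkt =>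
    RGraph.isLegalWeighting_of_support hx.nonneg h0 hsumx (hkt.trans htn)
  rcases lt_trichotomy k t with hkt | rfl | hkt
  · rw [hx.lagrangian_eq]
    refine le_trans ?_ ((colexGraph 3 m).weightPoly_le_lagrangian (hlegal hkt.le))
    refine edgeSum_le_edgeSum hx.nonneg fun e he heC => ?_
    by_contra hcon
    push Not at hcon
    refine heC (hsubC (mem_powersetCard.2 ⟨fun i hi => ?_, G.card_eq e he⟩))
    have hik : i ∈ Icc 1 k := by
      by_contra hik
      exact hcon i hi (h0 i hik)
    exact Icc_subset_Icc le_rfl (by omega) hik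
  · have hGsub : G.edges ⊆ triples k :=
      hext.edges_subset hx hpos h0 (by rw [hGm, card_triples]; exact hmt)
    have hE := hext.extremalComplement hcomp hx hpos h0 hanti ht3 hGsub (hlast ht3)
    have hTG : triples k \ G.edges ⊆ triples k := sdiff_subset
    have hTC : triples k \ colexFirst 3 m ⊆ triples k := sdiff_subset
    have hmemL : ∀ a b c, 1 ≤ a → a < b → b < c → c ≤ k →
        (({a, b, c} : Finset ℕ) ∈ (triples k \ colexFirst 3 m).image (reflect k) ↔
          ({k + 1 - c, k + 1 - b, k + 1 - a} : Finset ℕ) ∉ colexFirst 3 m) := by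
      intro a b c h1 h2 h3 h4
      rw [mem_image_reflect hTC (triple_mem_triples h1 h2 h3 h4), reflect_triple, triple_rev,
        mem_sdiff, and_iff_right]
      exact triple_mem_triples (by omega) (by omega) (by omega) (by omega)
    have hk1 : k + 1 - 1 = k := by omega
    have hk2 : k + 1 - 2 = k - 1 := by omega
    have hcontains : ∀ e ∈ triples k \ colexFirst 3 m, k ∈ e := by
      intro e he
      obtain ⟨heT, heC⟩ := mem_sdiff.1 he
      obtain ⟨hs, hc⟩ := mem_powersetCard.1 heT
      by_contra hke
      refine heC (hsubC (mem_powersetCard.2 ⟨fun i hi => ?_, hc⟩))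
      have h1 := mem_Icc.1 (hs hi)
      have h2 : i ≠ k := fun h => hke (h ▸ hi)
      rw [mem_Icc]
      omega
    have hcases := hE.eq_or_mul_le_edgeSum (image_reflect_subset hTC) (by
        rw [card_image_of_injOn (injOn_reflect hTG), card_image_of_injOn (injOn_reflect hTC),
          card_sdiff_of_subset hGsub, card_sdiff_of_subset hCsub, hGm, hCcard])
      (card_image_reflect_sdiff.trans hdiff'.2)
      (card_image_reflect_sdiff.trans hdiff'.1) (by
        intro e he
        obtain ⟨f, hf, rfl⟩ := mem_image.1 he
        exact mem_image.2 ⟨k, hcontains f hf, by omega⟩) (by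
        intro i j h1 h2 h3
        rw [hmemL 1 2 j le_rfl (by omega) (by omega) h3,
          hmemL 1 2 i le_rfl (by omega) (by omega) (by omega), hk1, hk2]
        intro hj hi
        rcases h2.eq_or_lt with rfl | h2
        · exact hj hi
        · exact hj (mem_colexFirst_triple_of_le (by omega) (by omega) (by omega) hi)) (by
        intro b c j h1 h2 h3 h4 h5
        rw [hmemL 1 b c le_rfl (by omega) (by omega) h3,
          hmemL 1 2 j le_rfl (by omega) (by omega) h5, hk1, hk2]
        intro hb hj
        exact hb (mem_colexFirst_triple_of_lt (by omega) (by omega) (by omega) hj))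
    rcases hcases with heq | hle
    · have hGC : G.edges = colexFirst 3 m := by
        have e1 : triples k \ G.edges = triples k \ colexFirst 3 m := by
          ext e
          by_cases he : e ∈ triples k
          · have e2 := mem_image_reflect hTG (reflect_mem_triples he)
            have e3 := mem_image_reflect hTC (reflect_mem_triples he)
            rw [reflect_reflect (mem_powersetCard.1 he).1] at e2 e3
            rw [← e2, ← e3, heq]
          · exact iff_of_false (fun h => he (hTG h)) fun h => he (hTC h)
        rw [← _root_.sdiff_sdiff_eq_self hGsub, e1, _root_.sdiff_sdiff_eq_self hCsub]
      rw [hx.lagrangian_eq]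
      refine le_trans (le_of_eq ?_)
        ((colexGraph 3 m).weightPoly_le_lagrangian (hlegal le_rfl))
      rw [RGraph.weightPoly_eq_edgeSum, RGraph.weightPoly_eq_edgeSum, hGC, hC]
    -- Reversed back, the merged weighting vanishes at `k`, which lies in every triple of `[k]`
    -- missing from the colex graph; so nothing is lost there.
    · obtain ⟨y, hy0, hy1, hysum, hy⟩ := hE.exists_weighting_of_mul_le_edgeSum hle
      obtain ⟨w, hw⟩ : ∃ w : ℕ → ℝ, w = fun i => if i ∈ Icc 1 k then y (k + 1 - i) else 0 :=
        ⟨_, rfl⟩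
      have hwin : ∀ i ∈ Icc 1 k, w i = y (k + 1 - i) := fun i hi => by rw [hw]; exact if_pos hi
      have hwout : ∀ i, i ∉ Icc 1 k → w i = 0 := fun i hi => by rw [hw]; exact if_neg hi
      have hw0 : ∀ i, 0 ≤ w i := by
        intro i
        by_cases hi : i ∈ Icc 1 k
        · rw [hwin i hi]
          rw [mem_Icc] at hi
          exact hy0 _ (mem_Icc.2 (by omega))
        · rw [hwout i hi]
      have hwleg : (colexGraph 3 m).IsLegalWeighting w := by
        refine RGraph.isLegalWeighting_of_support hw0 hwout ?_ htn
        rw [sum_congr rfl hwin, sum_Icc_reflect, hysum]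
      rw [hx.lagrangian_eq]
      refine le_trans ?_ ((colexGraph 3 m).weightPoly_le_lagrangian hwleg)
      have e3 : edgeSum (triples k) y = edgeSum (triples k) w := by
        conv_lhs => rw [← image_reflect_triples k]
        exact edgeSum_image_reflect (Subset.refl _) hwin
      rw [RGraph.weightPoly_eq_edgeSum, ← edgeSum_reflect_sdiff hGsub x]
      refine hy.trans (e3.le.trans (edgeSum_le_edgeSum hw0 fun e he heC => ⟨k, ?_, ?_⟩))
      · exact hcontains e (mem_sdiff.2 ⟨he, heC⟩)
      · rw [hwin k (mem_Icc.2 (by omega)), Nat.add_sub_cancel_left, hy1]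
  · exfalso
    have hG1 : ∀ b, 2 ≤ b → b ≤ t → ({1, b, t + 1} : Finset ℕ) ∈ G.edges := fun b h1 h2 =>
      hcomp.triple_mem le_rfl (by omega) (by omega) le_rfl (by omega) (by omega)
        (hlast (by omega))
    have hinj : Set.InjOn (fun b : ℕ => ({1, b, t + 1} : Finset ℕ)) (Icc 2 t : Finset ℕ) := by
      intro b hb c hc hbc
      rw [coe_Icc, Set.mem_Icc] at hb hc
      have : b ∈ ({1, c, t + 1} : Finset ℕ) := by
        rw [← show ({1, b, t + 1} : Finset ℕ) = {1, c, t + 1} from hbc]; simp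
      simp only [mem_insert, mem_singleton] at this
      omega
    have hsub : (Icc 2 t).image (fun b : ℕ => ({1, b, t + 1} : Finset ℕ))
        ⊆ G.edges \ colexFirst 3 m := by
      intro e he
      obtain ⟨b, hb, rfl⟩ := mem_image.1 he
      rw [mem_Icc] at hb
      refine mem_sdiff.2 ⟨hG1 b hb.1 hb.2, fun hmem => ?_⟩
      have := mem_Icc.1 ((mem_powersetCard.1 (hCsub hmem)).1
        (show t + 1 ∈ ({1, b, t + 1} : Finset ℕ) by simp))
      omega
    have hle := (card_le_card hsub).trans hdiff'.1
    rw [card_image_of_injOn hinj, Nat.card_Icc] at hle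
    have hbig : ∀ F : Finset (Finset ℕ), F ⊆ G.edges → #F ≤ t.choose 3 := fun F hF =>
      (card_le_card hF).trans (hGm ▸ hmt)
    -- The `t - 1` triples `{1, b, t + 1}` all lie in `G` but not in `C`, so `t - 1 ≤ 3`. For the
    -- two remaining values the edges forced by compression exceed `t.choose 3`.
    rcases (show t = 3 ∨ t = 4 by omega) with rfl | rfl
    · have := hbig {{1, 2, 4}, {1, 3, 4}} (by
        intro e he
        simp only [mem_insert, mem_singleton] at he
        rcases he with rfl | rfl
        · exact hG1 2 (by omega) (by omega)
        · exact hG1 3 (by omega) (by omega))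
      exact absurd this (by decide)
    · have h5 : ∀ b c, 2 ≤ b → b < c → c ≤ 5 → ({1, b, c} : Finset ℕ) ∈ G.edges :=
        fun b c h1 h2 h3 => hcomp.triple_mem le_rfl (by omega) h2 le_rfl (by omega) (by omega)
          (hG1 4 (by omega) (by omega))
      have := hbig {{1, 2, 3}, {1, 2, 4}, {1, 2, 5}, {1, 3, 4}, {1, 3, 5}} (by
        intro e he
        simp only [mem_insert, mem_singleton] at he
        rcases he with rfl | rfl | rfl | rfl | rfl <;>
          exact h5 _ _ (by omega) (by omega) (by omega))
      exact absurd this (by decide)
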